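/- **Setting.** Let $N\ge 1$, let $\pi'$ be a dominant permutation of $\{2,\dots,N\}$ other than the identity, and let $\pi=1\pi'\in S_N$ (so $\pi(1)=1$). Boxes $(a,b)$ of the $N\times N$ grid are (row, column). The diagram of $\pi$ is $D(\pi)=\{(\pi_j,i): i<j,\ \pi_i>\pi_j\}$; dominance means that $D(\pi)$ is the diagram of a partition whose north-west-most box is $(2,2)$. Let $Ess(\pi)$ be the set of south-east corners of $D(\pi)$, $NW(\pi)$ the set of boxes weakly north-west of some box of $D(\pi)$, and $L(\pi)=NW(\pi)\setminus dom(\pi)$, where $dom(\pi)$ is the connected component of $D(\pi)$ containing $(1,1)$ (here empty). **Moment polytope.** Let $Y_\pi$ be the projection to the entries in $L(\pi)$ of the matrix Schubert variety $\overline{B_-\pi B_+}\subset M_N(\mathbb C)$ (Zariski closure; $\pi$ also denotes the matrix with $1$ at $(\pi(j),j)$, and $B_\mp$ are the invertible lower/upper triangular matrices). Write $x_1,\dots,x_N,y_1,\dots,y_N$ for the standard basis of $\mathbb R^{N}\times\mathbb R^N$. The moment polytope $\Phi(\mathbb P(Y_\pi))$ is the convex hull of the torus weights $x_i-y_j$ of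 those coordinates $(i,j)\in L(\pi)$ that do not vanish identically on $Y_\pi$. **Pipe dream complex and core.** $PD(\pi)$ is the subword complex $\Delta(Q,\pi)$ of the triangular word $Q=(s_{N-1},s_{N-2},s_{N-1},\dots,s_1,\dots,s_{N-1})$, that is, the simplicial complex on the positions of $Q$ whose facets are the sets $F$ such that the subword $Q\setminus F$ is a reduced expression for $\pi$. The positions are identified with the boxes $(i,j)$, $i+j\le N$, with letter $s_{i+j-1}$, rows being read from bottom to top and each row from left to right. Let the bottom (resp. top) reduced pipe dream be obtained by aligning the boxes of $D(\pi)$ to the left (resp. to the top) and taking them as crosses; let $cr(\pi)$ be the union of these two sets of crosses. The core $\mathcal C(\pi)$ is the restriction of $PD(\pi)$ to the vertices in $cr(\pi)$, and $\mathcal C^{k}(\pi)$ is $\mathcal C(\pi)$ coned over $k$ times. **The tree $T(\pi)$.** Let $R(\pi)=cr(\pi)\cup\{(1,1)\}$ and traverse its south-east boundary from the south-west to the north-east corner by steps $E$ and $N$. Let $A$ consist of all $N$ steps and of those $E$ steps whose column contains no box of $Ess(\pi)$. Label the steps in $A$ by $1,\dots,m=|A|$ in the order of traversal; give each $E$ step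 not in $A$ the label of the $N$ step directly preceding it. Place a dot in every box of $R(\pi)$ that is not a cross of the bottom reduced pipe dream, and let the dots in each column drop to the southernmost boxes of $R(\pi)$ in that column. $T(\pi)$ is the graph on $\{1,\dots,m\}$ with an edge between $i<j$ whenever there is a dropped dot in the column of an $E$ step labelled $i$ and the row of the $N$ step labelled $j$. **Canonical triangulations.** For a graph $G$ on $\{1,\dots,m\}$ let $\mathcal P(G)\subset\mathbb R^m$ be the convex hull of $0$ and all $e_i-e_j$ $(i<j)$ lying in the cone spanned by the vectors $e_i-e_j$, $i<j$, $\{i,j\}\in E(G)$. The top-dimensional simplices of the canonical triangulation of $\mathcal P(T(\pi))$ are the $\Delta=\mathcal P(S)$, where $S$ runs over the noncrossing alternating spanning trees of the directed transitive closure of $T(\pi)$ (edges directed from smaller to larger; noncrossing: no edges $\{i,k\},\{j,l\}$ with $i<j<k<l$; alternating: no vertex has both an incoming and an outgoing edge). Define linear maps $K$ and $L$ by $K(x_i)=x_i$; $K(y_j)=x_i$ if $(i,j)\in Ess(\pi)$, and $K(y_j)=y_j$ if no box of column $j$ is in $Ess(\pi)$; $L(x_i)=-e_k$ with $k$ the label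 of the $N$ step on row $i$; $L(y_j)=0$ if column $j$ contains a box of $Ess(\pi)$, and otherwise $L(y_j)=-e_k$ with $k$ the label of the $E$ step on column $j$. The canonical triangulation of $\Phi(\mathbb P(Y_\pi))$ is the triangulation of $\Phi(\mathbb P(Y_\pi))$ whose maximal simplices are the sets $\Phi(\mathbb P(Y_\pi))\cap(L\circ K)^{-1}(\Delta)$. **Theorem.** The canonical triangulation of $\Phi(\mathbb P(Y_\pi))$ exists (that is, there is a geometric simplicial complex with underlying space $\Phi(\mathbb P(Y_\pi))$ and exactly these maximal simplices), and it is a geometric realization of $\mathcal C^{|Ess(\pi)|+1}(\pi)$: its abstract simplicial complex is isomorphic to the core of $PD(\pi)$ coned over $|Ess(\pi)|+1$ times. -/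

import Mathlib

namespace SchubertCore

/-! Rows and columns are numbered from `0`, so the box written `(1,1)` on paper is `(0, 0)` here,
and the adjacent transposition `s_1` is `simpleRefl 0`. -/

/-- Boxes (row, column) of the `N × N` grid. The product order has `p ≤ q` iff `p` is weakly
north-west of `q`. -/
abbrev Box (N : ℕ) := Fin N × Fin N

/-! ### Diagrams -/

section Diagrams

variable {N : ℕ}

/-- The Rothe diagram `{(π_j, i) : i < j, π_i > π_j}`. -/
def rothe (π : Equiv.Perm (Fin N)) : Finset (Box N) :=
  Finset.univ.filter fun p => ∃ i j : Fin N, i < j ∧ π j < π i ∧ p = (π j, i)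

/-- A permutation is dominant when its diagram is the diagram of a partition, justified to the
north-west corner. -/
def IsDominant (π : Equiv.Perm (Fin N)) : Prop :=
  IsLowerSet (rothe π : Set (Box N))

/-- `q` is the neighbour of `p` immediately to the south or immediately to the east. -/
def IsSouthEastNeighbour (p q : Box N) : Prop :=
  (q.1.val = p.1.val + 1 ∧ q.2 = p.2) ∨ (q.1 = p.1 ∧ q.2.val = p.2.val + 1)

open Classical in
/-- Fulton's essential set: the south-east corners of the diagram. -/
noncomputable def essentialSet (π : Equiv.Perm (Fin N)) : Finset (Box N) :=
  (rothe π).filter fun p => ∀ q, IsSouthEastNeighbour p q → q ∉ rothe π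

/-- The dominant piece: the connected component of the diagram that contains the north-west box of
the grid (empty if that box is not in the diagram). -/
def dominantPiece (π : Equiv.Perm (Fin N)) : Set (Box N) :=
  {p | ∃ o ∈ rothe π, o.1.val = 0 ∧ o.2.val = 0 ∧
    Relation.ReflTransGen
      (fun u v : Box N => v ∈ rothe π ∧ (IsSouthEastNeighbour u v ∨ IsSouthEastNeighbour v u)) o p}

/-- `NW(π)`: the boxes weakly north-west of some box of the diagram. -/
def regionNW (π : Equiv.Perm (Fin N)) : Set (Box N) :=
  {p | ∃ q ∈ rothe π, p ≤ q}

/-- `L(π) = NW(π) \ dom(π)`. -/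
def regionL (π : Equiv.Perm (Fin N)) : Set (Box N) :=
  regionNW π \ dominantPiece π

end Diagrams

/-! ### Matrix Schubert varieties and the moment polytope -/

section Varieties

variable {N : ℕ}

/-- The permutation matrix: entry `(i, j)` is `1` iff `π(j) = i`. -/
def permMatrix (π : Equiv.Perm (Fin N)) : Matrix (Fin N) (Fin N) ℂ :=
  Matrix.of fun i j => if π j = i then 1 else 0

/-- The orbit `B₋ π B₊`; `X` is lower triangular invertible, `Y` is upper triangular invertible. -/
def borelOrbit (π : Equiv.Perm (Fin N)) : Set (Matrix (Fin N) (Fin N) ℂ) :=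
  {M | ∃ X Y : Matrix (Fin N) (Fin N) ℂ,
    (∀ i j, i < j → X i j = 0) ∧ IsUnit X.det ∧
    (∀ i j, j < i → Y i j = 0) ∧ IsUnit Y.det ∧
    M = X * permMatrix π * Y}

/-- The matrix Schubert variety: the Zariski closure of `B₋ π B₊` in the space of matrices. -/
def matrixSchubert (π : Equiv.Perm (Fin N)) : Set (Matrix (Fin N) (Fin N) ℂ) :=
  {M | ∀ f : MvPolynomial (Box N) ℂ,
    (∀ X ∈ borelOrbit π, MvPolynomial.eval (fun p : Box N => X p.1 p.2) f = 0) →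
      MvPolynomial.eval (fun p : Box N => M p.1 p.2) f = 0}

/-- `Y_π`: the projection of the matrix Schubert variety to the entries in `L(π)`. -/
def varietyY (π : Equiv.Perm (Fin N)) : Set (regionL π → ℂ) :=
  (fun M p => M p.1.1 p.1.2) '' matrixSchubert π

/-- The weight `x_i - y_j` with which the torus of pairs of invertible diagonal matrices acts on
the `(i, j)` entry of a matrix by `(A, B) · M = A M B⁻¹`. The standard basis vector of index
`Sum.inl i` is `x_i`, that of index `Sum.inr j` is `y_j`. -/
def weight (p : Box N) : Fin N ⊕ Fin N → ℝ :=
  Pi.single (Sum.inl p.1) 1 - Pi.single (Sum.inr p.2) 1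

/-- The moment polytope `Φ(ℙ(Y_π))`: the convex hull of the torus weights of the coordinates that
do not vanish at a general point of `Y_π`, that is, of the coordinates that do not vanish
identically on the irreducible cone `Y_π`. -/
def momentPolytope (π : Equiv.Perm (Fin N)) : Set (Fin N ⊕ Fin N → ℝ) :=
  convexHull ℝ {v | ∃ p : regionL π, (∃ z ∈ varietyY π, z p ≠ 0) ∧ v = weight p.1}

end Varieties

/-! ### Subword complexes and pipe dream complexes -/

section Subword

variable {n : ℕ}

/-- The adjacent transpositions in the symmetric group on `n + 1` letters. -/
def simpleRefl (k : Fin n) : Equiv.Perm (Fin (n + 1)) :=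
  Equiv.swap k.castSucc k.succ

/-- The product of a word, from left to right. -/
def wordProd (w : List (Fin n)) : Equiv.Perm (Fin (n + 1)) :=
  (w.map simpleRefl).prod

/-- `w` is a reduced expression for `π`. -/
def IsReducedExpression (w : List (Fin n)) (π : Equiv.Perm (Fin (n + 1))) : Prop :=
  wordProd w = π ∧ ∀ w' : List (Fin n), wordProd w' = π → w.length ≤ w'.length

open Classical in
/-- The facets of the subword complex `Δ(Q, π)`. The word `Q` is given by the list `Q` of its
positions (without repetitions) and by the letter at each position. A set `F` of positions is a
facet when the subword of `Q` on the complement of `F` is a reduced expression for `π`. -/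
def IsSubwordFacet {V : Type*} (Q : List V) (letter : V → Fin n) (π : Equiv.Perm (Fin (n + 1)))
    (F : Finset V) : Prop :=
  (∀ v ∈ F, v ∈ Q) ∧ IsReducedExpression ((Q.filter fun v => v ∉ F).map letter) π

/-- The subword complex: the simplicial complex with the facets above. (As always in Mathlib's
simplicial complexes the empty face is not listed.) -/
def subwordComplex {V : Type*} (Q : List V) (letter : V → Fin n) (π : Equiv.Perm (Fin (n + 1))) :
    PreAbstractSimplicialComplex V where
  faces := {F | F.Nonempty ∧ ∃ G, IsSubwordFacet Q letter π G ∧ F ⊆ G}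
  isRelLowerSet_faces := fun _ hF =>
    ⟨hF.1, fun _ hle hne => ⟨hne, hF.2.imp fun _ hG => ⟨hG.1, hle.trans hG.2⟩⟩⟩

/-- The boxes of the triangular staircase: those `(i, j)` with `i + j ≤ n + 1` in numbering from
`1`, in the symmetric group on `n + 1` letters. -/
abbrev TriBox (n : ℕ) := {p : Box (n + 1) // p.1.val + p.2.val < n}

/-- The letter in the box `(i, j)`: it is `s_{i+j-1}` in numbering from `1`. -/
def triLetter (p : TriBox n) : Fin n := ⟨p.1.1.val + p.1.2.val, p.2⟩

/-- The positions of the triangular word `(s_{N-1}, s_{N-2}, s_{N-1}, …, s_1, s_2, …, s_{N-1})`,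
`N = n + 1`: the rows of the staircase from bottom to top, each row read from left to right. -/
def triWord (n : ℕ) : List (TriBox n) :=
  (List.finRange (n + 1)).reverse.flatMap fun i =>
    (List.finRange (n + 1)).filterMap fun j =>
      if h : i.val + j.val < n then some ⟨(i, j), h⟩ else none

/-- The pipe dream complex `PD(π)`. -/
def pipeDreamComplex (π : Equiv.Perm (Fin (n + 1))) : PreAbstractSimplicialComplex (TriBox n) :=
  subwordComplex (triWord n) triLetter π

/-- The crosses of the bottom reduced pipe dream: the diagram aligned to the left. -/
def bottomCrosses (π : Equiv.Perm (Fin (n + 1))) : Finset (Box (n + 1)) :=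
  Finset.univ.filter fun p => p.2.val < ((rothe π).filter fun q => q.1 = p.1).card

/-- The crosses of the top reduced pipe dream: the diagram aligned to the top. -/
def topCrosses (π : Equiv.Perm (Fin (n + 1))) : Finset (Box (n + 1)) :=
  Finset.univ.filter fun p => p.1.val < ((rothe π).filter fun q => q.2 = p.2).card

/-- The core region `cr(π)`: the superimposition of the two pipe dreams. -/
def coreRegion (π : Equiv.Perm (Fin (n + 1))) : Finset (Box (n + 1)) :=
  bottomCrosses π ∪ topCrosses π

/-- The core `𝒞(π)`: the restriction of the pipe dream complex to the vertices in the core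
region. -/
def core (π : Equiv.Perm (Fin (n + 1))) : PreAbstractSimplicialComplex (TriBox n) where
  faces := {F | F ∈ (pipeDreamComplex π).faces ∧ ∀ v ∈ F, v.1 ∈ coreRegion π}
  isRelLowerSet_faces := fun _ hF =>
    ⟨((pipeDreamComplex π).isRelLowerSet_faces hF.1).1, fun _ hle hne =>
      ⟨((pipeDreamComplex π).isRelLowerSet_faces hF.1).2 hle hne, fun v hv => hF.2 v (hle hv)⟩⟩

/-- `C` coned over `k` times: there are `k` new vertices, and a nonempty set of vertices is a face
iff its old vertices form a face of `C` (or there are none). -/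
def iteratedCone {V : Type*} (C : PreAbstractSimplicialComplex V) (k : ℕ) :
    PreAbstractSimplicialComplex (V ⊕ Fin k) where
  faces := {F | F.Nonempty ∧ (F.toLeft = ∅ ∨ F.toLeft ∈ C.faces)}
  isRelLowerSet_faces := by
    rintro F ⟨hF, h⟩
    refine ⟨hF, fun G hle hne => ⟨hne, ?_⟩⟩
    have hsub : G.toLeft ⊆ F.toLeft := Finset.toLeft_subset_toLeft hle
    rcases G.toLeft.eq_empty_or_nonempty with h0 | h0
    · exact Or.inl h0
    · rcases h with h | h
      · exact absurd (hsub.trans_eq h) (by simpa [Finset.subset_empty] using h0.ne_empty)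
      · exact Or.inr ((C.isRelLowerSet_faces h).2 hsub h0)

end Subword

/-! ### Acyclic root polytopes and their canonical triangulations -/

section RootPolytope

variable {m : ℕ}

/-- `e_i - e_j`. -/
def rootVec (i j : Fin m) : Fin m → ℝ := Pi.single i 1 - Pi.single j 1

/-- The vectors `e_i - e_j`, `i < j`, of the edges of a graph. -/
def edgeVectors (G : SimpleGraph (Fin m)) : Set (Fin m → ℝ) :=
  {v | ∃ i j, i < j ∧ G.Adj i j ∧ v = rootVec i j}

/-- The cone of a graph: nonnegative combinations of its edge vectors. -/
def graphCone (G : SimpleGraph (Fin m)) : Set (Fin m → ℝ) :=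
  {v | ∃ c : Fin m → Fin m → ℝ, (∀ i j, 0 ≤ c i j) ∧
    (∀ i j, ¬(i < j ∧ G.Adj i j) → c i j = 0) ∧ v = ∑ i, ∑ j, c i j • rootVec i j}

/-- The acyclic root polytope `𝒫(G)`: the convex hull of `0` and of all positive roots in the
cone of `G`. -/
def rootPolytope (G : SimpleGraph (Fin m)) : Set (Fin m → ℝ) :=
  convexHull ℝ ({0} ∪ ({v | ∃ i j, i < j ∧ v = rootVec i j} ∩ graphCone G))

/-- The directed transitive closure, the edges being directed from the smaller to the larger
vertex. -/
def transClosure (G : SimpleGraph (Fin m)) : SimpleGraph (Fin m) :=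
  SimpleGraph.fromRel (Relation.TransGen fun i j => i < j ∧ G.Adj i j)

/-- No two edges cross when drawn above a line carrying the vertices in their order. -/
def IsNoncrossing (G : SimpleGraph (Fin m)) : Prop :=
  ∀ i j k l, i < j → j < k → k < l → ¬(G.Adj i k ∧ G.Adj j l)

/-- No vertex has both an incoming and an outgoing edge. -/
def IsAlternating (G : SimpleGraph (Fin m)) : Prop :=
  ∀ i j k, i < j → j < k → ¬(G.Adj i j ∧ G.Adj j k)

/-- The top dimensional simplices of the canonical triangulation of `𝒫(G)`: the polytopes `𝒫(S)`
of the noncrossing alternating spanning trees `S` of the directed transitive closure of `G`. -/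
def canonicalCells (G : SimpleGraph (Fin m)) : Set (Set (Fin m → ℝ)) :=
  {Δ | ∃ S : SimpleGraph (Fin m), S ≤ transClosure G ∧ S.IsTree ∧ IsNoncrossing S ∧
    IsAlternating S ∧ Δ = rootPolytope S}

end RootPolytope

/-! ### The tree `T(π)` and the canonical triangulation of the moment polytope -/

section Degeneration

variable {n : ℕ}

/-- The region `R(π)`: the core region together with the north-west box of the grid. -/
def regionR (π : Equiv.Perm (Fin (n + 1))) : Finset (Box (n + 1)) :=
  insert (0, 0) (coreRegion π)

/-- The steps of the south-east boundary of `R(π)`, from its south-west to its north-east corner: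
`Sum.inl a` is the `N` step on row `a` and `Sum.inr b` is the `E` step on column `b`. -/
abbrev Step (n : ℕ) := Fin (n + 1) ⊕ Fin (n + 1)

/-- The order in which the boundary steps are traversed. The `E` step on column `b` comes before
the `N` step on row `a` iff the box `(a, b)` belongs to the region. -/
def stepBefore (π : Equiv.Perm (Fin (n + 1))) : Step n → Step n → Prop
  | Sum.inl a, Sum.inl a' => a' < a
  | Sum.inr b, Sum.inr b' => b < b'
  | Sum.inr b, Sum.inl a => (a, b) ∈ regionR π
  | Sum.inl a, Sum.inr b => (a, b) ∉ regionR π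

open Classical in
/-- The set `A`: all `N` steps, and those `E` steps that do not bound a box of the essential set,
that is, whose column contains no box of the essential set. -/
noncomputable def labelledSteps (π : Equiv.Perm (Fin (n + 1))) : Finset (Step n) :=
  Finset.univ.filter fun s =>
    match s with
    | Sum.inl a => ∃ b, (a, b) ∈ regionR π
    | Sum.inr b => (∃ a, (a, b) ∈ regionR π) ∧ ∀ a, (a, b) ∉ essentialSet π

open Classical in
/-- The label of a boundary step. The steps in `A` are labelled `0, 1, …, |A| - 1` in the order of
traversal; an `E` step outside `A` carries the label of the `N` step directly preceding it, which
is the last step of `A` before it. -/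
noncomputable def stepLabel (π : Equiv.Perm (Fin (n + 1))) (s : Step n) : ℕ :=
  if s ∈ labelledSteps π then ((labelledSteps π).filter fun t => stepBefore π t s).card
  else ((labelledSteps π).filter fun t => stepBefore π t s).card - 1

/-- The dropped dots: put a dot in each box of `R(π)` that is not a cross of the bottom reduced
pipe dream and let the dots of each column fall south within `R(π)`; with `k` dots in a column,
they end up in the `k` southernmost boxes of `R(π)` in that column. -/
def droppedDots (π : Equiv.Perm (Fin (n + 1))) : Finset (Box (n + 1)) :=
  (regionR π).filter fun p =>
    ((regionR π).filter fun q => q.2 = p.2 ∧ p.1 < q.1).card <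
      ((regionR π).filter fun q => q.2 = p.2 ∧ q ∉ bottomCrosses π).card

/-- The tree `T(π)` on the `|A|` labels: each dropped dot `(a, b)` gives the edge between the label
of the `E` step on column `b` and the label of the `N` step on row `a`. -/
def treeT (π : Equiv.Perm (Fin (n + 1))) : SimpleGraph (Fin (labelledSteps π).card) :=
  SimpleGraph.fromRel fun i j =>
    ∃ p ∈ droppedDots π, stepLabel π (Sum.inr p.2) = i.val ∧ stepLabel π (Sum.inl p.1) = j.val

open Classical in
/-- The linear map `K`: it fixes every `x_i`, it sends `y_j` to `x_i` if `(i, j)` is in the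
essential set, and it fixes the other `y_j`. -/
noncomputable def mapK (π : Equiv.Perm (Fin (n + 1))) :
    (Fin (n + 1) ⊕ Fin (n + 1) → ℝ) →ₗ[ℝ] (Fin (n + 1) ⊕ Fin (n + 1) → ℝ) :=
  (Pi.basisFun ℝ (Fin (n + 1) ⊕ Fin (n + 1))).constr ℝ fun s =>
    match s with
    | Sum.inl i => Pi.single (Sum.inl i) 1
    | Sum.inr j =>
      if h : ∃ i, (i, j) ∈ essentialSet π then Pi.single (Sum.inl h.choose) 1
      else Pi.single (Sum.inr j) 1

open Classical in
/-- The linear map `L`: it sends `x_i` to `-e_k`, with `k` the label of the `N` step on row `i`,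
and `y_j` to `0` if column `j` contains a box of the essential set and else to `-e_k`, with `k` the
label of the `E` step on column `j`. (The moment polytope lies in the span of those `x_i`, `y_j`
whose row or column carries a boundary step; the values elsewhere are irrelevant.) -/
noncomputable def mapL (π : Equiv.Perm (Fin (n + 1))) :
    (Fin (n + 1) ⊕ Fin (n + 1) → ℝ) →ₗ[ℝ] (Fin (labelledSteps π).card → ℝ) :=
  (Pi.basisFun ℝ (Fin (n + 1) ⊕ Fin (n + 1))).constr ℝ fun s =>
    match s with
    | Sum.inl i => fun k => if k.val = stepLabel π (Sum.inl i) then -1 else 0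
    | Sum.inr j =>
      if ∃ i, (i, j) ∈ essentialSet π then 0
      else fun k => if k.val = stepLabel π (Sum.inr j) then -1 else 0

/-- `K` is the canonical triangulation of the moment polytope `Φ(ℙ(Y_π))`: it is a triangulation of
this polytope (a simplicial complex with the polytope as underlying space), and its maximal simplices
are the preimages in `Φ(ℙ(Y_π))`, under the map `L ∘ K`, of the top dimensional simplices of the
canonical triangulation of `𝒫(T(π))`. (A finite simplicial complex is determined by its
maximal simplices.) -/
structure IsCanonicalTriangulation (π : Equiv.Perm (Fin (n + 1)))
    (K : Geometry.SimplicialComplex ℝ (Fin (n + 1) ⊕ Fin (n + 1) → ℝ)) : Prop where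
  space_eq : K.space = momentPolytope π
  cells_eq : {P | ∃ s ∈ K.facets, P = convexHull ℝ (s : Set (Fin (n + 1) ⊕ Fin (n + 1) → ℝ))} =
    {P | ∃ Δ ∈ canonicalCells (treeT π), P = momentPolytope π ∩ (mapL π ∘ₗ mapK π) ⁻¹' Δ}

end Degeneration

open Classical in
/-- The geometric simplicial complex `K` is a geometric realization of the abstract simplicial
complex `C`: there is an assignment of points to the vertices of `C`, injective on the vertices,
under which the faces of `C` become exactly the vertex sets of the simplices of `K`. -/
def IsGeometricRealization {V E : Type*} [AddCommGroup E] [Module ℝ E]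
    (K : Geometry.SimplicialComplex ℝ E) (C : PreAbstractSimplicialComplex V) : Prop :=
  ∃ φ : V → E, Set.InjOn φ {v | {v} ∈ C.faces} ∧
    K.faces = (fun F : Finset V => F.image φ) '' C.faces

/-- The permutation `1π'` on `n + 1` letters: it fixes the first letter and acts as `π'` on the
remaining ones. -/
def oneCons {n : ℕ} (π' : Equiv.Perm (Fin n)) : Equiv.Perm (Fin (n + 1)) :=
  Equiv.Perm.decomposeFin.symm (0, π')

end SchubertCore

/-! Write Λ for NW(π), which here equals L(π). It is a Ferrers shape, and no coordinate vanishes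
identically on Y_π, so the moment polytope is the convex hull of the weights x_i - y_j of all boxes
of Λ. Everything is governed by one relation: two boxes conflict when one lies strictly south-west
of the other and the south-east corner of the rectangle they span is in Λ. The weights of two
conflicting boxes have the same sum as those of the other two corners, which also lie in Λ.
Conflict-free sets of boxes then describe all three objects of the theorem.

Polytope: uncrossing conflicting pairs writes every point with a conflict-free support
(`exists_conflictFree_weightSum`), and a nonnegative combination with conflict-free support is
determined by its value (`eq_of_weightSum_eq`). Hence the conflict-free sets span the simplices of a
triangulation, `conflictFreeComplex`.

Pipe dreams: in a rectangle from the north-west corner of the grid to a box of the diagram, only the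
first pipe may run from the top side to the left side, and this forbids elbows strictly south-west
of one another (`le_of_lt_toTop`). Conversely a maximal conflict-free set is the set of elbows in Λ
of a reduced pipe dream (`exists_facet`), by a count of inversions. So the faces of the core are the
conflict-free subsets of cr(π). The other boxes of Λ are the origin and its maximal boxes, which
form Ess(π); they conflict with nothing, which makes them the |Ess(π)|+1 cone points.

Trees: a box of R(π) is an edge of the transitive closure of T(π), joining the labels of its column
and its row, while for an essential box these labels coincide. A conflict is then a crossing or a
failure of alternation (`conflict_iff`), so maximal conflict-free sets are noncrossing alternating
spanning trees together with Ess(π). The map L ∘ K sends the weight of a box to the root of its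
edge, and on the span of the weights of Λ its kernel is spanned by the essential weights. Therefore
the preimage of a cell is the simplex of the corresponding boxes (`momentPolytope_inter_preimage`).
-/

namespace SchubertCore

/-! ### Conflict-free sets of boxes in a Ferrers shape -/

section Shape

variable {N : ℕ}

/-- The box `p` lies strictly south-west of `q`, and the south-east corner of the rectangle they
span belongs to the shape `Λ`. -/
def Conflict (Λ : Finset (Box N)) (p q : Box N) : Prop :=
  q.1 < p.1 ∧ p.2 < q.2 ∧ (p.1, q.2) ∈ Λ

/-- A set of boxes without conflicts. -/
def ConflictFree (Λ F : Finset (Box N)) : Prop :=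
  ∀ p ∈ F, ∀ q ∈ F, ¬ Conflict Λ p q

lemma ConflictFree.mono {Λ F G : Finset (Box N)} (hG : ConflictFree Λ G) (h : F ⊆ G) :
    ConflictFree Λ F := fun p hp q hq => hG p (h hp) q (h hq)

/-- The linear combination of the weights with coefficients `f`. -/
noncomputable def weightSum (f : Box N → ℝ) : Fin N ⊕ Fin N → ℝ := ∑ p, f p • weight p

lemma weightSum_inl (f : Box N → ℝ) (a : Fin N) : weightSum f (Sum.inl a) = ∑ b, f (a, b) := by
  simp only [weightSum, weight, Finset.sum_apply, Pi.smul_apply, Pi.sub_apply, smul_eq_mul,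
    Fintype.sum_prod_type, Pi.single_apply, reduceCtorEq, Sum.inl.injEq, if_false, sub_zero]
  rw [Finset.sum_eq_single a] <;> simp +contextual [eq_comm]

lemma weightSum_inr (f : Box N → ℝ) (b : Fin N) : weightSum f (Sum.inr b) = -∑ a, f (a, b) := by
  simp only [weightSum, weight, Finset.sum_apply, Pi.smul_apply, Pi.sub_apply, smul_eq_mul,
    Fintype.sum_prod_type_right, Pi.single_apply, reduceCtorEq, Sum.inr.injEq, if_false, zero_sub]
  rw [Finset.sum_eq_single b] <;> simp +contextual [eq_comm]

lemma weightSum_add (f g : Box N → ℝ) : weightSum (f + g) = weightSum f + weightSum g := by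
  simp [weightSum, add_smul, Finset.sum_add_distrib]

lemma weightSum_sub (f g : Box N → ℝ) : weightSum (f - g) = weightSum f - weightSum g := by
  simp [weightSum, sub_smul, Finset.sum_sub_distrib]

lemma weightSum_smul (t : ℝ) (f : Box N → ℝ) : weightSum (t • f) = t • weightSum f := by
  simp [weightSum, Finset.smul_sum, mul_smul]

lemma weightSum_single (p : Box N) (t : ℝ) : weightSum (Pi.single p t) = t • weight p := by
  rw [weightSum, Finset.sum_eq_single p] <;> simp +contextual

lemma continuous_weightSum : Continuous (weightSum : (Box N → ℝ) → _) := by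
  unfold weightSum; fun_prop

lemma weight_injective : Function.Injective (weight : Box N → _) := by
  intro p q h
  have h1 := congrFun h (Sum.inl p.1)
  have h2 := congrFun h (Sum.inr p.2)
  simp only [weight, Pi.sub_apply, Pi.single_apply, reduceCtorEq, if_true, if_false, sub_zero,
    zero_sub, Sum.inl.injEq, Sum.inr.injEq] at h1 h2
  ext
  · by_contra h; rw [if_neg (fun h' => h (by rw [h']))] at h1; norm_num at h1
  · by_contra h; rw [if_neg (fun h' => h (by rw [h']))] at h2; norm_num at h2

/-- Two combinations of weights with conflict-free supports agree as soon as their values do. Signs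
are only constrained away from the maximal boxes of the shape. -/
theorem eq_of_weightSum_eq {Λ : Finset (Box N)} {f g : Box N → ℝ}
    (hf : ∀ p, f p ≠ 0 → p ∈ Λ) (hg : ∀ p, g p ≠ 0 → p ∈ Λ)
    (hf0 : ∀ p, (∃ q ∈ Λ, p < q) → 0 ≤ f p) (hg0 : ∀ p, (∃ q ∈ Λ, p < q) → 0 ≤ g p)
    (hfc : ∀ p q, f p ≠ 0 → f q ≠ 0 → ¬ Conflict Λ p q)
    (hgc : ∀ p q, g p ≠ 0 → g q ≠ 0 → ¬ Conflict Λ p q)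
    (h : weightSum f = weightSum g) : f = g := by
  by_contra hne
  obtain ⟨p₀, hp₀⟩ := Function.ne_iff.1 hne
  -- Compare the two combinations at a south-east-most box where they differ; beyond it they agree.
  obtain ⟨p, -, hp⟩ := Finset.exists_le_maximal (Finset.univ.filter fun p => f p ≠ g p)
    (Finset.mem_filter.2 ⟨Finset.mem_univ p₀, hp₀⟩)
  have hpne : f p ≠ g p := (Finset.mem_filter.1 hp.1).2
  have hmax : ∀ q, p < q → f q = g q := fun q hq => by
    by_contra hq'
    exact hp.not_gt (Finset.mem_filter.2 ⟨Finset.mem_univ q, hq'⟩) hq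
  have key : ∀ f g : Box N → ℝ, (∀ p, f p ≠ 0 → p ∈ Λ) → (∀ p, g p ≠ 0 → p ∈ Λ) →
      (∀ p, (∃ q ∈ Λ, p < q) → 0 ≤ f p) →
      (∀ p q, g p ≠ 0 → g q ≠ 0 → ¬ Conflict Λ p q) →
      weightSum f = weightSum g → (∀ q, p < q → f q = g q) → ¬ g p < f p := by
    clear * -
    intro f g hf hg hf0 hgc h hmax hlt
    have hpΛ : p ∈ Λ := by
      by_contra hpΛ
      have h1 : f p = 0 := by by_contra h1; exact hpΛ (hf p h1)
      have h2 : g p = 0 := by by_contra h2; exact hpΛ (hg p h2)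
      rw [h1, h2] at hlt; exact lt_irrefl _ hlt
    have hr := congrFun h (Sum.inl p.1)
    rw [weightSum_inl, weightSum_inl] at hr
    have hc := congrFun h (Sum.inr p.2)
    rw [weightSum_inr, weightSum_inr, neg_inj] at hc
    -- The row sums of `f` and `g` agree, so the excess of `f` at `p` is compensated elsewhere in
    -- the row. The entry at `p` is replaced by `0` to force another column; the same is then done
    -- in the column of `p`.
    obtain ⟨b, -, hb⟩ := Finset.exists_lt_of_sum_lt (f := fun b => if b = p.2 then 0 else f (p.1, b))
      (g := fun b => if b = p.2 then 0 else g (p.1, b)) (s := Finset.univ) (by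
        rw [← Finset.sum_erase_add _ _ (Finset.mem_univ p.2),
          ← Finset.sum_erase_add Finset.univ (fun b => g (p.1, b)) (Finset.mem_univ p.2)] at hr
        rw [← Finset.sum_erase_add _ _ (Finset.mem_univ p.2),
          ← Finset.sum_erase_add Finset.univ (fun b => if b = p.2 then 0 else g (p.1, b))
            (Finset.mem_univ p.2)]
        simp only [if_true, add_zero]
        rw [Finset.sum_congr rfl (fun b hb => if_neg (Finset.ne_of_mem_erase hb)),
          Finset.sum_congr rfl (fun b hb => if_neg (Finset.ne_of_mem_erase hb))]
        have : f p = f (p.1, p.2) := rfl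
        have : g p = g (p.1, p.2) := rfl
        linarith)
    obtain ⟨a, -, ha⟩ := Finset.exists_lt_of_sum_lt (f := fun a => if a = p.1 then 0 else f (a, p.2))
      (g := fun a => if a = p.1 then 0 else g (a, p.2)) (s := Finset.univ) (by
        rw [← Finset.sum_erase_add _ _ (Finset.mem_univ p.1),
          ← Finset.sum_erase_add Finset.univ (fun a => g (a, p.2)) (Finset.mem_univ p.1)] at hc
        rw [← Finset.sum_erase_add _ _ (Finset.mem_univ p.1),
          ← Finset.sum_erase_add Finset.univ (fun a => if a = p.1 then 0 else g (a, p.2))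
            (Finset.mem_univ p.1)]
        simp only [if_true, add_zero]
        rw [Finset.sum_congr rfl (fun b hb => if_neg (Finset.ne_of_mem_erase hb)),
          Finset.sum_congr rfl (fun b hb => if_neg (Finset.ne_of_mem_erase hb))]
        have : f p = f (p.1, p.2) := rfl
        have : g p = g (p.1, p.2) := rfl
        linarith)
    have hb2 : b ≠ p.2 := by rintro rfl; simp at hb
    have ha1 : a ≠ p.1 := by rintro rfl; simp at ha
    simp only [if_neg hb2] at hb
    simp only [if_neg ha1] at ha
    have hblt : b < p.2 := by
      rcases lt_or_gt_of_ne hb2 with h' | h'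
      · exact h'
      · exact absurd (hmax (p.1, b) (Prod.lt_iff.2 (Or.inr ⟨le_rfl, h'⟩))) hb.ne
    have halt : a < p.1 := by
      rcases lt_or_gt_of_ne ha1 with h' | h'
      · exact h'
      · exact absurd (hmax (a, p.2) (Prod.lt_iff.2 (Or.inl ⟨h', le_rfl⟩))) ha.ne
    -- Both compensating boxes lie strictly north-west of `p`, where `f` is nonnegative, so `g` is
    -- positive there; but they conflict, with `p` as corner. Signs at maximal boxes never enter.
    have h1 := hf0 (p.1, b) ⟨p, hpΛ, Prod.lt_iff.2 (Or.inr ⟨le_rfl, hblt⟩)⟩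
    have h2 := hf0 (a, p.2) ⟨p, hpΛ, Prod.lt_iff.2 (Or.inl ⟨halt, le_rfl⟩)⟩
    exact hgc _ _ (h1.trans_lt hb).ne' (h2.trans_lt ha).ne' ⟨halt, hblt, hpΛ⟩
  rcases lt_or_gt_of_ne hpne with h' | h'
  · exact key g f hg hf hg0 hfc h.symm (fun q hq => (hmax q hq).symm) h'
  · exact key f g hf hg hf0 hgc h hmax h'

/-- Uncrossing: every nonnegative combination of weights of boxes in the shape can be rewritten with
a conflict-free support. -/
theorem exists_conflictFree_weightSum {Λ : Finset (Box N)} (hΛ : IsLowerSet (Λ : Set (Box N)))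
    (c : Box N → ℝ) (hc0 : 0 ≤ c) (hc : ∀ p, c p ≠ 0 → p ∈ Λ) :
    ∃ f : Box N → ℝ, 0 ≤ f ∧ (∀ p, f p ≠ 0 → p ∈ Λ) ∧ weightSum f = weightSum c ∧
      ∀ p q, f p ≠ 0 → f q ≠ 0 → ¬ Conflict Λ p q := by
  let S : Set (Box N → ℝ) := {f | 0 ≤ f ∧ (∀ p, p ∉ Λ → f p = 0) ∧ weightSum f = weightSum c}
  have hclosed : IsClosed S := by
    refine (isClosed_le continuous_const continuous_id).inter (IsClosed.inter ?_ ?_)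
    · change IsClosed {f : Box N → ℝ | ∀ p, p ∉ Λ → f p = 0}
      simp only [Set.ofPred_forall]
      exact isClosed_iInter fun p => isClosed_iInter fun _ =>
        isClosed_eq (continuous_apply p) continuous_const
    · exact isClosed_eq continuous_weightSum continuous_const
  have hcomp : IsCompact S := by
    -- The x-coordinates of the value are the row sums, which bound every coefficient.
    refine (isCompact_Icc (a := (0 : Box N → ℝ))
      (b := fun p => weightSum c (Sum.inl p.1))).of_isClosed_subset hclosed ?_
    rintro f ⟨hf0, -, hfw⟩
    refine ⟨hf0, fun p => ?_⟩
    change f p ≤ weightSum c (Sum.inl p.1)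
    rw [← hfw, weightSum_inl]
    exact Finset.single_le_sum (f := fun b => f (p.1, b)) (fun b _ => hf0 _) (Finset.mem_univ p.2)
  have hcS : c ∈ S := ⟨hc0, fun p hp => by by_contra h; exact hp (hc p h), rfl⟩
  -- The objective is supermodular: moving mass `ε` from a conflicting pair to the other two corners
  -- raises it by `ε` times the area of the rectangle, so a maximizer has no conflict.
  obtain ⟨f, ⟨hf0, hfΛ, hfw⟩, hmax⟩ := hcomp.exists_isMaxOn ⟨c, hcS⟩
    (f := fun f => ∑ p, f p * ((p.1 : ℕ) * (p.2 : ℕ) : ℝ)) (by fun_prop)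
  refine ⟨f, hf0, fun p hp => by by_contra h; exact hp (hfΛ p h), hfw, ?_⟩
  rintro p q hp hq ⟨h1, h2, h3⟩
  have hp' : 0 < f p := lt_of_le_of_ne (hf0 p) (Ne.symm hp)
  have hq' : 0 < f q := lt_of_le_of_ne (hf0 q) (Ne.symm hq)
  set ε := min (f p) (f q)
  have hε : 0 < ε := lt_min hp' hq'
  set r : Box N := (p.1, q.2)
  set s : Box N := (q.1, p.2)
  have hs : s ∈ Λ := hΛ (show s ≤ r from ⟨h1.le, h2.le⟩) h3
  have hpq : p ≠ q := fun h => h1.ne (by rw [h])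
  let f' : Box N → ℝ := f + (Pi.single r ε + Pi.single s ε - Pi.single p ε - Pi.single q ε)
  have hf' : f' ∈ S := by
    refine ⟨fun x => ?_, fun x hx => ?_, ?_⟩
    · have e1 : ε ≤ f p := min_le_left _ _
      have e2 : ε ≤ f q := min_le_right _ _
      have e3 : 0 ≤ (Pi.single r ε : Box N → ℝ) x := by
        rw [Pi.single_apply]; split_ifs <;> linarith
      have e4 : 0 ≤ (Pi.single s ε : Box N → ℝ) x := by
        rw [Pi.single_apply]; split_ifs <;> linarith
      have e5 : 0 ≤ f x := hf0 x
      change 0 ≤ f x + ((Pi.single r ε : Box N → ℝ) x + (Pi.single s ε : Box N → ℝ) x -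
        (Pi.single p ε : Box N → ℝ) x - (Pi.single q ε : Box N → ℝ) x)
      rw [Pi.single_apply p, Pi.single_apply q]
      by_cases hxp : x = p
      · subst hxp; rw [if_pos rfl, if_neg hpq]; linarith
      · by_cases hxq : x = q
        · subst hxq; rw [if_pos rfl, if_neg hxp]; linarith
        · rw [if_neg hxp, if_neg hxq]; linarith
    · have n1 : x ≠ r := fun h => hx (h ▸ h3)
      have n2 : x ≠ s := fun h => hx (h ▸ hs)
      have n3 : x ≠ p := fun h => hp (hfΛ p (h ▸ hx))
      have n4 : x ≠ q := fun h => hq (hfΛ q (h ▸ hx))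
      simp [f', n1, n2, n3, n4, hfΛ x hx]
    · rw [← hfw]
      simp only [f', weightSum_add, weightSum_sub, weightSum_single, add_eq_left]
      simp only [weight, r, s, smul_sub]
      abel
  have hle := hmax hf'
  simp only [f', Set.mem_ofPred_eq, Pi.add_apply, Pi.sub_apply, add_mul, sub_mul,
    Finset.sum_add_distrib, Finset.sum_sub_distrib, Pi.single_apply, ite_mul, zero_mul,
    Finset.sum_ite_eq', Finset.mem_univ, if_true] at hle
  simp only [r, s] at hle
  have h1' : ((q.1 : ℕ) : ℝ) < (p.1 : ℕ) := by exact_mod_cast h1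
  have h2' : ((p.2 : ℕ) : ℝ) < (q.2 : ℕ) := by exact_mod_cast h2
  nlinarith [mul_pos hε (mul_pos (sub_pos.2 h1') (sub_pos.2 h2'))]

end Shape

/-! ### Maximal conflict-free sets: predecessors, connectedness and cardinality -/

section Maximal

variable {n : ℕ}

/-- A conflict-free set of boxes of `Λ` to which no box of `Λ` can be added. -/
structure IsMaxConflictFree {N : ℕ} (Λ F : Finset (Box N)) : Prop where
  subset : F ⊆ Λ
  conflictFree : ConflictFree Λ F
  mem_of : ∀ p ∈ Λ, (∀ q ∈ F, ¬ Conflict Λ p q) → (∀ q ∈ F, ¬ Conflict Λ q p) → p ∈ F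

lemma not_conflict_self {N : ℕ} (Λ : Finset (Box N)) (p : Box N) : ¬ Conflict Λ p p :=
  fun h => lt_irrefl _ h.1

lemma ConflictFree.insert {N : ℕ} {Λ F : Finset (Box N)} {p : Box N} (hF : ConflictFree Λ F)
    (h1 : ∀ q ∈ F, ¬ Conflict Λ p q) (h2 : ∀ q ∈ F, ¬ Conflict Λ q p) :
    ConflictFree Λ (insert p F) := by
  intro x hx y hy
  rcases Finset.mem_insert.1 hx with rfl | hx' <;>
    rcases Finset.mem_insert.1 hy with rfl | hy'
  · exact not_conflict_self _ _
  · exact h1 y hy'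
  · exact h2 x hx'
  · exact hF x hx' y hy'

lemma ConflictFree.exists_isMaxConflictFree {N : ℕ} {Λ F : Finset (Box N)} (hF : F ⊆ Λ)
    (hc : ConflictFree Λ F) : ∃ G, F ⊆ G ∧ IsMaxConflictFree Λ G := by
  classical
  obtain ⟨G, hFG, hG⟩ := Finset.exists_le_maximal (Λ.powerset.filter (ConflictFree Λ))
    (Finset.mem_filter.2 ⟨Finset.mem_powerset.2 hF, hc⟩)
  have hG' := Finset.mem_filter.1 hG.1
  refine ⟨G, hFG, Finset.mem_powerset.1 hG'.1, hG'.2, fun p hp h1 h2 => ?_⟩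
  have := hG.2 (Finset.mem_filter.2 ⟨Finset.mem_powerset.2
    (Finset.insert_subset hp (Finset.mem_powerset.1 hG'.1)), hG'.2.insert h1 h2⟩)
    (Finset.subset_insert p G)
  exact this (Finset.mem_insert_self p G)

lemma IsMaxConflictFree.eq_of_subset {N : ℕ} {Λ F G : Finset (Box N)}
    (hF : IsMaxConflictFree Λ F) (hG : ConflictFree Λ G) (hGΛ : G ⊆ Λ) (h : F ⊆ G) : F = G :=
  h.antisymm fun p hp => hF.mem_of p (hGΛ hp) (fun q hq => hG p hp q (h hq))
    (fun q hq => hG q (h hq) p hp)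

/-- A maximal box of the shape is in conflict with no box. -/
lemma not_conflict_of_maximal {N : ℕ} {Λ : Finset (Box N)} {p : Box N}
    (hp : ∀ q ∈ Λ, ¬ p < q) (q : Box N) : ¬ Conflict Λ p q ∧ ¬ Conflict Λ q p :=
  ⟨fun h => hp _ h.2.2 (Prod.lt_iff.2 (Or.inr ⟨le_rfl, h.2.1⟩)),
    fun h => hp _ h.2.2 (Prod.lt_iff.2 (Or.inl ⟨h.1, le_rfl⟩))⟩

lemma not_conflict_zero (Λ : Finset (Box (n + 1))) (q : Box (n + 1)) :
    ¬ Conflict Λ (0, 0) q ∧ ¬ Conflict Λ q (0, 0) :=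
  ⟨fun h => absurd h.1 (by simp), fun h => absurd h.2.1 (by simp)⟩

variable {Λ F : Finset (Box (n + 1))}

lemma IsMaxConflictFree.mem_of_maximal (hF : IsMaxConflictFree Λ F) {p : Box (n + 1)} (hpΛ : p ∈ Λ)
    (hp : ∀ q ∈ Λ, ¬ p < q) : p ∈ F :=
  hF.mem_of p hpΛ (fun q _ => (not_conflict_of_maximal hp q).1)
    (fun q _ => (not_conflict_of_maximal hp q).2)

lemma IsMaxConflictFree.zero_mem (hF : IsMaxConflictFree Λ F) (h : (0, 0) ∈ Λ) : (0, 0) ∈ F :=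
  hF.mem_of _ h (fun q _ => (not_conflict_zero Λ q).1) (fun q _ => (not_conflict_zero Λ q).2)

/-- Every box but the origin has a predecessor in its row or in its column. -/
lemma IsMaxConflictFree.exists_lt (hF : IsMaxConflictFree Λ F) (hΛ : IsLowerSet (Λ : Set (Box (n + 1))))
    {z : Box (n + 1)} (hz : z ∈ F) (hz0 : z ≠ (0, 0)) :
    ∃ y ∈ F, y < z ∧ (y.1 = z.1 ∨ y.2 = z.2) := by
  classical
  have h00 : (0, 0) ≤ z := ⟨Fin.zero_le _, Fin.zero_le _⟩
  have hzΛ := hF.subset hz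
  obtain ⟨y, -, hy⟩ := Finset.exists_le_maximal (F.filter (· < z))
    (Finset.mem_filter.2 ⟨hF.zero_mem (hΛ h00 hzΛ), lt_of_le_of_ne h00 hz0.symm⟩)
  obtain ⟨hyF, hyz⟩ := Finset.mem_filter.1 hy.1
  refine ⟨y, hyF, hyz, ?_⟩
  by_contra! hne
  have h1 : y.1 < z.1 := lt_of_le_of_ne hyz.le.1 hne.1
  have h2 : y.2 < z.2 := lt_of_le_of_ne hyz.le.2 hne.2
  have hxz : ((z.1, y.2) : Box (n + 1)) < z := Prod.lt_iff.2 (Or.inr ⟨le_rfl, h2⟩)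
  have hyx : y < (z.1, y.2) := Prod.lt_iff.2 (Or.inl ⟨h1, le_rfl⟩)
  -- If `y`, maximal in `F` below `z`, were strictly north-west of `z`, the south-west corner of
  -- their rectangle could be added to `F`: a box in conflict with it would conflict with `y` or
  -- `z`, or would lie between them. That corner itself then lies between them.
  have hx : (z.1, y.2) ∈ F := by
    refine hF.mem_of _ (hΛ hxz.le hzΛ) (fun q hq hc => ?_) (fun q hq hc => ?_)
    · obtain ⟨c1, c2, c3⟩ := hc
      simp only at c1 c2 c3
      have hqz : q.2 ≤ z.2 := by
        by_contra hlt
        refine hF.conflictFree z hz q hq ⟨c1, not_le.1 hlt, c3⟩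
      have hqy : q.1 < y.1 → False := fun h' => hF.conflictFree y hyF q hq
        ⟨h', c2, hΛ (show (y.1, q.2) ≤ z from ⟨h1.le, hqz⟩) hzΛ⟩
      refine hy.not_gt (Finset.mem_filter.2 ⟨hq, Prod.lt_iff.2 (Or.inl ⟨c1, hqz⟩)⟩)
        (Prod.lt_iff.2 (Or.inr ⟨not_lt.1 hqy, c2⟩))
    · obtain ⟨c1, c2, c3⟩ := hc
      exact hF.conflictFree q hq y hyF ⟨h1.trans c1, c2, c3⟩
  exact hy.not_gt (Finset.mem_filter.2 ⟨hx, hxz⟩) hyx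

/-- Suppose `F` misses row `a`. The maximal box of `Λ` below the east end of the row is in `F`;
descending from it by `exists_lt`, some step must jump over row `a` inside a single column. The box
where that column meets row `a` conflicts with no box of `F`, since such a conflict would pass to
one end of the jump, so maximality puts it in `F`. -/
lemma IsMaxConflictFree.exists_row (hF : IsMaxConflictFree Λ F)
    (hΛ : IsLowerSet (Λ : Set (Box (n + 1)))) {a : Fin (n + 1)} (ha : ∃ b, (a, b) ∈ Λ) :
    ∃ b, (a, b) ∈ F := by
  classical
  by_contra! hno
  obtain ⟨b₀, hb₀⟩ := ha
  obtain ⟨b, hbmax⟩ := (Finset.univ.filter fun b => (a, b) ∈ Λ).exists_maximal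
    ⟨b₀, by simpa using hb₀⟩
  have hb : (a, b) ∈ Λ := by simpa using hbmax.1
  have hble : ∀ f, (a, f) ∈ Λ → f ≤ b := fun f hf => not_lt.1 fun h =>
    hbmax.not_gt (by simpa using hf) h
  obtain ⟨p, hp, hpmax⟩ := Λ.exists_le_maximal hb
  have hpF := hF.mem_of_maximal hpmax.1 fun q hq => hpmax.not_gt hq
  have hpa : a < p.1 := lt_of_le_of_ne hp.1 (by rintro rfl; exact hno _ hpF)
  have hpb : p.2 = b := le_antisymm (hble _ (hΛ (show (a, p.2) ≤ p from ⟨hp.1, le_rfl⟩) hpmax.1)) hp.2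
  obtain ⟨z, -, hz⟩ := Finset.exists_le_minimal (F.filter fun z => z ≤ p ∧ a < z.1)
    (Finset.mem_filter.2 ⟨hpF, le_rfl, hpa⟩)
  obtain ⟨hzF, hzp, hza⟩ := Finset.mem_filter.1 hz.1
  obtain ⟨y, hyF, hyz, hy⟩ := hF.exists_lt hΛ hzF (by rintro rfl; simp at hza)
  have hya : y.1 < a := by
    rcases lt_trichotomy y.1 a with h | h | h
    · exact h
    · exact absurd hyF (by rw [← h] at hno; exact hno _)
    · exact absurd hyz (hz.not_lt (Finset.mem_filter.2 ⟨hyF, hyz.le.trans hzp, h⟩))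
  have hyd : y.2 = z.2 := hy.resolve_left (hya.trans hza).ne
  refine hno z.2 (hF.mem_of _ (hΛ (show (a, z.2) ≤ z from ⟨hza.le, le_rfl⟩) (hF.subset hzF))
    (fun q hq hc => ?_) (fun q hq hc => ?_))
  · obtain ⟨c1, c2, c3⟩ := hc
    exact hF.conflictFree z hzF q hq ⟨c1.trans hza, c2,
      hΛ (show (z.1, q.2) ≤ p from ⟨hzp.1, (hble _ c3).trans_eq hpb.symm⟩) hpmax.1⟩
  · obtain ⟨c1, c2, c3⟩ := hc
    exact hF.conflictFree q hq y hyF ⟨hya.trans c1, hyd ▸ c2, hyd ▸ c3⟩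

/-- The transpose of `exists_row`: here the jump over column `b` happens inside a single row. -/
lemma IsMaxConflictFree.exists_col (hF : IsMaxConflictFree Λ F)
    (hΛ : IsLowerSet (Λ : Set (Box (n + 1)))) {b : Fin (n + 1)} (hb : ∃ a, (a, b) ∈ Λ) :
    ∃ a, (a, b) ∈ F := by
  classical
  by_contra! hno
  obtain ⟨a₀, ha₀⟩ := hb
  obtain ⟨a, hamax⟩ := (Finset.univ.filter fun a => (a, b) ∈ Λ).exists_maximal
    ⟨a₀, by simpa using ha₀⟩
  have ha : (a, b) ∈ Λ := by simpa using hamax.1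
  have hale : ∀ f, (f, b) ∈ Λ → f ≤ a := fun f hf => not_lt.1 fun h =>
    hamax.not_gt (by simpa using hf) h
  obtain ⟨p, hp, hpmax⟩ := Λ.exists_le_maximal ha
  have hpF := hF.mem_of_maximal hpmax.1 fun q hq => hpmax.not_gt hq
  have hpb : b < p.2 := lt_of_le_of_ne hp.2 (by rintro rfl; exact hno _ hpF)
  have hpa : p.1 = a := le_antisymm (hale _ (hΛ (show (p.1, b) ≤ p from ⟨le_rfl, hp.2⟩) hpmax.1)) hp.1
  obtain ⟨z, -, hz⟩ := Finset.exists_le_minimal (F.filter fun z => z ≤ p ∧ b < z.2)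
    (Finset.mem_filter.2 ⟨hpF, le_rfl, hpb⟩)
  obtain ⟨hzF, hzp, hzb⟩ := Finset.mem_filter.1 hz.1
  obtain ⟨y, hyF, hyz, hy⟩ := hF.exists_lt hΛ hzF (by rintro rfl; simp at hzb)
  have hyb : y.2 < b := by
    rcases lt_trichotomy y.2 b with h | h | h
    · exact h
    · exact absurd hyF (by rw [← h] at hno; exact hno _)
    · exact absurd hyz (hz.not_lt (Finset.mem_filter.2 ⟨hyF, hyz.le.trans hzp, h⟩))
  have hyd : y.1 = z.1 := hy.resolve_right (hyb.trans hzb).ne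
  refine hno z.1 (hF.mem_of _ (hΛ (show (z.1, b) ≤ z from ⟨le_rfl, hzb.le⟩) (hF.subset hzF))
    (fun q hq hc => ?_) (fun q hq hc => ?_))
  · obtain ⟨c1, c2, c3⟩ := hc
    exact hF.conflictFree y hyF q hq ⟨hyd ▸ c1, hyb.trans c2, hyd ▸ c3⟩
  · obtain ⟨c1, c2, c3⟩ := hc
    exact hF.conflictFree q hq z hzF ⟨c1, c2.trans hzb,
      hΛ (show (q.1, z.2) ≤ p from ⟨(hale _ c3).trans_eq hpa.symm, hzp.2⟩) hpmax.1⟩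

/-- Connectedness: a property of rows and columns that spreads along the boxes of a maximal
conflict-free set holds for all rows and columns of the shape if it does for the first row. -/
lemma IsMaxConflictFree.forall_of_iff (hF : IsMaxConflictFree Λ F)
    (hΛ : IsLowerSet (Λ : Set (Box (n + 1)))) {P Q : Fin (n + 1) → Prop}
    (hPQ : ∀ p ∈ F, (P p.1 ↔ Q p.2)) (h0 : P 0) :
    (∀ a, (∃ b, (a, b) ∈ Λ) → P a) ∧ ∀ b, (∃ a, (a, b) ∈ Λ) → Q b := by
  have key : ∀ z : Box (n + 1), z ∈ F → P z.1 := by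
    intro z
    induction z using WellFoundedLT.induction with
    | ind z ih =>
      intro hz
      by_cases hz0 : z = (0, 0)
      · rw [hz0]; exact h0
      · obtain ⟨y, hyF, hyz, h | h⟩ := hF.exists_lt hΛ hz hz0
        · rw [← h]; exact ih y hyz hyF
        · rw [hPQ z hz, ← h, ← hPQ y hyF]; exact ih y hyz hyF
  refine ⟨fun a ha => ?_, fun b hb => ?_⟩
  · obtain ⟨b, hb⟩ := hF.exists_row hΛ ha
    exact key _ hb
  · obtain ⟨a, ha⟩ := hF.exists_col hΛ hb
    exact (hPQ _ ha).1 (key _ ha)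

/-- A maximal conflict-free set has at least as many boxes as the first row and column together. -/
lemma IsMaxConflictFree.card_le (hF : IsMaxConflictFree Λ F)
    (hΛ : IsLowerSet (Λ : Set (Box (n + 1)))) :
    Λ.card ≤ F.card + (Λ.filter fun p => p.1 ≠ 0 ∧ p.2 ≠ 0).card := by
  classical
  rw [← Finset.card_filter_add_card_filter_not (s := Λ) (fun p => p.1 ≠ 0 ∧ p.2 ≠ 0), add_comm]
  refine Nat.add_le_add_right ?_ _
  have hrow : ∀ a, (∃ b, (a, b) ∈ Λ) → ∃ b, (a, b) ∈ F ∧ ∀ b', (a, b') ∈ F → b ≤ b' := by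
    intro a ha
    obtain ⟨b₀, hb₀⟩ := hF.exists_row hΛ ha
    obtain ⟨b, hb⟩ := (Finset.univ.filter fun b => (a, b) ∈ F).exists_minimal
      ⟨b₀, by simpa using hb₀⟩
    exact ⟨b, by simpa using hb.1, fun b' hb' => not_lt.1 fun h =>
      hb.not_lt (by simpa using hb') h⟩
  have hcol : ∀ b, (∃ a, (a, b) ∈ Λ) → ∃ a, (a, b) ∈ F ∧ ∀ a', (a', b) ∈ F → a ≤ a' := by
    intro b hb
    obtain ⟨a₀, ha₀⟩ := hF.exists_col hΛ hb
    obtain ⟨a, ha⟩ := (Finset.univ.filter fun a => (a, b) ∈ F).exists_minimal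
      ⟨a₀, by simpa using ha₀⟩
    exact ⟨a, by simpa using ha.1, fun a' ha' => not_lt.1 fun h =>
      ha.not_lt (by simpa using ha') h⟩
  choose! f hf hfmin using hrow
  choose! g hg hgmin using hcol
  -- A box of the first column goes to the first box of `F` in its row, any other box of the first
  -- row to the first box of `F` in its column.
  refine Finset.card_le_card_of_injOn (fun p => if p.2 = 0 then (p.1, f p.1) else (g p.2, p.2))
    ?_ ?_
  · intro p hp
    obtain ⟨hp, -⟩ := Finset.mem_filter.1 hp
    simp only
    split_ifs
    · exact hf _ ⟨_, hp⟩
    · exact hg _ ⟨_, hp⟩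
  -- A box of `F` that is first both in its row and in its column has no predecessor, hence is the
  -- origin; this rules out a coincidence with a column other than column `0`.
  · have hmix : ∀ p ∈ Λ, ∀ q ∈ Λ, q.2 ≠ 0 → ((p.1, f p.1) : Box (n + 1)) ≠ (g q.2, q.2) := by
      intro p hp q hq hq0 he
      have h1 := hf _ ⟨_, hp⟩
      obtain ⟨y, hyF, hyz, h | h⟩ := hF.exists_lt hΛ h1 (fun h => hq0 (by
        rw [← (Prod.ext_iff.1 he).2, (Prod.ext_iff.1 h).2]))
      · have := hfmin p.1 ⟨_, hp⟩ y.2 (by rw [← show y.1 = p.1 from h]; exact hyF)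
        exact hyz.not_ge ⟨h.ge, this⟩
      · rw [he] at h hyz
        have := hgmin q.2 ⟨_, hq⟩ y.1 (by rw [← show y.2 = q.2 from h]; exact hyF)
        exact hyz.not_ge ⟨this, h.ge⟩
    intro p hp q hq he
    obtain ⟨hp, hp'⟩ := Finset.mem_filter.1 hp
    obtain ⟨hq, hq'⟩ := Finset.mem_filter.1 hq
    simp only at he
    split_ifs at he with h1 h2 h2
    · exact Prod.ext (Prod.ext_iff.1 he).1 (h1.trans h2.symm)
    · exact absurd he (hmix p hp q hq h2)
    · exact absurd he.symm (hmix q hq p hp h1)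
    · have : p.1 = 0 := by by_contra h; exact hp' ⟨h, h1⟩
      have : q.1 = 0 := by by_contra h; exact hq' ⟨h, h2⟩
      exact Prod.ext (by simp_all) (Prod.ext_iff.1 he).2

end Maximal

/-! ### Inversions -/

section Inversions

lemma mem_rothe {N : ℕ} {π : Equiv.Perm (Fin N)} {p : Box N} :
    p ∈ rothe π ↔ p.1 < π p.2 ∧ p.2 < π.symm p.1 := by
  simp only [rothe, Finset.mem_filter, Finset.mem_univ, true_and]
  constructor
  · rintro ⟨i, j, hij, hlt, rfl⟩
    simpa using ⟨hlt, hij⟩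
  · rintro ⟨h1, h2⟩
    exact ⟨p.2, π.symm p.1, h2, by simpa using h1, by simp⟩

/-- A permutation is determined by its Rothe diagram. -/
theorem rothe_injective {N : ℕ} : Function.Injective (rothe : Equiv.Perm (Fin N) → _) := by
  -- At the first position where `u` and `v` differ, if `u i < v i` then the box `(u i, i)` is in
  -- the diagram of `v` but not in that of `u`.
  have key : ∀ (u v : Equiv.Perm (Fin N)) (i : Fin N), rothe u = rothe v → (∀ j < i, u j = v j) →
      ¬ u i < v i := by
    intro u v i h hj hlt
    have h1 : ((u i, i) : Box N) ∈ rothe v := by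
      refine mem_rothe.2 ⟨hlt, lt_of_le_of_ne (not_lt.1 fun h' => ?_) fun h' => ?_⟩
      · have := hj _ h'
        simp only [Equiv.apply_symm_apply, EmbeddingLike.apply_eq_iff_eq] at this
        exact h'.ne this
      · simp only at h'
        have : v i = u i := by conv_lhs => rw [h', Equiv.apply_symm_apply]
        exact hlt.ne' this
    rw [← h] at h1
    exact lt_irrefl _ (mem_rothe.1 h1).1
  intro u v h
  ext1 i
  induction i using WellFoundedLT.induction with
  | ind i ih =>
    exact le_antisymm (not_lt.1 (key v u i h.symm fun j hj => (ih j hj).symm))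
      (not_lt.1 (key u v i h ih))

variable {n : ℕ}

/-- The number of inversions is at most the length of any expression. -/
theorem card_rothe_wordProd_le (w : List (Fin n)) : (rothe (wordProd w)).card ≤ w.length := by
  let inv (u : Equiv.Perm (Fin (n + 1))) : Finset (Fin (n + 1) × Fin (n + 1)) :=
    Finset.univ.filter fun x => x.1 < x.2 ∧ u x.2 < u x.1
  have hinv : ∀ u, (rothe u).card = (inv u).card := by
    intro u
    refine Finset.card_bij' (fun p _ => (p.2, u.symm p.1)) (fun x _ => (u x.2, x.1)) ?_ ?_ ?_ ?_
    · intro p hp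
      have := mem_rothe.1 hp
      simpa [inv] using ⟨this.2, this.1⟩
    · intro x hx
      have : x.1 < x.2 ∧ u x.2 < u x.1 := by simpa [inv] using hx
      exact mem_rothe.2 (by simpa using ⟨this.2, this.1⟩)
    · intro p _; simp
    · intro x _; simp
  rw [hinv]
  induction w with
  | nil =>
    refine le_of_eq (Finset.card_eq_zero.2 (Finset.filter_eq_empty_iff.2 ?_))
    rintro x - ⟨h1, h2⟩
    simp only [wordProd, List.map_nil, List.prod_nil, Equiv.Perm.coe_one, id_eq] at h2
    exact lt_asymm h1 h2
  | cons k w ih =>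
    have hu : wordProd (k :: w) = simpleRefl k * wordProd w := by simp [wordProd]
    rw [hu, List.length_cons]
    set u := wordProd w
    -- Left multiplication by `simpleRefl k` swaps two adjacent values, so the only inversion it can
    -- create is between the positions of these values.
    refine le_trans (Finset.card_le_card (t := insert (u.symm k.castSucc, u.symm k.succ) (inv u))
      ?_) ((Finset.card_insert_le _ _).trans (Nat.add_le_add_right ih 1))
    intro x hx
    obtain ⟨h1, h2⟩ : x.1 < x.2 ∧ simpleRefl k (u x.2) < simpleRefl k (u x.1) :=
      (Finset.mem_filter.1 hx).2
    rw [Finset.mem_insert]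
    by_cases h : u x.2 < u x.1
    · right; simpa [inv] using ⟨h1, h⟩
    · left
      have h' : u x.1 < u x.2 := lt_of_le_of_ne (not_lt.1 h) fun e =>
        h1.ne (u.injective e)
      suffices u x.1 = k.castSucc ∧ u x.2 = k.succ by
        rw [← this.1, ← this.2]; simp
      revert h2 h'
      generalize u x.1 = y, u x.2 = z
      intro h2 h'
      simp only [simpleRefl, Equiv.swap_apply_def] at h2
      simp only [Fin.ext_iff, Fin.lt_def, Fin.val_castSucc, Fin.val_succ] at *
      split_ifs at h2 <;> simp_all <;> omega

end Inversions

/-! ### Following the pipes of a pipe dream -/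

section Pipes

/-- The transposition of `k` and `k + 1` on natural numbers. -/
def natSwap (k q : ℕ) : ℕ := if q = k then k + 1 else if q = k + 1 then k else q

/-- The letters act one after the other, from left to right. -/
def natAct (l : List ℕ) (q : ℕ) : ℕ := l.foldl (fun q k => natSwap k q) q

lemma natAct_append (l l' : List ℕ) (q : ℕ) : natAct (l ++ l') q = natAct l' (natAct l q) :=
  List.foldl_append

/-- Inverting a product of involutions reverses it, so the first letter acts first. Reading the
triangular word from left to right thus computes the inverse permutation by following pipes upward
from the left edge. -/
lemma val_wordProd_symm {n : ℕ} (w : List (Fin n)) (q : Fin (n + 1)) :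
    ((wordProd w).symm q).val = natAct (w.map Fin.val) q.val := by
  induction w generalizing q with
  | nil => rfl
  | cons k w ih =>
    have hu : wordProd (k :: w) = simpleRefl k * wordProd w := by simp [wordProd]
    have : (wordProd (k :: w)).symm q = (wordProd w).symm (simpleRefl k q) := by
      rw [Equiv.symm_apply_eq, hu]
      simp [simpleRefl]
    rw [this, ih]
    simp only [natAct, List.map_cons, List.foldl_cons]
    congr 1
    simp only [simpleRefl, Equiv.swap_apply_def, natSwap, Fin.ext_iff, Fin.val_castSucc,
      Fin.val_succ]
    split_ifs <;> simp

lemma natAct_eq_self {l : List ℕ} {q : ℕ} (h : ∀ k ∈ l, q < k) : natAct l q = q := by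
  induction l with
  | nil => rfl
  | cons k l ih =>
    have hk := h k (by simp)
    have : natSwap k q = q := by unfold natSwap; split_ifs <;> omega
    simp only [natAct, List.foldl_cons, this]
    exact ih fun k' hk' => h k' (by simp [hk'])

variable (cr : ℕ → ℕ → Bool) (n : ℕ)

/-- The letters of the crosses in row `r`. -/
def rowWord (r : ℕ) : List ℕ := ((List.range (n + 1)).filter (cr r)).map (r + ·)

/-- A pipe coming from the left passes the crosses and goes on at the first elbow. -/
lemma natAct_range' (c : ℕ → Bool) (r s k : ℕ) (hc : ∀ j, c j = true → j < s + k) :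
    ∃ t, s ≤ t ∧ (∀ j, s ≤ j → j < t → c j = true) ∧ c t = false ∧
      natAct (((List.range' s k).filter c).map (r + ·)) (r + s) = r + t := by
  induction k generalizing s with
  | zero =>
    refine ⟨s, le_rfl, fun j h1 h2 => absurd h2 (by omega), ?_, by simp [natAct]⟩
    by_contra h
    have := hc s (by simpa using h)
    omega
  | succ k ih =>
    rw [List.range'_succ]
    by_cases hs : c s = true
    · obtain ⟨t, h1, h2, h3, h4⟩ := ih (s + 1) (fun j hj => by have := hc j hj; omega)
      refine ⟨t, by omega, fun j hj hjt => ?_, h3, ?_⟩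
      · rcases hj.eq_or_lt with rfl | hj
        · exact hs
        · exact h2 j hj hjt
      · rw [List.filter_cons_of_pos hs, List.map_cons, natAct, List.foldl_cons]
        rw [show natSwap (r + s) (r + s) = r + (s + 1) by simp [natSwap]; omega]
        exact h4
    · refine ⟨s, le_rfl, fun j h1 h2 => absurd h2 (by omega), by simpa using hs, ?_⟩
      rw [List.filter_cons_of_neg hs]
      refine natAct_eq_self fun x hx => ?_
      simp only [List.mem_map, List.mem_filter, List.mem_range'_1] at hx
      obtain ⟨j, ⟨hj, -⟩, rfl⟩ := hx
      omega

variable {cr n}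

lemma rowWord_split {r s : ℕ} (hs : s ≤ n + 1) :
    rowWord cr n r = ((List.range s).filter (cr r)).map (r + ·) ++
      ((List.range' s (n + 1 - s)).filter (cr r)).map (r + ·) := by
  rw [rowWord, ← List.map_append, ← List.filter_append]
  congr 2
  rw [List.range_eq_range', List.range_eq_range']
  rw [show n + 1 = s + (n + 1 - s) by omega, ← List.range'_append_1]
  simp

/-- Boxes outside the staircase are not crosses. -/
def InStaircase (cr : ℕ → ℕ → Bool) (n : ℕ) : Prop := ∀ r j, cr r j = true → r + j < n

lemma natAct_rowWord_self (h : InStaircase cr n) (r : ℕ) :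
    ∃ t, (∀ j < t, cr r j = true) ∧ cr r t = false ∧ natAct (rowWord cr n r) r = r + t := by
  obtain ⟨t, -, h2, h3, h4⟩ := natAct_range' (cr r) r 0 (n + 1) fun j hj => by
    have := h r j hj; omega
  refine ⟨t, fun j hj => h2 j (Nat.zero_le _) hj, h3, ?_⟩
  rw [rowWord, List.range_eq_range']
  exact h4

/-- Position `r + 1 + c` is the bottom edge of the box `(r, c)` and `r + c` is its top edge. Of the
letters of the row only `r + c`, the letter of the box itself, moves the pipe: it passes the cross
vertically. -/
lemma natAct_rowWord_of_cross (h : InStaircase cr n) {r c : ℕ} (hc : cr r c = true) :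
    natAct (rowWord cr n r) (r + 1 + c) = r + c := by
  have := h r c hc
  rw [rowWord_split (s := c) (by omega), natAct_append,
    show n + 1 - c = n - c + 1 by omega, List.range'_succ, List.filter_cons_of_pos hc,
    List.map_cons]
  have h1 : natAct (List.map (r + ·) ((List.range c).filter (cr r))) (r + 1 + c) = r + 1 + c := by
    suffices ∀ l : List ℕ, (∀ k ∈ l, k < r + c) → natAct l (r + 1 + c) = r + 1 + c by
      refine this _ fun k hk => ?_
      simp only [List.mem_map, List.mem_filter, List.mem_range] at hk
      obtain ⟨j, ⟨hj, -⟩, rfl⟩ := hk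
      omega
    intro l hl
    induction l with
    | nil => rfl
    | cons k l ih =>
      have hk := hl k (by simp)
      have : natSwap k (r + 1 + c) = r + 1 + c := by unfold natSwap; split_ifs <;> omega
      simp only [natAct, List.foldl_cons, this]
      exact ih fun k' hk' => hl k' (by simp [hk'])
  rw [h1, natAct, List.foldl_cons]
  rw [show natSwap (r + c) (r + 1 + c) = r + c by unfold natSwap; split_ifs <;> omega]
  refine natAct_eq_self fun x hx => ?_
  simp only [List.mem_map, List.mem_filter, List.mem_range'_1] at hx
  obtain ⟨j, ⟨hj, -⟩, rfl⟩ := hx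
  omega

/-- A pipe entering an elbow from below turns east, runs through the crosses of the row and leaves
upward at the next elbow `t`. -/
lemma natAct_rowWord_of_elbow (h : InStaircase cr n) {r c : ℕ} (hrc : r + c ≤ n)
    (hc : cr r c = false) :
    ∃ t, c < t ∧ (∀ j, c < j → j < t → cr r j = true) ∧ cr r t = false ∧
      natAct (rowWord cr n r) (r + 1 + c) = r + t := by
  rw [rowWord_split (s := c + 1) (by omega), natAct_append]
  have h1 : natAct (List.map (r + ·) ((List.range (c + 1)).filter (cr r))) (r + 1 + c) =
      r + (c + 1) := by
    suffices ∀ l : List ℕ, (∀ k ∈ l, k < r + c) → natAct l (r + 1 + c) = r + (c + 1) by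
      refine this _ fun k hk => ?_
      simp only [List.mem_map, List.mem_filter, List.mem_range] at hk
      obtain ⟨j, ⟨hj, hj'⟩, rfl⟩ := hk
      have : j ≠ c := by rintro rfl; rw [hc] at hj'; exact Bool.noConfusion hj'
      omega
    intro l hl
    induction l with
    | nil => simp [natAct]; omega
    | cons k l ih =>
      have hk := hl k (by simp)
      have : natSwap k (r + 1 + c) = r + 1 + c := by unfold natSwap; split_ifs <;> omega
      simp only [natAct, List.foldl_cons, this]
      exact ih fun k' hk' => hl k' (by simp [hk'])
  rw [h1]
  obtain ⟨t, h2, h3, h4, h5⟩ := natAct_range' (cr r) r (c + 1) (n + 1 - (c + 1)) fun j hj => by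
    have := h r j hj; omega
  exact ⟨t, by omega, fun j hj hjt => h3 j (by omega) hjt, h4, h5⟩

/-! ### Pipes followed through several rows -/

variable (cr n)

/-- The pipe passing position `q` below the first `r` rows is followed back to the top. -/
def toTop : ℕ → ℕ → ℕ
  | 0, q => q
  | r + 1, q => toTop r (natAct (rowWord cr n r) q)

variable {cr n}

lemma toTop_eq_natAct (r q : ℕ) :
    toTop cr n r q = natAct ((List.range r).reverse.flatMap (rowWord cr n)) q := by
  induction r generalizing q with
  | zero => rfl
  | succ r ih =>
    rw [List.range_succ, List.reverse_append, List.reverse_singleton, List.singleton_append,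
      List.flatMap_cons, natAct_append, toTop, ih]

/-- All letters of the rows `r` and below are at least `r`, so they do not move `q`. -/
lemma toTop_eq_of_le {r s q : ℕ} (hrs : r ≤ s) (hq : q < r) : toTop cr n s q = toTop cr n r q := by
  induction s, hrs using Nat.le_induction with
  | base => rfl
  | succ s hs ih =>
    rw [toTop, natAct_eq_self, ih]
    intro k hk
    simp only [rowWord, List.mem_map] at hk
    obtain ⟨j, -, rfl⟩ := hk
    omega

/-- The pipe leaving to the left in row `r` comes from above the first elbow of that row. -/
lemma exists_toTop_exit (h : InStaircase cr n) {r : ℕ} (hr : r ≤ n) :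
    ∃ t, (∀ j < t, cr r j = true) ∧ cr r t = false ∧
      toTop cr n (n + 1) r = toTop cr n r (r + t) := by
  obtain ⟨t, h1, h2, h3⟩ := natAct_rowWord_self h r
  refine ⟨t, h1, h2, ?_⟩
  rw [toTop_eq_of_le (r := r + 1) (by omega) (by omega), toTop, h3]

lemma natAct_rowWord_of_lt (h : InStaircase cr n) {r c : ℕ} (hrc : n < r + c) :
    natAct (rowWord cr n r) (r + 1 + c) = r + (c + 1) := by
  suffices ∀ l : List ℕ, (∀ k ∈ l, k < r + c) → natAct l (r + 1 + c) = r + (c + 1) by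
    refine this _ fun k hk => ?_
    simp only [rowWord, List.mem_map, List.mem_filter, List.mem_range] at hk
    obtain ⟨j, ⟨hj, hj'⟩, rfl⟩ := hk
    have := h r j hj'
    omega
  intro l hl
  induction l with
  | nil => simp [natAct]; omega
  | cons k l ih =>
    have hk := hl k (by simp)
    have : natSwap k (r + 1 + c) = r + 1 + c := by unfold natSwap; split_ifs <;> omega
    simp only [natAct, List.foldl_cons, this]
    exact ih fun k' hk' => hl k' (by simp [hk'])

lemma toTop_succ_of_cross (h : InStaircase cr n) {r c : ℕ} (hc : cr r c = true) :
    toTop cr n (r + 1) (r + 1 + c) = toTop cr n r (r + c) := by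
  rw [toTop, natAct_rowWord_of_cross h hc]

lemma exists_toTop_succ_of_elbow (h : InStaircase cr n) {r c : ℕ} (hc : cr r c = false) :
    ∃ t, c < t ∧ (∀ j, c < j → j < t → cr r j = true) ∧ cr r t = false ∧
      toTop cr n (r + 1) (r + 1 + c) = toTop cr n r (r + t) := by
  rcases le_or_gt (r + c) n with hrc | hrc
  · obtain ⟨t, h1, h2, h3, h4⟩ := natAct_rowWord_of_elbow h hrc hc
    exact ⟨t, h1, h2, h3, by rw [toTop, h4]⟩
  · refine ⟨c + 1, by omega, fun j h1 h2 => by omega, ?_, ?_⟩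
    · by_contra h'
      have := h r (c + 1) (by simpa using h')
      omega
    · rw [toTop, natAct_rowWord_of_lt h hrc]

/-- Pipes only move to the left on their way down. -/
lemma le_toTop (h : InStaircase cr n) (r c : ℕ) : c ≤ toTop cr n r (r + c) := by
  induction r generalizing c with
  | zero => simp [toTop]
  | succ r ih =>
    rcases hc : cr r c with _ | _
    · obtain ⟨t, h1, -, -, h4⟩ := exists_toTop_succ_of_elbow h hc
      rw [h4]
      exact h1.le.trans (ih t)
    · rw [toTop_succ_of_cross h hc]
      exact ih c

lemma toTop_zero (q : ℕ) : toTop cr n 0 q = q := rfl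

lemma exists_last_elbow {r b t : ℕ} (ht : cr r t = false) (htb : t ≤ b) :
    ∃ d ≤ b, cr r d = false ∧ ∀ c ≤ b, cr r c = false → c ≤ d := by
  obtain ⟨d, hd⟩ := ((Finset.range (b + 1)).filter fun c => cr r c = false).exists_maximal
    ⟨t, by simpa [Nat.lt_succ_iff] using ⟨htb, ht⟩⟩
  have h := hd.1
  simp only [Finset.mem_filter, Finset.mem_range] at h
  exact ⟨d, by omega, h.2, fun c hc hcr => not_lt.1 fun hlt =>
    hd.not_gt (by simpa [Nat.lt_succ_iff] using ⟨hc, hcr⟩) hlt⟩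

/-- If, in a rectangle at the north-west corner, the first elbow of each row lies below the last
elbow of the preceding rows, then only the first pipe enters the rectangle from the top and leaves
it to the left. -/
theorem lt_toTop_of_chain (h : InStaircase cr n) {a b : ℕ} (ha : a ≤ n) (h00 : cr 0 0 = false)
    (hstep : ∀ r, 1 ≤ r → r ≤ a → ∀ c ≤ b, cr r c = false → (∀ j < c, cr r j = true) →
      (∃ r' < r, cr r' c = false) ∧ ∀ r' < r, ∀ c' ≤ b, cr r' c' = false → c' ≤ c)
    {r : ℕ} (hr : 1 ≤ r) (hra : r ≤ a) : b < toTop cr n (n + 1) r := by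
  -- A pipe turning east at the last elbow of the row within the rectangle next turns up east of
  -- column `b`, and going up never brings it back west.
  have hlast : ∀ r d, d ≤ b → cr r d = false → (∀ c ≤ b, cr r c = false → c ≤ d) →
      b < toTop cr n (r + 1) (r + 1 + d) := by
    intro r d _ hd hmax
    obtain ⟨t, h1, -, h3, h4⟩ := exists_toTop_succ_of_elbow h hd
    rw [h4]
    have : b < t := by
      by_contra hb
      exact absurd (hmax t (not_lt.1 hb) h3) (not_le.2 h1)
    exact this.trans_le (le_toTop h r t)
  -- By `hstep`, the first elbow of a row within the rectangle is in the easternmost column `d` of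
  -- the earlier elbows.
  have hexit : ∀ r, 1 ≤ r → r ≤ a → ∀ d ≤ b, (∃ r' < r, cr r' d = false) →
      (∀ r' < r, ∀ c ≤ b, cr r' c = false → c ≤ d) → ∀ t ≤ b, (∀ j < t, cr r j = true) →
      cr r t = false → t = d := by
    rintro r hr hra d hdb ⟨r', hr', hd⟩ hmax t htb ht htf
    obtain ⟨⟨r'', hr'', h1⟩, h2⟩ := hstep r hr hra t htb htf ht
    exact le_antisymm (hmax r'' hr'' t htb h1) (h2 r' hr' d hdb hd)
  -- Invariant: below the first `r` rows, the pipe in the easternmost elbow column `d` comes from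
  -- outside the rectangle. A pipe leaving left in row `r` turns up either in this column or already
  -- east of the rectangle.
  have hinv : ∀ r, 1 ≤ r → r ≤ a + 1 → ∃ d ≤ b, (∃ r' < r, cr r' d = false) ∧
      (∀ r' < r, ∀ c ≤ b, cr r' c = false → c ≤ d) ∧ b < toTop cr n r (r + d) := by
    intro r hr
    induction r, hr using Nat.le_induction with
    | base =>
      intro _
      obtain ⟨d, hd, hd', hmax⟩ := exists_last_elbow h00 (Nat.zero_le b)
      refine ⟨d, hd, ⟨0, by omega, hd'⟩, fun r' hr' => ?_, ?_⟩
      · obtain rfl : r' = 0 := by omega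
        exact hmax
      · exact hlast 0 d hd hd' hmax
    | succ r hr ih =>
      intro hra
      obtain ⟨d, hdb, hde, hmax, hd⟩ := ih (by omega)
      obtain ⟨t, ht, htf, -⟩ := natAct_rowWord_self h r
      rcases le_or_gt t b with htb | htb
      · obtain rfl := hexit r hr (by omega) d hdb hde hmax t htb ht htf
        obtain ⟨d', hd', hd'f, hmax'⟩ := exists_last_elbow htf htb
        refine ⟨d', hd', ⟨r, by omega, hd'f⟩, fun r' hr' c hc hcf => ?_, hlast r d' hd' hd'f hmax'⟩
        rcases Nat.lt_succ_iff_lt_or_eq.1 hr' with hr' | rfl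
        · exact (hmax r' hr' c hc hcf).trans (hmax' t htb htf)
        · exact hmax' c hc hcf
      · obtain ⟨r₀, hr₀, hr₀d⟩ := hde
        refine ⟨d, hdb, ⟨r₀, by omega, hr₀d⟩, fun r' hr' c hc hcf => ?_, ?_⟩
        · rcases Nat.lt_succ_iff_lt_or_eq.1 hr' with hr' | rfl
          · exact hmax r' hr' c hc hcf
          · rw [ht c (by omega)] at hcf; exact Bool.noConfusion hcf
        · rw [toTop_succ_of_cross h (ht d (by omega))]; exact hd
  obtain ⟨d, hdb, hde, hmax, hd⟩ := hinv r hr (by omega)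
  obtain ⟨t, ht, htf, he⟩ := exists_toTop_exit h (hra.trans ha)
  rw [he]
  rcases le_or_gt t b with htb | htb
  · rwa [hexit r hr hra d hdb hde hmax t htb ht htf]
  · exact htb.trans_le (le_toTop h r t)

/-- Conversely, if only the first pipe enters the rectangle from the top and leaves it to the left,
then no elbow of the rectangle lies strictly south-west of another. -/
theorem le_of_lt_toTop (h : InStaircase cr n) {a b : ℕ} (ha : a ≤ n)
    (h0 : toTop cr n (n + 1) 0 = 0)
    (hlt : ∀ r, 1 ≤ r → r ≤ a → b < toTop cr n (n + 1) r)
    {r r' c c' : ℕ} (hr : r < r') (hr' : r' ≤ a) (hc : c ≤ b) (hcf : cr r c = false)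
    (hc' : c' ≤ b) (hcf' : cr r' c' = false) : c ≤ c' := by
  -- The pipe leaving left in row `r` must come from outside the rectangle. If only column `d` can
  -- carry such a pipe, the first elbow of the row is in column `d` as soon as the row has an elbow
  -- in the rectangle.
  have hfirst : ∀ r, 1 ≤ r → r ≤ a → ∀ d ≤ b, (∀ c ≤ b, c ≠ d → toTop cr n r (r + c) ≤ b) →
      ∀ c ≤ b, cr r c = false → cr r d = false ∧ ∀ c ≤ b, cr r c = false → d ≤ c := by
    intro r hr hra d hd hle c hc hcf
    obtain ⟨t, ht, htf, he⟩ := exists_toTop_exit h (hra.trans ha)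
    have hmin : ∀ c, cr r c = false → t ≤ c := fun c hcf => not_lt.1 fun hlt => by
      rw [ht c hlt] at hcf; exact Bool.noConfusion hcf
    have htd : t = d := by
      by_contra hne
      exact absurd (hle t ((hmin c hcf).trans hc) hne) (not_le.2 (he ▸ hlt r hr hra))
    subst htd
    exact ⟨htf, fun c _ => hmin c⟩
  -- Invariant: some column `d` bounds all elbows seen so far, and every pipe passing below these
  -- rows within the rectangle, except perhaps in column `d`, entered through its top side. After a
  -- row with elbows, its last elbow in the rectangle becomes the new `d`.
  have hinv : ∀ r, 1 ≤ r → r ≤ a + 1 → ∃ d ≤ b,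
      (∀ r' < r, ∀ c ≤ b, cr r' c = false → c ≤ d) ∧
      (∀ c ≤ b, c ≠ d → toTop cr n r (r + c) ≤ b) := by
    intro r hr
    induction r, hr using Nat.le_induction with
    | base =>
      intro _
      obtain ⟨t, ht, htf, he⟩ := exists_toTop_exit h (Nat.zero_le n)
      rw [h0, toTop_zero, zero_add] at he
      subst he
      obtain ⟨d, hd, hd', hmax⟩ := exists_last_elbow htf (Nat.zero_le b)
      refine ⟨d, hd, fun r' hr' => ?_, fun c hc hcd => ?_⟩
      · obtain rfl : r' = 0 := by omega
        exact hmax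
      · rcases hcc : cr 0 c with _ | _
        · obtain ⟨t, h1, h2, -, h4⟩ := exists_toTop_succ_of_elbow h hcc
          rw [h4, toTop_zero, zero_add]
          have hcd' := lt_of_le_of_ne (hmax c hc hcc) hcd
          by_contra htb
          rw [h2 d hcd' (by omega)] at hd'
          exact Bool.noConfusion hd'
        · rw [toTop_succ_of_cross h hcc, toTop_zero]
          omega
    | succ r hr ih =>
      intro hra
      obtain ⟨d, hdb, hmax, hd⟩ := ih (by omega)
      by_cases hex : ∃ c ≤ b, cr r c = false
      · obtain ⟨c₀, hc₀, hc₀f⟩ := hex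
        obtain ⟨hdf, hdmin⟩ := hfirst r hr (by omega) d hdb hd c₀ hc₀ hc₀f
        obtain ⟨d', hd'b, hd'f, hmax'⟩ := exists_last_elbow hc₀f hc₀
        refine ⟨d', hd'b, fun r' hr' c hc hcf => ?_, fun c hc hcd => ?_⟩
        · rcases Nat.lt_succ_iff_lt_or_eq.1 hr' with hr' | rfl
          · exact (hmax r' hr' c hc hcf).trans (hmax' d hdb hdf)
          · exact hmax' c hc hcf
        · rcases hcc : cr r c with _ | _
          · obtain ⟨t, h1, h2, -, h4⟩ := exists_toTop_succ_of_elbow h hcc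
            rw [h4]
            have hcd' := lt_of_le_of_ne (hmax' c hc hcc) hcd
            have htd : t ≤ d' := by
              by_contra htd
              rw [h2 d' hcd' (by omega)] at hd'f
              exact Bool.noConfusion hd'f
            have := hdmin c hc hcc
            exact hd t (by omega) (by omega)
          · rw [toTop_succ_of_cross h hcc]
            refine hd c hc ?_
            rintro rfl
            rw [hcc] at hdf
            exact Bool.noConfusion hdf
      · push Not at hex
        refine ⟨d, hdb, fun r' hr' c hc hcf => ?_, fun c hc hcd => ?_⟩
        · rcases Nat.lt_succ_iff_lt_or_eq.1 hr' with hr' | rfl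
          · exact hmax r' hr' c hc hcf
          · exact absurd hcf (hex c hc)
        · have hcc : cr r c = true := by simpa using hex c hc
          rw [toTop_succ_of_cross h hcc]
          exact hd c hc hcd
  obtain ⟨d, hdb, hmax, hd⟩ := hinv r' (by omega) (by omega)
  exact (hmax r hr c hc hcf).trans
    ((hfirst r' (by omega) hr' d hdb hd c' hc' hcf').2 c' hc' hcf')

end Pipes

/-! ### The shape of a dominant permutation shifted by one -/

section Shifted

variable {n : ℕ}

/-- The diagram of `π` is a nonempty partition whose north-west-most box is `(1, 1)`. -/
structure IsShiftedDominant (π : Equiv.Perm (Fin (n + 1))) : Prop where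
  symm_zero : π.symm 0 = 0
  nonempty : (rothe π).Nonempty
  ne_zero : ∀ p ∈ rothe π, p.1 ≠ 0 ∧ p.2 ≠ 0
  mem_of_le : ∀ p ∈ rothe π, ∀ q ≤ p, q.1 ≠ 0 → q.2 ≠ 0 → q ∈ rothe π

lemma oneCons_zero (π' : Equiv.Perm (Fin n)) : oneCons π' 0 = 0 := by simp [oneCons]

lemma oneCons_succ (π' : Equiv.Perm (Fin n)) (i : Fin n) : oneCons π' i.succ = (π' i).succ := by
  simp [oneCons]

lemma oneCons_symm_succ (π' : Equiv.Perm (Fin n)) (i : Fin n) :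
    (oneCons π').symm i.succ = (π'.symm i).succ := by
  rw [Equiv.symm_apply_eq, oneCons_succ, Equiv.apply_symm_apply]

lemma oneCons_symm_zero (π' : Equiv.Perm (Fin n)) : (oneCons π').symm 0 = 0 := by
  rw [Equiv.symm_apply_eq, oneCons_zero]

lemma succ_mem_rothe_oneCons {π' : Equiv.Perm (Fin n)} {a b : Fin n} :
    (a.succ, b.succ) ∈ rothe (oneCons π') ↔ (a, b) ∈ rothe π' := by
  simp [mem_rothe, oneCons_succ, oneCons_symm_succ]

lemma isShiftedDominant_oneCons {π' : Equiv.Perm (Fin n)} (hdom : IsDominant π') (hne : π' ≠ 1) :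
    IsShiftedDominant (oneCons π') := by
  have h0 : ∀ p ∈ rothe (oneCons π'), p.1 ≠ 0 ∧ p.2 ≠ 0 := by
    rintro ⟨a, b⟩ hp
    obtain ⟨h1, h2⟩ := mem_rothe.1 hp
    refine ⟨fun h => ?_, fun h => ?_⟩
    · simp only at h h2; rw [h, oneCons_symm_zero] at h2; simp at h2
    · simp only at h h1; rw [h, oneCons_zero] at h1; simp at h1
  refine ⟨oneCons_symm_zero π', ?_, h0, ?_⟩
  · have : (rothe π').Nonempty := by
      rw [Finset.nonempty_iff_ne_empty]
      intro h
      refine hne (rothe_injective (h.trans (Finset.eq_empty_of_forall_notMem fun p hp => ?_).symm))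
      obtain ⟨h1, h2⟩ := mem_rothe.1 hp
      exact lt_asymm h1 h2
    obtain ⟨⟨a, b⟩, hp⟩ := this
    exact ⟨(a.succ, b.succ), succ_mem_rothe_oneCons.2 hp⟩
  · rintro ⟨a, b⟩ hp ⟨a', b'⟩ hle ha' hb'
    obtain ⟨ha, hb⟩ := h0 _ hp
    obtain ⟨a, rfl⟩ := Fin.exists_succ_eq.2 ha
    obtain ⟨b, rfl⟩ := Fin.exists_succ_eq.2 hb
    obtain ⟨a', rfl⟩ := Fin.exists_succ_eq.2 ha'
    obtain ⟨b', rfl⟩ := Fin.exists_succ_eq.2 hb'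
    rw [succ_mem_rothe_oneCons] at hp ⊢
    exact hdom (show (a', b') ≤ (a, b) from
      ⟨Fin.succ_le_succ_iff.1 hle.1, Fin.succ_le_succ_iff.1 hle.2⟩) hp

open Classical in
/-- The region `NW(π)` as a finite set. -/
noncomputable def shape (π : Equiv.Perm (Fin (n + 1))) : Finset (Box (n + 1)) :=
  Finset.univ.filter (· ∈ regionNW π)

variable {π : Equiv.Perm (Fin (n + 1))}

lemma mem_shape {p : Box (n + 1)} : p ∈ shape π ↔ ∃ q ∈ rothe π, p ≤ q := by
  simp [shape, regionNW]

lemma isLowerSet_shape : IsLowerSet (shape π : Set (Box (n + 1))) := by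
  intro p q hqp hp
  obtain ⟨r, hr, hpr⟩ := mem_shape.1 hp
  exact mem_shape.2 ⟨r, hr, hqp.trans hpr⟩

lemma rothe_subset_shape : rothe π ⊆ shape π := fun p hp => mem_shape.2 ⟨p, hp, le_rfl⟩

/-! ### Corners, crosses and the core region in terms of the shape -/

namespace IsShiftedDominant

variable (h : IsShiftedDominant π)

include h

lemma mem_rothe_iff {p : Box (n + 1)} : p ∈ rothe π ↔ p ∈ shape π ∧ p.1 ≠ 0 ∧ p.2 ≠ 0 := by
  refine ⟨fun hp => ⟨rothe_subset_shape hp, h.ne_zero p hp⟩, fun ⟨hp, h1, h2⟩ => ?_⟩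
  obtain ⟨q, hq, hpq⟩ := mem_shape.1 hp
  exact h.mem_of_le q hq p hpq h1 h2

lemma mem_regionL_iff {p : Box (n + 1)} : p ∈ regionL π ↔ p ∈ shape π := by
  have hdom : dominantPiece π = ∅ := by
    refine Set.eq_empty_of_forall_notMem ?_
    rintro p ⟨o, ho, ho1, -⟩
    exact (h.ne_zero o ho).1 (Fin.ext ho1)
  rw [regionL, hdom, Set.sdiff_empty, mem_shape]
  rfl

lemma zero_mem_shape : (0, 0) ∈ shape π := by
  obtain ⟨q, hq⟩ := h.nonempty
  exact mem_shape.2 ⟨q, hq, Fin.zero_le _, Fin.zero_le _⟩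

/-- Off the first row and column the diagram is closed to the north-west, so testing the two
neighbours of a box is the same as testing all boxes south-east of it. -/
lemma mem_essentialSet_iff {p : Box (n + 1)} :
    p ∈ essentialSet π ↔ p ∈ shape π ∧ ∀ q ∈ shape π, ¬ p < q := by
  classical
  rw [essentialSet, Finset.mem_filter]
  constructor
  · rintro ⟨hp, hn⟩
    refine ⟨rothe_subset_shape hp, fun q hq hpq => ?_⟩
    obtain ⟨h1, h2⟩ := h.ne_zero p hp
    rcases Prod.lt_iff.1 hpq with ⟨hlt, hle⟩ | ⟨hle, hlt⟩
    · have hb := q.1.isLt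
      have hlt' : p.1.val < q.1.val := hlt
      refine hn (⟨p.1.val + 1, by omega⟩, p.2) (Or.inl ⟨rfl, rfl⟩) (h.mem_rothe_iff.2
        ⟨isLowerSet_shape (a := q) ⟨hlt, hle⟩ hq, ?_, h2⟩)
      exact fun e => absurd (congrArg Fin.val e) (Nat.succ_ne_zero _)
    · have hb := q.2.isLt
      have hlt' : p.2.val < q.2.val := hlt
      refine hn (p.1, ⟨p.2.val + 1, by omega⟩) (Or.inr ⟨rfl, rfl⟩) (h.mem_rothe_iff.2
        ⟨isLowerSet_shape (a := q) ⟨hle, hlt⟩ hq, h1, ?_⟩)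
      exact fun e => absurd (congrArg Fin.val e) (Nat.succ_ne_zero _)
  · rintro ⟨hp, hmax⟩
    obtain ⟨q, hq, hpq⟩ := mem_shape.1 hp
    have hpq : p = q := by
      by_contra hne
      exact hmax q (rothe_subset_shape hq) (lt_of_le_of_ne hpq hne)
    refine ⟨hpq ▸ hq, fun r hr hr' => hmax r (rothe_subset_shape hr') ?_⟩
    rcases hr with ⟨h1, h2⟩ | ⟨h1, h2⟩
    · exact Prod.lt_iff.2 (Or.inl ⟨by rw [Fin.lt_def]; omega, h2.ge⟩)
    · exact Prod.lt_iff.2 (Or.inr ⟨h1.ge, by rw [Fin.lt_def]; omega⟩)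

/-- A nonempty row of the diagram is an interval starting in column `1`, so aligning it to the left
moves it by exactly one column. -/
lemma mem_bottomCrosses_iff {p : Box (n + 1)} :
    p ∈ bottomCrosses π ↔ ∃ b, p.2 < b ∧ (p.1, b) ∈ rothe π := by
  simp only [bottomCrosses, Finset.mem_filter, Finset.mem_univ, true_and]
  constructor
  · intro hlt
    by_contra! hno
    have hle := Finset.card_le_card_of_injOn (t := Finset.Ioc 0 p.2) Prod.snd
      (s := (rothe π).filter fun q => q.1 = p.1) (fun q hq => by
        obtain ⟨hq, hq1⟩ := Finset.mem_filter.1 hq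
        refine Finset.mem_coe.2 (Finset.mem_Ioc.2 ⟨Fin.pos_iff_ne_zero.2 (h.ne_zero q hq).2,
          not_lt.1 fun hlt => hno _ hlt ?_⟩)
        rw [← hq1]; exact hq) (fun q hq q' hq' he => by
        refine Prod.ext ?_ he
        rw [(Finset.mem_filter.1 hq).2, (Finset.mem_filter.1 hq').2])
    rw [Fin.card_Ioc] at hle
    simp only [Fin.val_zero] at hle
    omega
  · rintro ⟨b, hb, hm⟩
    have hle := Finset.card_le_card_of_injOn (s := Finset.Ioc 0 b) (fun c => ((p.1, c) : Box (n + 1)))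
      (t := (rothe π).filter fun q => q.1 = p.1) (fun c hc => by
        obtain ⟨hc0, hcb⟩ := Finset.mem_Ioc.1 hc
        exact Finset.mem_coe.2 (Finset.mem_filter.2
          ⟨h.mem_of_le _ hm _ ⟨le_rfl, hcb⟩ (h.ne_zero _ hm).1 hc0.ne', rfl⟩))
      (fun c _ c' _ he => (Prod.ext_iff.1 he).2)
    rw [Fin.card_Ioc] at hle
    have : p.2.val < b.val := hb
    simp only [Fin.val_zero] at hle
    omega

lemma mem_topCrosses_iff {p : Box (n + 1)} :
    p ∈ topCrosses π ↔ ∃ a, p.1 < a ∧ (a, p.2) ∈ rothe π := by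
  simp only [topCrosses, Finset.mem_filter, Finset.mem_univ, true_and]
  constructor
  · intro hlt
    by_contra! hno
    have hle := Finset.card_le_card_of_injOn (t := Finset.Ioc 0 p.1) Prod.fst
      (s := (rothe π).filter fun q => q.2 = p.2) (fun q hq => by
        obtain ⟨hq, hq1⟩ := Finset.mem_filter.1 hq
        refine Finset.mem_coe.2 (Finset.mem_Ioc.2 ⟨Fin.pos_iff_ne_zero.2 (h.ne_zero q hq).1,
          not_lt.1 fun hlt => hno _ hlt ?_⟩)
        rw [← hq1]; exact hq) (fun q hq q' hq' he => by
        refine Prod.ext he ?_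
        rw [(Finset.mem_filter.1 hq).2, (Finset.mem_filter.1 hq').2])
    rw [Fin.card_Ioc] at hle
    simp only [Fin.val_zero] at hle
    omega
  · rintro ⟨a, ha, hm⟩
    have hle := Finset.card_le_card_of_injOn (s := Finset.Ioc 0 a) (fun c => ((c, p.2) : Box (n + 1)))
      (t := (rothe π).filter fun q => q.2 = p.2) (fun c hc => by
        obtain ⟨hc0, hcb⟩ := Finset.mem_Ioc.1 hc
        exact Finset.mem_coe.2 (Finset.mem_filter.2
          ⟨h.mem_of_le _ hm _ ⟨hcb, le_rfl⟩ hc0.ne' (h.ne_zero _ hm).2, rfl⟩))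
      (fun c _ c' _ he => (Prod.ext_iff.1 he).1)
    rw [Fin.card_Ioc] at hle
    have : p.1.val < a.val := ha
    simp only [Fin.val_zero] at hle
    omega

/-- The two shifted copies of the diagram cover `Λ` except for its maximal boxes and the origin: the
top copy is needed for the first row, the bottom copy for the first column. The exceptions are the
future cone points. -/
lemma mem_coreRegion_iff {p : Box (n + 1)} :
    p ∈ coreRegion π ↔ p ∈ shape π ∧ (∃ q ∈ shape π, p < q) ∧ p ≠ (0, 0) := by
  rw [coreRegion, Finset.mem_union, h.mem_bottomCrosses_iff, h.mem_topCrosses_iff]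
  constructor
  · rintro (⟨b, hb, hm⟩ | ⟨a, ha, hm⟩)
    · have hlt : p < (p.1, b) := Prod.lt_iff.2 (Or.inr ⟨le_rfl, hb⟩)
      refine ⟨mem_shape.2 ⟨_, hm, hlt.le⟩, ⟨_, rothe_subset_shape hm, hlt⟩, ?_⟩
      rintro rfl
      exact (h.ne_zero _ hm).1 rfl
    · have hlt : p < (a, p.2) := Prod.lt_iff.2 (Or.inl ⟨ha, le_rfl⟩)
      refine ⟨mem_shape.2 ⟨_, hm, hlt.le⟩, ⟨_, rothe_subset_shape hm, hlt⟩, ?_⟩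
      rintro rfl
      exact (h.ne_zero _ hm).2 rfl
  · rintro ⟨hp, ⟨q, hq, hpq⟩, hp0⟩
    obtain ⟨r, hr, hpr⟩ := mem_shape.1 hp
    by_cases h1 : p.1 = 0
    · have h2 : p.2 ≠ 0 := fun h2 => hp0 (Prod.ext h1 h2)
      exact Or.inr ⟨r.1, h1 ▸ Fin.pos_iff_ne_zero.2 (h.ne_zero r hr).1,
        h.mem_of_le r hr _ ⟨le_rfl, hpr.2⟩ (h.ne_zero r hr).1 h2⟩
    by_cases h2 : p.2 = 0
    · exact Or.inl ⟨r.2, h2 ▸ Fin.pos_iff_ne_zero.2 (h.ne_zero r hr).2,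
        h.mem_of_le r hr _ ⟨hpr.1, le_rfl⟩ h1 (h.ne_zero r hr).2⟩
    rcases Prod.lt_iff.1 hpq with ⟨hlt, hle⟩ | ⟨hle, hlt⟩
    · exact Or.inr ⟨q.1, hlt, h.mem_rothe_iff.2 ⟨isLowerSet_shape (a := q) ⟨le_rfl, hle⟩ hq,
        (Fin.pos_iff_ne_zero.1 (lt_of_le_of_lt (Fin.zero_le _) hlt)), h2⟩⟩
    · exact Or.inl ⟨q.2, hlt, h.mem_rothe_iff.2 ⟨isLowerSet_shape (a := q) ⟨hle, le_rfl⟩ hq, h1,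
        (Fin.pos_iff_ne_zero.1 (lt_of_le_of_lt (Fin.zero_le _) hlt))⟩⟩

lemma mem_regionR_iff {p : Box (n + 1)} :
    p ∈ regionR π ↔ p ∈ shape π ∧ ∃ q ∈ shape π, p < q := by
  rw [regionR, Finset.mem_insert, h.mem_coreRegion_iff]
  constructor
  · rintro (rfl | hp)
    · refine ⟨h.zero_mem_shape, ?_⟩
      obtain ⟨q, hq⟩ := h.nonempty
      exact ⟨q, rothe_subset_shape hq, lt_of_le_of_ne ⟨Fin.zero_le _, Fin.zero_le _⟩
        fun e => (h.ne_zero q hq).1 (by rw [← e])⟩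
    · exact ⟨hp.1, hp.2.1⟩
  · rintro ⟨hp, hq⟩
    by_cases h0 : p = (0, 0)
    · exact Or.inl h0
    · exact Or.inr ⟨hp, hq, h0⟩

lemma mem_essentialSet_or_mem_regionR {p : Box (n + 1)} (hp : p ∈ shape π) :
    p ∈ essentialSet π ∨ p ∈ regionR π := by
  rw [h.mem_essentialSet_iff, h.mem_regionR_iff]
  by_cases hq : ∃ q ∈ shape π, p < q
  · exact Or.inr ⟨hp, hq⟩
  · push Not at hq
    exact Or.inl ⟨hp, hq⟩

lemma notMem_regionR {p : Box (n + 1)} (hp : p ∈ essentialSet π) : p ∉ regionR π := by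
  rw [h.mem_regionR_iff]
  rintro ⟨-, q, hq, hpq⟩
  exact (h.mem_essentialSet_iff.1 hp).2 q hq hpq

/-- All boxes above `p` in its column, down from row `1`, are in the diagram. So `π.symm` maps the
rows `1, …, p.1` injectively into the positions after `p.2`, of which there are `n - p.2`. -/
lemma add_le_of_mem_rothe {p : Box (n + 1)} (hp : p ∈ rothe π) : p.1.val + p.2.val ≤ n := by
  have hle := Finset.card_le_card_of_injOn (s := Finset.Ioc 0 p.1) (t := Finset.Ioi p.2) π.symm
    (fun a ha => by
      obtain ⟨ha0, hap⟩ := Finset.mem_Ioc.1 ha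
      exact Finset.mem_coe.2 (Finset.mem_Ioi.2 (mem_rothe.1 (h.mem_of_le p hp (a, p.2)
        ⟨hap, le_rfl⟩ ha0.ne' (h.ne_zero p hp).2)).2))
    (fun _ _ _ _ he => π.symm.injective he)
  rw [Fin.card_Ioc, Fin.card_Ioi] at hle
  simp only [Fin.val_zero] at hle
  have := p.2.isLt
  omega

lemma add_lt_of_mem_regionR {p : Box (n + 1)} (hp : p ∈ regionR π) : p.1.val + p.2.val < n := by
  obtain ⟨-, q, hq, hpq⟩ := h.mem_regionR_iff.1 hp
  obtain ⟨r, hr, hqr⟩ := mem_shape.1 hq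
  have h1 := h.add_le_of_mem_rothe hr
  have h2 : q.1.val ≤ r.1.val := hqr.1
  have h3 : q.2.val ≤ r.2.val := hqr.2
  rcases Prod.lt_iff.1 hpq with ⟨h4, h5⟩ | ⟨h4, h5⟩ <;> rw [Fin.lt_def] at * <;>
    rw [Fin.le_def] at * <;> omega

lemma rothe_eq_filter_shape : rothe π = (shape π).filter fun p => p.1 ≠ 0 ∧ p.2 ≠ 0 := by
  ext p
  rw [Finset.mem_filter, h.mem_rothe_iff]

end IsShiftedDominant

end Shifted

/-! ### The core of the pipe dream complex -/

section Core

variable {n : ℕ}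

open Classical in
/-- The crosses on the complement of `G`. -/
noncomputable def crossOf (G : Finset (TriBox n)) (r j : ℕ) : Bool :=
  decide (∃ v : TriBox n, v ∉ G ∧ v.1.1.val = r ∧ v.1.2.val = j)

lemma inStaircase_crossOf (G : Finset (TriBox n)) : InStaircase (crossOf G) n := by
  intro r j h
  obtain ⟨v, -, rfl, rfl⟩ := of_decide_eq_true h
  exact v.2

lemma crossOf_eq_true_iff {G : Finset (TriBox n)} {p : Box (n + 1)} :
    crossOf G p.1 p.2 = true ↔ ∃ h : p.1.val + p.2.val < n, (⟨p, h⟩ : TriBox n) ∉ G := by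
  rw [crossOf, decide_eq_true_iff]
  constructor
  · rintro ⟨v, hv, h1, h2⟩
    obtain rfl : v.1 = p := Prod.ext (Fin.ext h1) (Fin.ext h2)
    exact ⟨v.2, hv⟩
  · rintro ⟨h, hv⟩
    exact ⟨_, hv, rfl, rfl⟩

open Classical in
lemma map_triWord_filter (G : Finset (TriBox n)) :
    (((triWord n).filter fun v => v ∉ G).map triLetter).map Fin.val =
      (List.range (n + 1)).reverse.flatMap (rowWord (crossOf G) n) := by
  have hrange : List.range (n + 1) = (List.finRange (n + 1)).map Fin.val := by
    rw [List.finRange_eq_pmap_range]; simp [List.map_pmap]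
  rw [triWord, List.filter_flatMap, List.map_flatMap, List.map_flatMap, hrange, ← List.map_reverse,
    List.flatMap_map]
  congr 1
  funext i
  rw [rowWord, hrange]
  induction List.finRange (n + 1) with
  | nil => rfl
  | cons j l ih =>
    rw [List.map_cons, List.filterMap_cons]
    by_cases h : i.val + j.val < n
    · rw [dif_pos h]
      by_cases hG : (⟨(i, j), h⟩ : TriBox n) ∈ G
      · have hc : ¬ crossOf G i j = true := fun hc =>
          (crossOf_eq_true_iff (p := (i, j)).1 hc).2 hG
        rw [List.filter_cons_of_neg hc]
        simp only
        rw [List.filter_cons_of_neg (by simpa using hG)]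
        exact ih
      · have hc : crossOf G i j = true := crossOf_eq_true_iff (p := (i, j)).2 ⟨h, hG⟩
        rw [List.filter_cons_of_pos hc]
        simp only
        rw [List.filter_cons_of_pos (by simpa using hG), List.map_cons, List.map_cons,
          List.map_cons, ih]
        rfl
    · rw [dif_neg h]
      have hc : ¬ crossOf G i j = true := fun hc => h (inStaircase_crossOf G _ _ hc)
      rw [List.filter_cons_of_neg hc]
      exact ih

open Classical in
lemma symm_wordProd_triWord (G : Finset (TriBox n)) (q : Fin (n + 1)) :
    ((wordProd (((triWord n).filter fun v => v ∉ G).map triLetter)).symm q).val =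
      toTop (crossOf G) n (n + 1) q.val := by
  rw [val_wordProd_symm, map_triWord_filter, toTop_eq_natAct]

lemma nodup_triWord : (triWord n).Nodup := by
  rw [triWord, List.nodup_flatMap]
  have hmem : ∀ (i : Fin (n + 1)) (v : TriBox n), v ∈ ((List.finRange (n + 1)).filterMap fun j =>
      if h : i.val + j.val < n then some (⟨(i, j), h⟩ : TriBox n) else none) → v.1.1 = i := by
    intro i v hv
    obtain ⟨j, -, hj⟩ := List.mem_filterMap.1 hv
    split_ifs at hj with h
    rw [← Option.some.inj hj]
  constructor
  · intro i _
    refine (List.nodup_finRange _).filterMap fun j j' v hv hv' => ?_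
    simp only [Option.mem_def] at hv hv'
    split_ifs at hv hv'
    rw [← Option.some.inj hv'] at hv
    exact (Prod.ext_iff.1 (Subtype.ext_iff.1 (Option.some.inj hv))).2
  · refine (List.nodup_reverse.2 (List.nodup_finRange _)).imp fun {i j} hij => ?_
    intro v hv hv'
    exact hij ((hmem _ v hv).symm.trans (hmem _ v hv'))

lemma mem_triWord (v : TriBox n) : v ∈ triWord n := by
  rw [triWord, List.mem_flatMap]
  refine ⟨v.1.1, by simp, List.mem_filterMap.2 ⟨v.1.2, by simp, ?_⟩⟩
  rw [dif_pos v.2]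

open Classical in
lemma length_triWord_filter (G : Finset (TriBox n)) :
    (((triWord n).filter fun v => v ∉ G).map triLetter).length = (Finset.univ \ G).card := by
  rw [List.length_map, ← List.toFinset_card_of_nodup (nodup_triWord.filter _)]
  congr 1
  ext v
  simp [mem_triWord]

variable {π : Equiv.Perm (Fin (n + 1))}

/-- The corner of a conflict avoids the first row and column, hence is in the diagram. So for each
row `r ≥ 1` of the rectangle ending at the corner, `π.symm r` lies beyond its last column, and
`le_of_lt_toTop` excludes the two elbows. -/
lemma IsShiftedDominant.conflictFree_of_wordProd_eq (h : IsShiftedDominant π)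
    {G : Finset (TriBox n)} (hG : IsSubwordFacet (triWord n) triLetter π G)
    {u v : TriBox n} (hu : u ∈ G) (hv : v ∈ G) : ¬ Conflict (shape π) u.1 v.1 := by
  classical
  rintro ⟨h1, h2, h3⟩
  have htop : ∀ q : Fin (n + 1), (π.symm q).val = toTop (crossOf G) n (n + 1) q.val := by
    intro q
    rw [← hG.2.1, ← symm_wordProd_triWord]
    congr!
  have hD : (u.1.1, v.1.2) ∈ rothe π := h.mem_rothe_iff.2 ⟨h3,
    Fin.pos_iff_ne_zero.1 (lt_of_le_of_lt (Fin.zero_le _) h1),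
    Fin.pos_iff_ne_zero.1 (lt_of_le_of_lt (Fin.zero_le _) h2)⟩
  have hne : ∀ w ∈ G, crossOf G w.1.1 w.1.2 = false := fun w hw => by
    rw [← Bool.not_eq_true, crossOf_eq_true_iff]
    rintro ⟨_, h'⟩
    exact h' hw
  refine absurd (le_of_lt_toTop (inStaircase_crossOf G) (a := u.1.1.val) (b := v.1.2.val)
    (Nat.lt_succ_iff.1 u.1.1.isLt) ?_ ?_ (r := v.1.1) (r' := u.1.1) h1 le_rfl le_rfl (hne v hv)
    (c' := u.1.2) (le_of_lt h2) (hne u hu)) (not_le.2 h2)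
  · have := htop 0
    rw [h.symm_zero] at this
    exact this.symm
  · intro r hr hra
    have hr' : r < n + 1 := lt_of_le_of_lt hra u.1.1.isLt
    have hm := mem_rothe.1 (h.mem_of_le _ hD ((⟨r, hr'⟩ : Fin (n + 1)), v.1.2) ⟨hra, le_rfl⟩
      (fun e => by have := congrArg Fin.val e; simp at this; omega) (h.ne_zero _ hD).2)
    have := htop ⟨r, hr'⟩
    rw [← this]
    exact hm.2

/-- The crosses are the boxes of `Λ` outside `F`, at most as many as the inversions of `π` by
`card_le`. Following pipes shows that their product has at least the inversions of `π`. Both bounds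
are then equalities, so the product is `π` and the word is reduced. -/
lemma IsShiftedDominant.exists_facet (h : IsShiftedDominant π) {F : Finset (Box (n + 1))}
    (hF : IsMaxConflictFree (shape π) F) :
    IsSubwordFacet (triWord n) triLetter π
      (Finset.univ.filter fun v : TriBox n => v.1 ∉ shape π ∨ v.1 ∈ F) := by
  classical
  set G : Finset (TriBox n) := Finset.univ.filter fun v : TriBox n => v.1 ∉ shape π ∨ v.1 ∈ F
    with hGdef
  have hmemG : ∀ v : TriBox n, v ∈ G ↔ v.1 ∉ shape π ∨ v.1 ∈ F := fun v => by simp [G]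
  have hΛ : IsLowerSet (shape π : Set (Box (n + 1))) := isLowerSet_shape
  have hcross : ∀ p ∈ shape π, (crossOf G p.1 p.2 = false ↔ p ∈ F) := by
    intro p hp
    rw [← Bool.not_eq_true, crossOf_eq_true_iff, not_exists]
    constructor
    · intro hn
      -- An essential box may lie just outside the staircase, where it is automatically not a cross;
      -- it belongs to `F` in any case.
      rcases h.mem_essentialSet_or_mem_regionR hp with he | hR
      · exact hF.mem_of_maximal hp (h.mem_essentialSet_iff.1 he).2
      · have := hn (h.add_lt_of_mem_regionR hR)
        rw [not_not, hmemG] at this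
        exact this.resolve_left (not_not.2 hp)
    · intro hpF hlt
      rw [not_not, hmemG]
      exact Or.inr hpF
  set w := ((triWord n).filter fun v => v ∉ G).map triLetter with hw
  have htop : ∀ q : Fin (n + 1), ((wordProd w).symm q).val = toTop (crossOf G) n (n + 1) q.val :=
    symm_wordProd_triWord G
  have h00 : crossOf G 0 0 = false :=
    (hcross (0, 0) h.zero_mem_shape).2 (hF.zero_mem h.zero_mem_shape)
  have hsymm0 : (wordProd w).symm 0 = 0 := by
    refine Fin.ext ?_
    rw [htop]
    obtain ⟨t, ht, -, he⟩ := exists_toTop_exit (inStaircase_crossOf G) (Nat.zero_le n)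
    obtain rfl : t = 0 := by
      by_contra ht0
      rw [ht 0 (Nat.pos_of_ne_zero ht0)] at h00
      exact Bool.noConfusion h00
    exact he
  have hlen : w.length ≤ (rothe π).card := by
    rw [hw, length_triWord_filter]
    have h1 : (Finset.univ \ G).card ≤ (shape π \ F).card := by
      refine Finset.card_le_card_of_injOn Subtype.val (fun v hv => ?_)
        (Subtype.val_injective.injOn)
      have := (Finset.mem_sdiff.1 hv).2
      rw [hmemG] at this
      push Not at this
      exact Finset.mem_coe.2 (Finset.mem_sdiff.2 this)
    have h2 := hF.card_le hΛ
    rw [← h.rothe_eq_filter_shape] at h2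
    rw [Finset.card_sdiff_of_subset hF.subset] at h1
    omega
  have hsub : rothe π ⊆ rothe (wordProd w) := by
    rintro ⟨a, b⟩ hab
    have habΛ := rothe_subset_shape hab
    obtain ⟨ha0, hb0⟩ := h.ne_zero _ hab
    simp only at ha0 hb0
    have key : ∀ r : Fin (n + 1), r ≠ 0 → r ≤ a → b < (wordProd w).symm r := by
      intro r hr hra
      rw [Fin.lt_def, htop]
      refine lt_toTop_of_chain (inStaircase_crossOf G) (a := a) (Nat.lt_succ_iff.1 a.isLt) h00 ?_
        (Nat.one_le_iff_ne_zero.2 fun e => hr (Fin.ext e)) hra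
      intro r hr hra c hcb hcf hcmin
      have hr' : r < n + 1 := lt_of_le_of_lt hra a.isLt
      have hc' : c < n + 1 := lt_of_le_of_lt hcb b.isLt
      set z : Box (n + 1) := (⟨r, hr'⟩, ⟨c, hc'⟩) with hz
      have hzΛ : z ∈ shape π := hΛ (show z ≤ (a, b) from ⟨hra, hcb⟩) habΛ
      have hzF : z ∈ F := (hcross z hzΛ).1 hcf
      -- Since `z` is the first elbow of its row, its predecessor in `F` is above it in the same
      -- column. Conflict-freeness keeps the earlier elbows of the rectangle from lying further
      -- east.
      obtain ⟨y, hyF, hyz, hy⟩ := hF.exists_lt hΛ hzF fun e => by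
        have := congrArg (fun p : Box (n + 1) => p.1.val) e
        simp [hz] at this
        omega
      have hyf := (hcross y (hF.subset hyF)).2 hyF
      have hy2 : y.2 = z.2 := by
        rcases hy with hy | hy
        · exfalso
          have hlt : y.2.val < c := by
            rcases Prod.lt_iff.1 hyz with ⟨hlt, -⟩ | ⟨-, hlt⟩
            · exact absurd hy hlt.ne
            · exact hlt
          have := hcmin _ hlt
          rw [hy] at hyf
          rw [show crossOf G r y.2.val = false from hyf] at this
          exact Bool.noConfusion this
        · exact hy
      have hy1 : y.1.val < r := by
        rcases Prod.lt_iff.1 hyz with ⟨hlt, -⟩ | ⟨-, hlt⟩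
        · exact hlt
        · exact absurd hy2 hlt.ne
      refine ⟨⟨y.1, hy1, ?_⟩, fun r' hr'r c' hc'b hcf' => ?_⟩
      · rw [hy2] at hyf; exact hyf
      · by_contra hlt
        have hx : ((⟨r', by omega⟩, ⟨c', by omega⟩) : Box (n + 1)) ∈ F := by
          refine (hcross _ (hΛ (show _ ≤ ((a, b) : Box (n + 1)) from ⟨?_, ?_⟩) habΛ)).1 hcf'
          · exact Fin.le_def.2 (by simp only; omega)
          · exact Fin.le_def.2 hc'b
        exact hF.conflictFree z hzF _ hx ⟨Fin.lt_def.2 hr'r, Fin.lt_def.2 (not_le.1 hlt),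
          hΛ (show _ ≤ ((a, b) : Box (n + 1)) from ⟨hra, hc'b⟩) habΛ⟩
    refine mem_rothe.2 ⟨?_, key a ha0 le_rfl⟩
    by_contra hle
    have hle : wordProd w b ≤ a := not_lt.1 hle
    by_cases h0 : wordProd w b = 0
    · rw [← Equiv.eq_symm_apply, hsymm0] at h0
      exact hb0 h0
    · have := key _ h0 hle
      simp at this
  have hprod : wordProd w = π := rothe_injective
    (Finset.eq_of_subset_of_card_le hsub ((card_rothe_wordProd_le w).trans hlen)).symm
  refine ⟨fun v _ => mem_triWord v, ?_⟩
  have hred : IsReducedExpression w π := ⟨hprod, fun w' hw' =>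
    hlen.trans (hw' ▸ card_rothe_wordProd_le w')⟩
  convert hred

/-- The faces of the core are the conflict-free sets of boxes of the core region. -/
theorem IsShiftedDominant.mem_core_faces_iff (h : IsShiftedDominant π) {F : Finset (TriBox n)} :
    F ∈ (core π).faces ↔ F.Nonempty ∧ (∀ v ∈ F, v.1 ∈ coreRegion π) ∧
      ∀ u ∈ F, ∀ v ∈ F, ¬ Conflict (shape π) u.1 v.1 := by
  classical
  constructor
  · rintro ⟨⟨hne, G, hG, hFG⟩, hcr⟩
    exact ⟨hne, hcr, fun u hu v hv => h.conflictFree_of_wordProd_eq hG (hFG hu) (hFG hv)⟩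
  · rintro ⟨hne, hcr, hc⟩
    obtain ⟨F', hFF', hF'⟩ := ConflictFree.exists_isMaxConflictFree (Λ := shape π)
      (F := F.image Subtype.val) (fun p hp => by
        obtain ⟨v, hv, rfl⟩ := Finset.mem_image.1 hp
        exact (h.mem_coreRegion_iff.1 (hcr v hv)).1) (fun p hp q hq => by
        obtain ⟨u, hu, rfl⟩ := Finset.mem_image.1 hp
        obtain ⟨v, hv, rfl⟩ := Finset.mem_image.1 hq
        exact hc u hu v hv)
    refine ⟨⟨hne, _, h.exists_facet hF', fun v hv => ?_⟩, hcr⟩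
    simp only [Finset.mem_filter, Finset.mem_univ, true_and]
    exact Or.inr (hFF' (Finset.mem_image_of_mem _ hv))

end Core

/-! ### The labels of the boundary steps -/

section Labels

variable {n : ℕ} {π : Equiv.Perm (Fin (n + 1))}

lemma inl_mem_labelledSteps {a : Fin (n + 1)} :
    Sum.inl a ∈ labelledSteps π ↔ ∃ b, (a, b) ∈ regionR π := by
  simp [labelledSteps]

lemma inr_mem_labelledSteps {b : Fin (n + 1)} :
    Sum.inr b ∈ labelledSteps π ↔ (∃ a, (a, b) ∈ regionR π) ∧ ∀ a, (a, b) ∉ essentialSet π := by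
  simp [labelledSteps]

namespace IsShiftedDominant

variable (h : IsShiftedDominant π)

include h

lemma isLowerSet_regionR : IsLowerSet (regionR π : Set (Box (n + 1))) := by
  intro p q hqp hp
  obtain ⟨hp, r, hr, hpr⟩ := h.mem_regionR_iff.1 hp
  exact h.mem_regionR_iff.2 ⟨isLowerSet_shape hqp hp, r, hr, hqp.trans_lt hpr⟩

lemma mem_regionR_of_lt {p q : Box (n + 1)} (hq : q ∈ shape π) (hpq : p < q) : p ∈ regionR π :=
  h.mem_regionR_iff.2 ⟨isLowerSet_shape hpq.le hq, q, hq, hpq⟩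

lemma mem_shape_of_mem_regionR {p : Box (n + 1)} (hp : p ∈ regionR π) : p ∈ shape π :=
  (h.mem_regionR_iff.1 hp).1

lemma mem_shape_of_mem_essentialSet {p : Box (n + 1)} (hp : p ∈ essentialSet π) : p ∈ shape π :=
  (h.mem_essentialSet_iff.1 hp).1

lemma not_lt_of_mem_essentialSet {p q : Box (n + 1)} (hp : p ∈ essentialSet π) (hq : q ∈ shape π) :
    ¬ p < q :=
  (h.mem_essentialSet_iff.1 hp).2 q hq

lemma ne_zero_of_mem_essentialSet {p : Box (n + 1)} (hp : p ∈ essentialSet π) :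
    p.1 ≠ 0 ∧ p.2 ≠ 0 := by
  classical
  rw [essentialSet, Finset.mem_filter] at hp
  exact h.ne_zero p hp.1

lemma exists_col_regionR {a : Fin (n + 1)} (ha : ∃ b, (a, b) ∈ shape π) :
    ∃ b, (a, b) ∈ regionR π := by
  obtain ⟨b, hb⟩ := ha
  have : (a, 0) ∈ shape π := isLowerSet_shape (show (a, 0) ≤ (a, b) from ⟨le_rfl, Fin.zero_le _⟩) hb
  exact ⟨0, (h.mem_essentialSet_or_mem_regionR this).resolve_left fun h' =>
    (h.ne_zero_of_mem_essentialSet h').2 rfl⟩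

lemma exists_row_regionR {b : Fin (n + 1)} (hb : ∃ a, (a, b) ∈ shape π) :
    ∃ a, (a, b) ∈ regionR π := by
  obtain ⟨a, ha⟩ := hb
  have : (0, b) ∈ shape π := isLowerSet_shape (show (0, b) ≤ (a, b) from ⟨Fin.zero_le _, le_rfl⟩) ha
  exact ⟨0, (h.mem_essentialSet_or_mem_regionR this).resolve_left fun h' =>
    (h.ne_zero_of_mem_essentialSet h').1 rfl⟩

/-- Because R(π) is closed to the north-west, its boundary is a lattice path, and box membership
orders the steps along it. -/
lemma stepBefore_trans {s t u : Step n} (hst : stepBefore π s t) (htu : stepBefore π t u) :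
    stepBefore π s u := by
  have hR := h.isLowerSet_regionR
  rcases s with a | b <;> rcases t with a' | b' <;> rcases u with a'' | b'' <;>
    simp only [stepBefore] at *
  · exact htu.trans hst
  · exact fun h' => htu (hR (show (a', b'') ≤ (a, b'') from ⟨hst.le, le_rfl⟩) h')
  · by_contra hle
    exact hst (hR (show (a, b') ≤ (a'', b') from ⟨not_lt.1 hle, le_rfl⟩) htu)
  · exact fun h' => hst (hR (show (a, b') ≤ (a, b'') from ⟨le_rfl, htu.le⟩) h')
  · exact hR (show (a'', b) ≤ (a', b) from ⟨htu.le, le_rfl⟩) hst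
  · by_contra hle
    exact htu (hR (show (a', b'') ≤ (a', b) from ⟨le_rfl, not_lt.1 hle⟩) hst)
  · exact hR (show (a'', b) ≤ (a'', b') from ⟨le_rfl, hst.le⟩) htu
  · exact hst.trans htu

omit h in
lemma not_stepBefore_self (s : Step n) : ¬ stepBefore π s s := by
  rcases s with a | b <;> simp [stepBefore]

lemma stepLabel_lt_stepLabel {s t : Step n} (hs : s ∈ labelledSteps π) (ht : t ∈ labelledSteps π)
    (hst : stepBefore π s t) : stepLabel π s < stepLabel π t := by
  classical
  rw [stepLabel, stepLabel, if_pos hs, if_pos ht]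
  refine Finset.card_lt_card (Finset.ssubset_iff_of_subset (fun u hu => ?_) |>.2 ⟨s, ?_, ?_⟩)
  · obtain ⟨hu, hus⟩ := Finset.mem_filter.1 hu
    exact Finset.mem_filter.2 ⟨hu, h.stepBefore_trans hus hst⟩
  · exact Finset.mem_filter.2 ⟨hs, hst⟩
  · exact fun h' => not_stepBefore_self s (Finset.mem_filter.1 h').2

lemma stepLabel_inl_lt {a a' : Fin (n + 1)} (ha : ∃ b, (a, b) ∈ shape π)
    (ha' : ∃ b, (a', b) ∈ shape π) (hlt : a' < a) :
    stepLabel π (Sum.inl a) < stepLabel π (Sum.inl a') :=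
  h.stepLabel_lt_stepLabel (inl_mem_labelledSteps.2 (h.exists_col_regionR ha))
    (inl_mem_labelledSteps.2 (h.exists_col_regionR ha')) hlt

/-- The steps of `A` before the `E` step on column `b` are the `N` step on row `i` and those before
it; the `- 1` in `stepLabel` removes this extra step. -/
lemma stepLabel_inr_eq {i b : Fin (n + 1)} (hib : (i, b) ∈ essentialSet π) :
    stepLabel π (Sum.inr b) = stepLabel π (Sum.inl i) := by
  classical
  have hN : Sum.inl i ∈ labelledSteps π := inl_mem_labelledSteps.2
    (h.exists_col_regionR ⟨b, h.mem_shape_of_mem_essentialSet hib⟩)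
  have hE : Sum.inr b ∉ labelledSteps π := fun h' => (inr_mem_labelledSteps.1 h').2 i hib
  have hR := h.isLowerSet_regionR
  have hnR := h.notMem_regionR hib
  have hS := h.mem_shape_of_mem_essentialSet hib
  rw [stepLabel, stepLabel, if_pos hN, if_neg hE]
  have : (labelledSteps π).filter (fun t => stepBefore π t (Sum.inr b)) =
      insert (Sum.inl i) ((labelledSteps π).filter fun t => stepBefore π t (Sum.inl i)) := by
    ext t
    simp only [Finset.mem_filter, Finset.mem_insert]
    rcases t with a | c
    · simp only [stepBefore, Sum.inl.injEq]
      constructor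
      · rintro ⟨ht, hab⟩
        rcases lt_trichotomy a i with hlt | rfl | hlt
        · exact absurd (h.mem_regionR_of_lt (p := (a, b)) hS
            (Prod.lt_iff.2 (Or.inl ⟨hlt, le_rfl⟩))) hab
        · exact Or.inl rfl
        · exact Or.inr ⟨ht, hlt⟩
      · rintro (rfl | ⟨ht, hlt⟩)
        · exact ⟨hN, hnR⟩
        · exact ⟨ht, fun h' => hnR (hR (show (i, b) ≤ (a, b) from ⟨hlt.le, le_rfl⟩) h')⟩
    · simp only [stepBefore, reduceCtorEq, false_or]
      refine and_congr_right fun ht => ⟨fun hcb => h.mem_regionR_of_lt hS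
        (Prod.lt_iff.2 (Or.inr ⟨le_rfl, hcb⟩)), fun hc => ?_⟩
      by_contra hle
      exact hnR (hR (show (i, b) ≤ (i, c) from ⟨le_rfl, not_lt.1 hle⟩) hc)
  rw [this, Finset.card_insert_of_notMem, Nat.add_sub_cancel]
  exact fun h' => not_stepBefore_self _ (Finset.mem_filter.1 h').2

lemma inr_mem_labelledSteps_or {b : Fin (n + 1)} (hb : ∃ a, (a, b) ∈ shape π) :
    Sum.inr b ∈ labelledSteps π ∨ ∃ i, (i, b) ∈ essentialSet π := by
  by_cases h' : ∃ i, (i, b) ∈ essentialSet π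
  · exact Or.inr h'
  · push Not at h'
    exact Or.inl (inr_mem_labelledSteps.2 ⟨h.exists_row_regionR hb, h'⟩)

/-- For rows and columns meeting `Λ`, this, `stepLabel_inr_eq` and `stepLabel_inl_lt_inr` form a
trichotomy: the label of column `b` is below, equal to or above that of row `a` according as `(a,
b)` is in R(π), essential or outside `Λ`. Columns without a label of their own are handled through
their essential box. -/
lemma stepLabel_inr_lt_inl {a b : Fin (n + 1)} (hab : (a, b) ∈ regionR π) :
    stepLabel π (Sum.inr b) < stepLabel π (Sum.inl a) := by
  have hS := h.mem_shape_of_mem_regionR hab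
  rcases h.inr_mem_labelledSteps_or ⟨a, hS⟩ with hb | ⟨i, hi⟩
  · exact h.stepLabel_lt_stepLabel hb (inl_mem_labelledSteps.2 ⟨b, hab⟩) hab
  · rw [h.stepLabel_inr_eq hi]
    refine h.stepLabel_inl_lt ⟨b, h.mem_shape_of_mem_essentialSet hi⟩ ⟨b, hS⟩ ?_
    by_contra hle
    exact h.notMem_regionR hi (h.isLowerSet_regionR
      (show (i, b) ≤ (a, b) from ⟨not_lt.1 hle, le_rfl⟩) hab)

lemma stepLabel_inl_lt_inr {a b : Fin (n + 1)} (ha : ∃ c, (a, c) ∈ shape π)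
    (hb : ∃ c, (c, b) ∈ shape π) (hab : (a, b) ∉ shape π) :
    stepLabel π (Sum.inl a) < stepLabel π (Sum.inr b) := by
  rcases h.inr_mem_labelledSteps_or hb with hb | ⟨i, hi⟩
  · exact h.stepLabel_lt_stepLabel (inl_mem_labelledSteps.2 (h.exists_col_regionR ha)) hb
      fun h' => hab (h.mem_shape_of_mem_regionR h')
  · rw [h.stepLabel_inr_eq hi]
    refine h.stepLabel_inl_lt ha ⟨b, h.mem_shape_of_mem_essentialSet hi⟩ ?_
    by_contra hle
    exact hab (isLowerSet_shape (show (a, b) ≤ (i, b) from ⟨not_lt.1 hle, le_rfl⟩)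
      (h.mem_shape_of_mem_essentialSet hi))

lemma stepLabel_inr_lt {b b' : Fin (n + 1)} (hb : ∃ a, (a, b) ∈ shape π)
    (hb' : ∃ a, (a, b') ∈ shape π) (hlt : b < b') :
    stepLabel π (Sum.inr b) < stepLabel π (Sum.inr b') := by
  rcases h.inr_mem_labelledSteps_or hb' with hA' | ⟨i', hi'⟩
  · rcases h.inr_mem_labelledSteps_or hb with hA | ⟨i, hi⟩
    · exact h.stepLabel_lt_stepLabel hA hA' hlt
    · rw [h.stepLabel_inr_eq hi]
      exact h.stepLabel_inl_lt_inr ⟨b, h.mem_shape_of_mem_essentialSet hi⟩ hb' fun h' =>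
        h.not_lt_of_mem_essentialSet hi h' (Prod.lt_iff.2 (Or.inr ⟨le_rfl, hlt⟩))
  · rw [h.stepLabel_inr_eq hi']
    exact h.stepLabel_inr_lt_inl (h.mem_regionR_of_lt (h.mem_shape_of_mem_essentialSet hi')
      (Prod.lt_iff.2 (Or.inr ⟨le_rfl, hlt⟩)))

omit h in
lemma stepLabel_lt_card_of_mem {s : Step n} (hs : s ∈ labelledSteps π) :
    stepLabel π s < (labelledSteps π).card := by
  classical
  rw [stepLabel, if_pos hs]
  refine Finset.card_lt_card (Finset.ssubset_iff_of_subset (Finset.filter_subset _ _) |>.2 ⟨s, hs, ?_⟩)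
  exact fun h' => not_stepBefore_self s (Finset.mem_filter.1 h').2

lemma stepLabel_inl_lt_card {a : Fin (n + 1)} (ha : ∃ b, (a, b) ∈ shape π) :
    stepLabel π (Sum.inl a) < (labelledSteps π).card :=
  stepLabel_lt_card_of_mem (inl_mem_labelledSteps.2 (h.exists_col_regionR ha))

lemma stepLabel_inr_lt_card {b : Fin (n + 1)} (hb : ∃ a, (a, b) ∈ shape π) :
    stepLabel π (Sum.inr b) < (labelledSteps π).card := by
  rcases h.inr_mem_labelledSteps_or hb with hA | ⟨i, hi⟩
  · exact stepLabel_lt_card_of_mem hA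
  · rw [h.stepLabel_inr_eq hi]
    exact h.stepLabel_inl_lt_card ⟨b, h.mem_shape_of_mem_essentialSet hi⟩

omit h in
lemma stepBefore_or_stepBefore {s t : Step n} (hst : s ≠ t) :
    stepBefore π s t ∨ stepBefore π t s := by
  rcases s with a | b <;> rcases t with a' | b' <;> simp only [stepBefore]
  · exact (lt_or_gt_of_ne fun e => hst (by rw [e])).symm
  · exact (em _).symm
  · exact em _
  · exact lt_or_gt_of_ne fun e => hst (by rw [e])

lemma exists_stepLabel_eq (k : Fin (labelledSteps π).card) :
    ∃ s ∈ labelledSteps π, stepLabel π s = k := by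
  classical
  have := Finset.surj_on_of_inj_on_of_card_le (s := labelledSteps π)
    (t := Finset.range (labelledSteps π).card) (fun s _ => stepLabel π s)
    (fun s hs => Finset.mem_range.2 (stepLabel_lt_card_of_mem hs)) (fun s t hs ht he => by
      by_contra hst
      rcases stepBefore_or_stepBefore (π := π) hst with h' | h'
      · exact (h.stepLabel_lt_stepLabel hs ht h').ne he
      · exact (h.stepLabel_lt_stepLabel ht hs h').ne' he) (by simp) k (Finset.mem_range.2 k.isLt)
  obtain ⟨s, hs, he⟩ := this
  exact ⟨s, hs, he.symm⟩

/-! ### The transitive closure of `T(π)` -/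

/-- A bottom cross needs a box of the diagram strictly to its east. With no box of `Λ` strictly
south-east of `(a, b)`, all boxes of R(π) below it in its column carry dots; the dot in the first
row is one more, so the dropped dots reach `(a, b)`. -/
lemma mem_droppedDots {a b : Fin (n + 1)} (hab : (a, b) ∈ regionR π)
    (hno : ∀ a' b', a < a' → b < b' → (a', b') ∉ shape π) : (a, b) ∈ droppedDots π := by
  classical
  refine Finset.mem_filter.2 ⟨hab, Finset.card_lt_card
    (Finset.ssubset_iff_of_subset (fun q hq => ?_) |>.2 ⟨(0, b), ?_, ?_⟩)⟩
  · obtain ⟨hq, hqb, haq⟩ := Finset.mem_filter.1 hq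
    refine Finset.mem_filter.2 ⟨hq, hqb, fun hq' => ?_⟩
    obtain ⟨c, hc, hm⟩ := h.mem_bottomCrosses_iff.1 hq'
    exact hno _ _ haq ((show b = q.2 from hqb.symm).trans_lt hc) (rothe_subset_shape hm)
  · refine Finset.mem_filter.2 ⟨h.isLowerSet_regionR
      (show (0, b) ≤ (a, b) from ⟨Fin.zero_le _, le_rfl⟩) hab, rfl, fun hq' => ?_⟩
    obtain ⟨c, -, hm⟩ := h.mem_bottomCrosses_iff.1 hq'
    exact (h.ne_zero _ hm).1 rfl
  · intro h'
    have := (Finset.mem_filter.1 h').2.2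
    simp at this

lemma treeT_adj_iff {i j : Fin (labelledSteps π).card} (hij : i < j) :
    (treeT π).Adj i j ↔ ∃ p ∈ droppedDots π, stepLabel π (Sum.inr p.2) = i.val ∧
      stepLabel π (Sum.inl p.1) = j.val := by
  rw [treeT, SimpleGraph.fromRel_adj]
  refine ⟨fun ⟨_, h'⟩ => h'.resolve_right ?_, fun h' => ⟨hij.ne, Or.inl h'⟩⟩
  rintro ⟨p, hp, h1, h2⟩
  have := h.stepLabel_inr_lt_inl (Finset.mem_filter.1 hp).1
  rw [h1, h2] at this
  exact lt_asymm hij this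

/-- If `(a, b)` has boxes of `Λ` strictly south-east of it, let `(k, d)` be the last box of the
lowest row reaching beyond column `b`. It is essential, so row `k` and column `d` share a label: the
dropped dot `(k, b)` is an edge into this label, and the path continues from `(a, d)`, further east.
-/
lemma transGen_treeT {b : Fin (n + 1)} : ∀ {a : Fin (n + 1)}, (a, b) ∈ regionR π →
    ∀ {i j : Fin (labelledSteps π).card}, stepLabel π (Sum.inr b) = i →
      stepLabel π (Sum.inl a) = j →
      Relation.TransGen (fun i j => i < j ∧ (treeT π).Adj i j) i j := by
  classical
  induction b using WellFoundedGT.induction with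
  | ind b ih =>
    intro a hab i j hi hj
    by_cases hno : ∀ a' b', a < a' → b < b' → (a', b') ∉ shape π
    · have hij : i < j := by
        have := h.stepLabel_inr_lt_inl hab
        rw [hi, hj] at this
        exact this
      exact Relation.TransGen.single ⟨hij, (h.treeT_adj_iff hij).2
        ⟨_, h.mem_droppedDots hab hno, hi, hj⟩⟩
    · push Not at hno
      obtain ⟨a', b', ha', hb', hS⟩ := hno
      obtain ⟨k, hak, hk⟩ := Finset.exists_le_maximal
        (Finset.univ.filter fun k => ∃ c, b < c ∧ (k, c) ∈ shape π)
        (Finset.mem_filter.2 ⟨Finset.mem_univ a', b', hb', hS⟩)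
      obtain ⟨c, hbc, hc⟩ := (Finset.mem_filter.1 hk.1).2
      obtain ⟨d, hcd, hd⟩ := Finset.exists_le_maximal (Finset.univ.filter fun d => (k, d) ∈ shape π)
        (Finset.mem_filter.2 ⟨Finset.mem_univ c, hc⟩)
      have hbd := hbc.trans_le hcd
      have hdS : (k, d) ∈ shape π := (Finset.mem_filter.1 hd.1).2
      have hkmax : ∀ a' b', k < a' → b < b' → (a', b') ∉ shape π := fun a' b' hka hbb hS =>
        hk.not_gt (Finset.mem_filter.2 ⟨Finset.mem_univ _, b', hbb, hS⟩) hka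
      have hess : (k, d) ∈ essentialSet π := by
        refine h.mem_essentialSet_iff.2 ⟨hdS, fun q hq hlt => ?_⟩
        rcases Prod.lt_iff.1 hlt with ⟨h1, h2⟩ | ⟨h1, h2⟩
        · exact hkmax q.1 q.2 h1 (hbd.trans_le h2) hq
        · refine hd.not_gt (Finset.mem_filter.2 ⟨Finset.mem_univ _, ?_⟩) h2
          exact isLowerSet_shape (show (k, q.2) ≤ q from ⟨h1, le_rfl⟩) hq
      have hkb : (k, b) ∈ regionR π :=
        h.mem_regionR_of_lt hdS (Prod.lt_iff.2 (Or.inr ⟨le_rfl, hbd⟩))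
      have hadR : (a, d) ∈ regionR π :=
        h.mem_regionR_of_lt hdS (Prod.lt_iff.2 (Or.inl ⟨ha'.trans_le hak, le_rfl⟩))
      let l : Fin (labelledSteps π).card :=
        ⟨stepLabel π (Sum.inl k), h.stepLabel_inl_lt_card ⟨d, hdS⟩⟩
      have hil : i < l := by
        have := h.stepLabel_inr_lt_inl hkb
        rw [hi] at this
        exact this
      exact Relation.TransGen.head ⟨hil, (h.treeT_adj_iff hil).2
        ⟨_, h.mem_droppedDots hkb hkmax, hi, rfl⟩⟩ (ih d hbd hadR (h.stepLabel_inr_eq hess) hj)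

/-- The edges of the transitive closure of `T(π)` correspond to the boxes of `R(π)`. -/
theorem transClosure_treeT_adj_iff {i j : Fin (labelledSteps π).card} (hij : i < j) :
    (transClosure (treeT π)).Adj i j ↔ ∃ p ∈ regionR π, stepLabel π (Sum.inr p.2) = i.val ∧
      stepLabel π (Sum.inl p.1) = j.val := by
  have key : ∀ {i j : Fin (labelledSteps π).card},
      Relation.TransGen (fun i j => i < j ∧ (treeT π).Adj i j) i j →
      ∃ p ∈ regionR π, stepLabel π (Sum.inr p.2) = i.val ∧ stepLabel π (Sum.inl p.1) = j.val := by
    intro i j hT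
    induction hT with
    | single h' =>
      obtain ⟨p, hp, h1, h2⟩ := (h.treeT_adj_iff h'.1).1 h'.2
      exact ⟨p, (Finset.mem_filter.1 hp).1, h1, h2⟩
    | tail _ h' ih =>
      obtain ⟨p, hp, h1, h2⟩ := ih
      obtain ⟨q, hq, h3, h4⟩ := (h.treeT_adj_iff h'.1).1 h'.2
      have hq := (Finset.mem_filter.1 hq).1
      refine ⟨(q.1, p.2), ?_, h1, h4⟩
      -- Two composable boxes give the box in the row of the second and the column of the first: the
      -- strict inequality of labels puts it in R(π) by the trichotomy.
      have hlt : stepLabel π (Sum.inr p.2) < stepLabel π (Sum.inl q.1) := by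
        have e1 := h.stepLabel_inr_lt_inl hp
        have e2 := h.stepLabel_inr_lt_inl hq
        omega
      have hrow : ∃ c, (q.1, c) ∈ shape π := ⟨q.2, h.mem_shape_of_mem_regionR hq⟩
      have hcol : ∃ c, (c, p.2) ∈ shape π := ⟨p.1, h.mem_shape_of_mem_regionR hp⟩
      by_cases hS : (q.1, p.2) ∈ shape π
      · refine (h.mem_essentialSet_or_mem_regionR hS).resolve_left fun he => ?_
        exact hlt.ne (h.stepLabel_inr_eq he)
      · exact absurd hlt (h.stepLabel_inl_lt_inr hrow hcol hS).not_gt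
  rw [transClosure, SimpleGraph.fromRel_adj]
  constructor
  · rintro ⟨-, h' | h'⟩
    · exact key h'
    · obtain ⟨p, hp, h1, h2⟩ := key h'
      have := h.stepLabel_inr_lt_inl hp
      rw [h1, h2] at this
      exact absurd hij (not_lt.2 (le_of_lt this))
  · rintro ⟨p, hp, h1, h2⟩
    exact ⟨hij.ne, Or.inl (h.transGen_treeT (a := p.1) (b := p.2) hp h1 h2)⟩

end IsShiftedDominant

end Labels

/-! ### The contraction `L ∘ K` -/

section Contraction

lemma mem_span_weight_iff {N : ℕ} {F : Finset (Box N)} {v : Fin N ⊕ Fin N → ℝ} :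
    v ∈ Submodule.span ℝ (weight '' (F : Set (Box N))) ↔
      ∃ c : Box N → ℝ, (∀ p, c p ≠ 0 → p ∈ F) ∧ weightSum c = v := by
  classical
  rw [Submodule.mem_span_image_finset_iff_exists_fun']
  constructor
  · rintro ⟨c, rfl⟩
    refine ⟨fun p => if p ∈ F then c p else 0, fun p hp => by by_contra h; simp [h] at hp, ?_⟩
    simp [weightSum, ite_smul, Finset.sum_ite_mem]
  · rintro ⟨c, hc, rfl⟩
    refine ⟨c, Finset.sum_subset (Finset.subset_univ _) fun p _ hp => ?_⟩
    rw [show c p = 0 by by_contra h; exact hp (hc p h), zero_smul]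

variable {n : ℕ} {π : Equiv.Perm (Fin (n + 1))}

variable (π) in
/-- The vector `e_k`. -/
def labelVec (k : ℕ) : Fin (labelledSteps π).card → ℝ := fun i => if i.val = k then 1 else 0

lemma labelVec_val (k : Fin (labelledSteps π).card) : labelVec π k.val = Pi.single k 1 := by
  funext i
  simp [labelVec, Pi.single_apply, Fin.ext_iff]

variable (π) in
/-- The composite of the maps `K` and `L`. -/
noncomputable def contraction :
    (Fin (n + 1) ⊕ Fin (n + 1) → ℝ) →ₗ[ℝ] (Fin (labelledSteps π).card → ℝ) :=
  mapL π ∘ₗ mapK π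

lemma mapL_inl (i : Fin (n + 1)) :
    mapL π (Pi.single (Sum.inl i) 1) = - labelVec π (stepLabel π (Sum.inl i)) := by
  rw [mapL, ← Pi.basisFun_apply, Module.Basis.constr_basis]
  funext k
  simp only [Pi.neg_apply, labelVec]
  split_ifs <;> simp

lemma contraction_inl (i : Fin (n + 1)) :
    contraction π (Pi.single (Sum.inl i) 1) = - labelVec π (stepLabel π (Sum.inl i)) := by
  rw [contraction, LinearMap.comp_apply, ← mapL_inl]
  congr 1
  rw [mapK, ← Pi.basisFun_apply, Module.Basis.constr_basis, Pi.basisFun_apply]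

/-- K replaces `y_j` by the `x_i` of an essential box, whose `N` step has the same label. So L ∘ K
sends every basis vector to minus the unit vector of the label of its step, without exception. -/
lemma IsShiftedDominant.contraction_inr (h : IsShiftedDominant π) (j : Fin (n + 1)) :
    contraction π (Pi.single (Sum.inr j) 1) = - labelVec π (stepLabel π (Sum.inr j)) := by
  rw [contraction, LinearMap.comp_apply, mapK, ← Pi.basisFun_apply, Module.Basis.constr_basis]
  simp only
  split_ifs with he
  · rw [mapL_inl, ← h.stepLabel_inr_eq he.choose_spec]
  · rw [mapL, ← Pi.basisFun_apply, Module.Basis.constr_basis]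
    simp only [if_neg he]
    funext k
    simp only [Pi.neg_apply, labelVec]
    split_ifs <;> simp

namespace IsShiftedDominant

variable (h : IsShiftedDominant π)

include h

lemma contraction_weight (p : Box (n + 1)) : contraction π (weight p) =
    labelVec π (stepLabel π (Sum.inr p.2)) - labelVec π (stepLabel π (Sum.inl p.1)) := by
  rw [weight, map_sub, contraction_inl, h.contraction_inr]
  abel

lemma contraction_weight_of_mem_essentialSet {p : Box (n + 1)} (hp : p ∈ essentialSet π) :
    contraction π (weight p) = 0 := by
  rw [h.contraction_weight, h.stepLabel_inr_eq (i := p.1) hp, sub_self]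

lemma contraction_weight_eq_rootVec {p : Box (n + 1)} {i j : Fin (labelledSteps π).card}
    (hi : stepLabel π (Sum.inr p.2) = i) (hj : stepLabel π (Sum.inl p.1) = j) :
    contraction π (weight p) = rootVec i j := by
  rw [h.contraction_weight, hi, hj, labelVec_val, labelVec_val, rootVec]

lemma stepLabel_inl_injective {a a' : Fin (n + 1)} (ha : ∃ b, (a, b) ∈ shape π)
    (ha' : ∃ b, (a', b) ∈ shape π)
    (he : stepLabel π (Sum.inl a) = stepLabel π (Sum.inl a')) : a = a' := by
  by_contra hne
  rcases lt_or_gt_of_ne hne with hlt | hlt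
  · exact (h.stepLabel_inl_lt ha' ha hlt).ne' he
  · exact (h.stepLabel_inl_lt ha ha' hlt).ne he

lemma stepLabel_inr_injective {b b' : Fin (n + 1)} (hb : ∃ a, (a, b) ∈ shape π)
    (hb' : ∃ a, (a, b') ∈ shape π)
    (he : stepLabel π (Sum.inr b) = stepLabel π (Sum.inr b')) : b = b' := by
  by_contra hne
  rcases lt_or_gt_of_ne hne with hlt | hlt
  · exact (h.stepLabel_inr_lt hb hb' hlt).ne he
  · exact (h.stepLabel_inr_lt hb' hb hlt).ne' he

lemma mem_shape_of_stepLabel_le {a b : Fin (n + 1)} (ha : ∃ b, (a, b) ∈ shape π)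
    (hb : ∃ a, (a, b) ∈ shape π)
    (hle : stepLabel π (Sum.inr b) ≤ stepLabel π (Sum.inl a)) : (a, b) ∈ shape π := by
  by_contra hS
  exact (h.stepLabel_inl_lt_inr ha hb hS).not_ge hle

lemma mem_essentialSet_of_stepLabel_eq {a b : Fin (n + 1)} (ha : ∃ b, (a, b) ∈ shape π)
    (hb : ∃ a, (a, b) ∈ shape π)
    (he : stepLabel π (Sum.inr b) = stepLabel π (Sum.inl a)) : (a, b) ∈ essentialSet π :=
  (h.mem_essentialSet_or_mem_regionR (h.mem_shape_of_stepLabel_le ha hb he.le)).resolve_right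
    fun h' => (h.stepLabel_inr_lt_inl h').ne he

/-- On the span of the weights of the shape, the contraction has a section modulo the weights of the
essential set. -/
lemma exists_section : ∃ σ : (Fin (labelledSteps π).card → ℝ) →ₗ[ℝ] (Fin (n + 1) ⊕ Fin (n + 1) → ℝ),
    ∀ p ∈ shape π, σ (contraction π (weight p)) - weight p ∈
      Submodule.span ℝ (weight '' (essentialSet π : Set (Box (n + 1)))) := by
  classical
  -- A label shared by a row and a column is lifted to the row; for the column this is off by the
  -- weight of the essential box where the two meet.
  let σ₀ : Fin (labelledSteps π).card → (Fin (n + 1) ⊕ Fin (n + 1) → ℝ) := fun k =>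
    if ha : ∃ a, (∃ b, (a, b) ∈ shape π) ∧ stepLabel π (Sum.inl a) = k then
      Pi.single (Sum.inl ha.choose) (-1)
    else if hb : ∃ b, (∃ a, (a, b) ∈ shape π) ∧ stepLabel π (Sum.inr b) = k then
      Pi.single (Sum.inr hb.choose) (-1)
    else 0
  let σ := (Pi.basisFun ℝ (Fin (labelledSteps π).card)).constr ℝ σ₀
  have hσ : ∀ k : Fin (labelledSteps π).card, σ (labelVec π k) = σ₀ k := fun k => by
    rw [labelVec_val, ← Pi.basisFun_apply, Module.Basis.constr_basis]
  have hrow : ∀ a, (∃ b, (a, b) ∈ shape π) →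
      σ (labelVec π (stepLabel π (Sum.inl a))) = Pi.single (Sum.inl a) (-1) := by
    intro a ha
    rw [hσ ⟨_, h.stepLabel_inl_lt_card ha⟩]
    have hex : ∃ a', (∃ b, (a', b) ∈ shape π) ∧
        stepLabel π (Sum.inl a') = stepLabel π (Sum.inl a) := ⟨a, ha, rfl⟩
    simp only [σ₀]
    rw [dif_pos hex, h.stepLabel_inl_injective hex.choose_spec.1 ha hex.choose_spec.2]
  refine ⟨σ, fun p hp => ?_⟩
  rw [h.contraction_weight, map_sub, hrow p.1 ⟨p.2, hp⟩]
  have hcol : ∃ a, (a, p.2) ∈ shape π := ⟨p.1, hp⟩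
  rw [weight]
  by_cases hex : ∃ a, (∃ b, (a, b) ∈ shape π) ∧
      stepLabel π (Sum.inl a) = stepLabel π (Sum.inr p.2)
  · obtain ⟨a, ha, he⟩ := hex
    have hess := h.mem_essentialSet_of_stepLabel_eq ha hcol he.symm
    rw [← he, hrow a ha]
    have : (Pi.single (Sum.inl a) (-1) - Pi.single (Sum.inl p.1) (-1) -
        (Pi.single (Sum.inl p.1) 1 - Pi.single (Sum.inr p.2) 1) :
        Fin (n + 1) ⊕ Fin (n + 1) → ℝ) = - weight (a, p.2) := by
      rw [weight, Pi.single_neg, Pi.single_neg]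
      abel
    rw [this]
    exact Submodule.neg_mem _ (Submodule.subset_span ⟨_, hess, rfl⟩)
  · have hex' : ∃ b, (∃ a, (a, b) ∈ shape π) ∧
        stepLabel π (Sum.inr b) = stepLabel π (Sum.inr p.2) := ⟨p.2, hcol, rfl⟩
    rw [hσ ⟨_, h.stepLabel_inr_lt_card hcol⟩]
    simp only [σ₀]
    rw [dif_neg hex, dif_pos hex',
      h.stepLabel_inr_injective hex'.choose_spec.1 hcol hex'.choose_spec.2, Pi.single_neg,
      Pi.single_neg]
    convert Submodule.zero_mem _
    abel

/-- The section recovers a combination of weights from its contraction up to essential weights, so a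
contraction equal to zero leaves only essential weights. -/
lemma mem_span_of_contraction_eq_zero {f : Box (n + 1) → ℝ} (hf : ∀ p, f p ≠ 0 → p ∈ shape π)
    (h0 : contraction π (weightSum f) = 0) :
    weightSum f ∈ Submodule.span ℝ (weight '' (essentialSet π : Set (Box (n + 1)))) := by
  obtain ⟨σ, hσ⟩ := h.exists_section
  have key : σ (contraction π (weightSum f)) - weightSum f ∈
      Submodule.span ℝ (weight '' (essentialSet π : Set (Box (n + 1)))) := by
    have : σ (contraction π (weightSum f)) - weightSum f =
        ∑ p, f p • (σ (contraction π (weight p)) - weight p) := by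
      simp only [weightSum, map_sum, map_smul, smul_sub, Finset.sum_sub_distrib]
    rw [this]
    refine Submodule.sum_mem _ fun p _ => ?_
    by_cases hp : f p = 0
    · rw [hp, zero_smul]; exact Submodule.zero_mem _
    · exact Submodule.smul_mem _ _ (hσ p (hf p hp))
  rw [h0, map_zero, zero_sub] at key
  exact (Submodule.neg_mem_iff _).1 key

/-- Two nonnegative combinations of weights with conflict-free supports have the same coefficients
on `R(π)` as soon as their contractions agree. -/
theorem eq_of_contraction_eq {f g : Box (n + 1) → ℝ}
    (hf : ∀ p, f p ≠ 0 → p ∈ shape π) (hg : ∀ p, g p ≠ 0 → p ∈ shape π)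
    (hf0 : ∀ p ∈ regionR π, 0 ≤ f p) (hg0 : ∀ p ∈ regionR π, 0 ≤ g p)
    (hfc : ∀ p q, f p ≠ 0 → f q ≠ 0 → ¬ Conflict (shape π) p q)
    (hgc : ∀ p q, g p ≠ 0 → g q ≠ 0 → ¬ Conflict (shape π) p q)
    (he : contraction π (weightSum f) = contraction π (weightSum g)) :
    ∀ p ∈ regionR π, f p = g p := by
  have hspan := h.mem_span_of_contraction_eq_zero (f := f - g) (fun p hp => by
    by_contra hS
    refine hp ?_
    rw [Pi.sub_apply, show f p = 0 by by_contra h'; exact hS (hf p h'),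
      show g p = 0 by by_contra h'; exact hS (hg p h'), sub_zero])
    (by rw [weightSum_sub, map_sub, he, sub_self])
  obtain ⟨e, hess, hsum⟩ := mem_span_weight_iff.1 hspan
  have hR : ∀ p, (∃ q ∈ shape π, p < q) → e p = 0 := by
    rintro p ⟨q, hq, hpq⟩
    by_contra hp
    exact h.not_lt_of_mem_essentialSet (hess p hp) hq hpq
  have hcase : ∀ p, (g + e) p ≠ 0 → g p ≠ 0 ∨ p ∈ essentialSet π := by
    intro p hp
    by_contra! hn
    rw [Pi.add_apply, hn.1, zero_add] at hp
    exact hn.2 (hess p hp)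
  -- The essential coefficients `e` may have any sign. This is harmless: they sit at maximal boxes,
  -- where `eq_of_weightSum_eq` imposes no sign and conflicts cannot occur.
  have hmain : f = g + e := by
    refine eq_of_weightSum_eq (Λ := shape π) hf (fun p hp => ?_) (fun p hp => ?_) (fun p hp => ?_)
      hfc (fun p q hp hq => ?_) ?_
    · exact (hcase p hp).elim (hg p) h.mem_shape_of_mem_essentialSet
    · obtain ⟨q, hq, hpq⟩ := hp
      exact hf0 p (h.mem_regionR_of_lt hq hpq)
    · rw [Pi.add_apply, hR p hp, add_zero]
      obtain ⟨q, hq, hpq⟩ := hp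
      exact hg0 p (h.mem_regionR_of_lt hq hpq)
    · rcases hcase p hp with hp | hp
      · rcases hcase q hq with hq | hq
        · exact hgc p q hp hq
        · exact (not_conflict_of_maximal (h.mem_essentialSet_iff.1 hq).2 p).2
      · exact (not_conflict_of_maximal (h.mem_essentialSet_iff.1 hp).2 q).1
    · rw [weightSum_add, hsum, weightSum_sub]
      abel
  intro p hp
  rw [hmain, Pi.add_apply, hR p (h.mem_regionR_iff.1 hp).2, add_zero]

end IsShiftedDominant

end Contraction

/-! ### Trees and maximal conflict-free sets -/

section Trees

variable {n : ℕ} {π : Equiv.Perm (Fin (n + 1))}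

open Classical in
/-- The boxes of the essential set and those giving the edges of `S`. -/
noncomputable def treeBoxes (π : Equiv.Perm (Fin (n + 1)))
    (S : SimpleGraph (Fin (labelledSteps π).card)) : Finset (Box (n + 1)) :=
  (shape π).filter fun p => p ∈ essentialSet π ∨ ∃ i j, stepLabel π (Sum.inr p.2) = i.val ∧
    stepLabel π (Sum.inl p.1) = j.val ∧ S.Adj i j

variable (π) in
/-- The graph with an edge for each box of `F`, between the labels of the boundary steps of its
column and of its row. -/
def boxGraph (F : Finset (Box (n + 1))) : SimpleGraph (Fin (labelledSteps π).card) :=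
  SimpleGraph.fromRel fun i j => ∃ p ∈ F, stepLabel π (Sum.inr p.2) = i.val ∧
    stepLabel π (Sum.inl p.1) = j.val

variable {S : SimpleGraph (Fin (labelledSteps π).card)}

lemma treeBoxes_subset : treeBoxes π S ⊆ shape π := by
  classical
  exact Finset.filter_subset _ _

namespace IsShiftedDominant

variable (h : IsShiftedDominant π)

include h

lemma stepLabel_inr_le_inl {p : Box (n + 1)} (hp : p ∈ shape π) :
    stepLabel π (Sum.inr p.2) ≤ stepLabel π (Sum.inl p.1) := by
  rcases h.mem_essentialSet_or_mem_regionR hp with he | hR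
  · exact (h.stepLabel_inr_eq he).le
  · exact (h.stepLabel_inr_lt_inl hR).le

/-- By the trichotomy, the corner of the rectangle is in `Λ` exactly when the middle inequality
holds. Strict there, a conflict is a crossing of two edges; equality gives a vertex with an incoming
and an outgoing edge. -/
lemma conflict_iff {p q : Box (n + 1)} (hp : p ∈ shape π) (hq : q ∈ shape π) :
    Conflict (shape π) p q ↔ stepLabel π (Sum.inr p.2) < stepLabel π (Sum.inr q.2) ∧
      stepLabel π (Sum.inr q.2) ≤ stepLabel π (Sum.inl p.1) ∧
      stepLabel π (Sum.inl p.1) < stepLabel π (Sum.inl q.1) := by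
  have hp1 : ∃ b, (p.1, b) ∈ shape π := ⟨p.2, hp⟩
  have hp2 : ∃ a, (a, p.2) ∈ shape π := ⟨p.1, hp⟩
  have hq1 : ∃ b, (q.1, b) ∈ shape π := ⟨q.2, hq⟩
  have hq2 : ∃ a, (a, q.2) ∈ shape π := ⟨q.1, hq⟩
  constructor
  · rintro ⟨h1, h2, h3⟩
    exact ⟨h.stepLabel_inr_lt hp2 hq2 h2, h.stepLabel_inr_le_inl h3,
      h.stepLabel_inl_lt hp1 hq1 h1⟩
  · rintro ⟨h1, h2, h3⟩
    refine ⟨?_, ?_, h.mem_shape_of_stepLabel_le hp1 hq2 h2⟩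
    · by_contra hle
      rcases (not_lt.1 hle).eq_or_lt with he | hlt
      · rw [he] at h3; exact lt_irrefl _ h3
      · exact lt_asymm h3 (h.stepLabel_inl_lt hq1 hp1 hlt)
    · by_contra hle
      rcases (not_lt.1 hle).eq_or_lt with he | hlt
      · rw [he] at h1; exact lt_irrefl _ h1
      · exact lt_asymm h1 (h.stepLabel_inr_lt hq2 hp2 hlt)

lemma conflictFree_treeBoxes (hnc : IsNoncrossing S) (halt : IsAlternating S) :
    ConflictFree (shape π) (treeBoxes π S) := by
  classical
  intro p hp q hq hc
  obtain ⟨hpS, hp⟩ := Finset.mem_filter.1 hp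
  obtain ⟨hqS, hq⟩ := Finset.mem_filter.1 hq
  obtain ⟨i, k, hi, hk, hik⟩ := hp.resolve_left fun he =>
    (not_conflict_of_maximal (h.mem_essentialSet_iff.1 he).2 q).1 hc
  obtain ⟨j, l, hj, hl, hjl⟩ := hq.resolve_left fun he =>
    (not_conflict_of_maximal (h.mem_essentialSet_iff.1 he).2 p).2 hc
  obtain ⟨h1, h2, h3⟩ := (h.conflict_iff hpS hqS).1 hc
  rw [hi, hj] at h1
  rw [hj, hk] at h2
  rw [hk, hl] at h3
  rcases h2.eq_or_lt with he | hlt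
  · obtain rfl : j = k := Fin.ext he
    exact halt i j l h1 h3 ⟨hik, hjl⟩
  · exact hnc i j k l h1 hlt h3 ⟨hik, hjl⟩

lemma boxGraph_adj_iff {F : Finset (Box (n + 1))} (hF : F ⊆ shape π)
    {i j : Fin (labelledSteps π).card} (hij : i < j) :
    (boxGraph π F).Adj i j ↔ ∃ p ∈ F, stepLabel π (Sum.inr p.2) = i.val ∧
      stepLabel π (Sum.inl p.1) = j.val := by
  rw [boxGraph, SimpleGraph.fromRel_adj]
  refine ⟨fun ⟨_, h'⟩ => h'.resolve_right ?_, fun h' => ⟨hij.ne, Or.inl h'⟩⟩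
  rintro ⟨p, hp, h1, h2⟩
  have := h.stepLabel_inr_le_inl (hF hp)
  rw [h1, h2] at this
  exact absurd hij (not_lt.2 this)

lemma isNoncrossing_boxGraph {F : Finset (Box (n + 1))} (hF : F ⊆ shape π)
    (hc : ConflictFree (shape π) F) : IsNoncrossing (boxGraph π F) := by
  rintro i j k l hij hjk hkl ⟨h1, h2⟩
  obtain ⟨p, hp, h3, h4⟩ := (h.boxGraph_adj_iff hF (hij.trans hjk)).1 h1
  obtain ⟨q, hq, h5, h6⟩ := (h.boxGraph_adj_iff hF (hjk.trans hkl)).1 h2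
  refine hc p hp q hq ((h.conflict_iff (hF hp) (hF hq)).2 ?_)
  rw [h3, h4, h5, h6]
  exact ⟨hij, le_of_lt hjk, hkl⟩

lemma isAlternating_boxGraph {F : Finset (Box (n + 1))} (hF : F ⊆ shape π)
    (hc : ConflictFree (shape π) F) : IsAlternating (boxGraph π F) := by
  rintro i j k hij hjk ⟨h1, h2⟩
  obtain ⟨p, hp, h3, h4⟩ := (h.boxGraph_adj_iff hF hij).1 h1
  obtain ⟨q, hq, h5, h6⟩ := (h.boxGraph_adj_iff hF hjk).1 h2
  refine hc p hp q hq ((h.conflict_iff (hF hp) (hF hq)).2 ?_)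
  rw [h3, h4, h5, h6]
  exact ⟨hij, le_rfl, hjk⟩

lemma boxGraph_le_transClosure {F : Finset (Box (n + 1))} (hF : F ⊆ shape π) :
    boxGraph π F ≤ transClosure (treeT π) := by
  have key : ∀ i j, i < j → (boxGraph π F).Adj i j → (transClosure (treeT π)).Adj i j := by
    intro i j hij hadj
    obtain ⟨p, hp, h1, h2⟩ := (h.boxGraph_adj_iff hF hij).1 hadj
    refine (h.transClosure_treeT_adj_iff hij).2 ⟨p, ?_, h1, h2⟩
    refine (h.mem_essentialSet_or_mem_regionR (hF hp)).resolve_left fun he => ?_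
    rw [h.stepLabel_inr_eq (i := p.1) he, h2] at h1
    exact hij.ne' (Fin.ext h1)
  intro i j hadj
  rcases lt_or_gt_of_ne hadj.ne with hij | hij
  · exact key i j hij hadj
  · exact (key j i hij hadj.symm).symm

/-- Reachability from the label of the first row spreads along the boxes of `F`, and an essential
box identifies the labels of its row and column; so `forall_of_iff` applies. -/
lemma connected_boxGraph {F : Finset (Box (n + 1))} (hF : IsMaxConflictFree (shape π) F) :
    (boxGraph π F).Connected := by
  have h0 : ∃ b, ((0 : Fin (n + 1)), b) ∈ shape π := ⟨0, h.zero_mem_shape⟩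
  let root : Fin (labelledSteps π).card := ⟨_, h.stepLabel_inl_lt_card h0⟩
  obtain ⟨hP, hQ⟩ := hF.forall_of_iff isLowerSet_shape
    (P := fun a => ∀ k : Fin (labelledSteps π).card, stepLabel π (Sum.inl a) = k →
      (boxGraph π F).Reachable root k)
    (Q := fun b => ∀ k : Fin (labelledSteps π).card, stepLabel π (Sum.inr b) = k →
      (boxGraph π F).Reachable root k) (fun p hp => by
      have hpS := hF.subset hp
      rcases h.mem_essentialSet_or_mem_regionR hpS with he | hR
      · rw [h.stepLabel_inr_eq (i := p.1) he]
      · have hlt := h.stepLabel_inr_lt_inl (a := p.1) (b := p.2) hR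
        let i : Fin (labelledSteps π).card := ⟨_, h.stepLabel_inr_lt_card ⟨p.1, hpS⟩⟩
        let j : Fin (labelledSteps π).card := ⟨_, h.stepLabel_inl_lt_card ⟨p.2, hpS⟩⟩
        have hadj : (boxGraph π F).Adj i j :=
          (h.boxGraph_adj_iff hF.subset hlt).2 ⟨p, hp, rfl, rfl⟩
        constructor
        · rintro hj k hk
          obtain rfl : i = k := Fin.ext hk
          exact (hj j rfl).trans hadj.symm.reachable
        · rintro hi k hk
          obtain rfl : j = k := Fin.ext hk
          exact (hi i rfl).trans hadj.reachable) (fun k hk => by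
      obtain rfl : root = k := Fin.ext hk
      exact SimpleGraph.Reachable.refl _)
  have hroot : ∀ k, (boxGraph π F).Reachable root k := by
    intro k
    obtain ⟨s, hs, he⟩ := h.exists_stepLabel_eq k
    rcases s with a | b
    · obtain ⟨b, hb⟩ := inl_mem_labelledSteps.1 hs
      exact hP a ⟨b, h.mem_shape_of_mem_regionR hb⟩ k he
    · obtain ⟨a, ha⟩ := (inr_mem_labelledSteps.1 hs).1
      exact hQ b ⟨a, h.mem_shape_of_mem_regionR ha⟩ k he
  have : Nonempty (Fin (labelledSteps π).card) := ⟨root⟩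
  exact ⟨fun i j => (hroot i).symm.trans (hroot j)⟩

/-- The boxes of a noncrossing alternating spanning tree form a maximal conflict-free set. -/
theorem isMaxConflictFree_treeBoxes (hle : S ≤ transClosure (treeT π)) (hS : S.IsTree)
    (hnc : IsNoncrossing S) (halt : IsAlternating S) :
    IsMaxConflictFree (shape π) (treeBoxes π S) := by
  classical
  have hcf := h.conflictFree_treeBoxes hnc halt
  refine ⟨treeBoxes_subset, hcf, fun p hp h1 h2 => ?_⟩
  by_contra hpS
  have hpR : p ∈ regionR π := (h.mem_essentialSet_or_mem_regionR hp).resolve_left fun he =>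
    hpS (Finset.mem_filter.2 ⟨hp, Or.inl he⟩)
  -- Since `S` is connected, every root is a signed sum of edge roots along a path. Hence the
  -- contraction of the weight of the missing box `p` is a combination of contracted weights of the
  -- tree boxes.
  let V := (Submodule.span ℝ (weight '' (treeBoxes π S : Set (Box (n + 1))))).map (contraction π)
  have hedge : ∀ i j, S.Adj i j → rootVec i j ∈ V := by
    have key : ∀ i j, i < j → S.Adj i j → rootVec i j ∈ V := by
      intro i j hij hadj
      obtain ⟨q, hq, hi, hj⟩ := (h.transClosure_treeT_adj_iff hij).1 (hle hadj)
      refine ⟨weight q, Submodule.subset_span ⟨q, Finset.mem_coe.2 (Finset.mem_filter.2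
        ⟨h.mem_shape_of_mem_regionR hq, Or.inr ⟨i, j, hi, hj, hadj⟩⟩), rfl⟩,
        h.contraction_weight_eq_rootVec hi hj⟩
    intro i j hadj
    rcases lt_or_gt_of_ne hadj.ne with hij | hij
    · exact key i j hij hadj
    · have := V.neg_mem (key j i hij hadj.symm)
      rwa [rootVec, neg_sub] at this
  have hall : ∀ i j, rootVec i j ∈ V := by
    intro i j
    obtain ⟨w⟩ := hS.1.1 i j
    induction w with
    | nil => rw [rootVec, sub_self]; exact V.zero_mem
    | cons hadj _ ih =>
      have := V.add_mem (hedge _ _ hadj) ih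
      rwa [rootVec, rootVec, sub_add_sub_cancel] at this
  obtain ⟨v, hv, hve⟩ := hall ⟨_, h.stepLabel_inr_lt_card ⟨p.1, hp⟩⟩
    ⟨_, h.stepLabel_inl_lt_card ⟨p.2, hp⟩⟩
  rw [← h.contraction_weight_eq_rootVec (p := p) rfl rfl] at hve
  obtain ⟨c, hc, rfl⟩ := mem_span_weight_iff.1 hv
  have hcp : c p = 0 := by by_contra h'; exact hpS (hc p h')
  have hneg : ∀ q, max (-c q) 0 ≠ 0 → q ∈ treeBoxes π S := fun q hq => hc q fun h0 => by
    rw [h0] at hq; simp at hq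
  have hpos : ∀ q, max (c q) 0 ≠ 0 → q ∈ treeBoxes π S := fun q hq => hc q fun h0 => by
    rw [h0] at hq; simp at hq
  -- Moving negative coefficients to the side of `p` gives two nonnegative combinations with
  -- conflict-free supports and equal contractions, but with coefficients `1` and `0` at `p`.
  let f : Box (n + 1) → ℝ := Pi.single p 1 + fun q => max (-c q) 0
  let g : Box (n + 1) → ℝ := fun q => max (c q) 0
  have hins := hcf.insert h1 h2
  have hfins : ∀ q, f q ≠ 0 → q ∈ insert p (treeBoxes π S) := by
    intro q hq
    rw [Finset.mem_insert]
    by_contra! hn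
    refine hn.2 (hneg q ?_)
    simpa [f, hn.1] using hq
  have := h.eq_of_contraction_eq (f := f) (g := g)
    (fun q hq => Finset.insert_subset hp treeBoxes_subset (hfins q hq))
    (fun q hq => treeBoxes_subset (hpos q hq))
    (fun q _ => by
      simp only [f, Pi.add_apply, Pi.single_apply]
      split_ifs <;> positivity) (fun q _ => le_max_right _ _)
    (fun q r hq hr => hins q (hfins q hq) r (hfins r hr))
    (fun q r hq hr => hcf q (hpos q hq) r (hpos r hr)) (by
      have hfg : f = Pi.single p 1 + (g - c) := by
        funext q
        simp only [f, g, Pi.add_apply, Pi.sub_apply, add_right_inj]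
        rcases le_total (c q) 0 with h' | h'
        · rw [max_eq_left (neg_nonneg.2 h'), max_eq_right h', zero_sub]
        · rw [max_eq_right (neg_nonpos.2 h'), max_eq_left h', sub_self]
      rw [hfg, weightSum_add, weightSum_sub, weightSum_single, one_smul, map_add, map_sub, hve]
      abel) p hpR
  simp [f, g, hcp] at this

/-- Every maximal conflict-free set comes from a noncrossing alternating spanning tree. -/
theorem exists_treeBoxes_eq {F : Finset (Box (n + 1))} (hF : IsMaxConflictFree (shape π) F) :
    ∃ S : SimpleGraph (Fin (labelledSteps π).card), S ≤ transClosure (treeT π) ∧ S.IsTree ∧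
      IsNoncrossing S ∧ IsAlternating S ∧ treeBoxes π S = F := by
  classical
  -- Any spanning tree will do: its boxes lie in `F` and are already maximal conflict-free, hence
  -- exhaust `F`.
  obtain ⟨S, hSF, hS⟩ := (h.connected_boxGraph hF).exists_isTree_le
  have hle := hSF.trans (h.boxGraph_le_transClosure hF.subset)
  have hnc : IsNoncrossing S := fun i j k l hij hjk hkl h' =>
    h.isNoncrossing_boxGraph hF.subset hF.conflictFree i j k l hij hjk hkl ⟨hSF h'.1, hSF h'.2⟩
  have halt : IsAlternating S := fun i j k hij hjk h' =>
    h.isAlternating_boxGraph hF.subset hF.conflictFree i j k hij hjk ⟨hSF h'.1, hSF h'.2⟩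
  refine ⟨S, hle, hS, hnc, halt, (h.isMaxConflictFree_treeBoxes hle hS hnc halt).eq_of_subset
    hF.conflictFree hF.subset fun p hp => ?_⟩
  obtain ⟨hpS, he | ⟨i, j, hi, hj, hadj⟩⟩ := Finset.mem_filter.1 hp
  · exact hF.mem_of_maximal hpS (h.mem_essentialSet_iff.1 he).2
  · have hij : i < j := lt_of_le_of_ne (by
      have := h.stepLabel_inr_le_inl hpS
      rw [hi, hj] at this
      exact this) hadj.ne
    obtain ⟨q, hq, hi', hj'⟩ := (h.boxGraph_adj_iff hF.subset hij).1 (hSF hadj)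
    have hqS := hF.subset hq
    obtain rfl : q = p := Prod.ext
      (h.stepLabel_inl_injective ⟨q.2, hqS⟩ ⟨p.2, hpS⟩ (hj'.trans hj.symm))
      (h.stepLabel_inr_injective ⟨q.1, hqS⟩ ⟨p.1, hpS⟩ (hi'.trans hi.symm))
    exact hq

end IsShiftedDominant

end Trees

/-! ### The triangulation of the moment polytope -/

section Triangulation

lemma mem_convexHull_weight_iff {N : ℕ} {F : Finset (Box N)} {v : Fin N ⊕ Fin N → ℝ} :
    v ∈ convexHull ℝ (weight '' (F : Set (Box N))) ↔
      ∃ f : Box N → ℝ, 0 ≤ f ∧ (∀ p, f p ≠ 0 → p ∈ F) ∧ ∑ p, f p = 1 ∧ weightSum f = v := by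
  classical
  constructor
  · intro hv
    rw [← Finset.coe_image, Finset.mem_convexHull'] at hv
    obtain ⟨w, hw0, hw1, hwv⟩ := hv
    rw [Finset.sum_image weight_injective.injOn] at hw1 hwv
    refine ⟨fun p => if p ∈ F then w (weight p) else 0, fun p => ?_, fun p hp => ?_, ?_, ?_⟩
    · change 0 ≤ if p ∈ F then w (weight p) else 0
      split_ifs with hp
      · exact hw0 _ (Finset.mem_image_of_mem _ hp)
      · exact le_rfl
    · by_contra h
      simp [h] at hp
    · rw [← hw1]
      simp [Finset.sum_ite_mem]
    · rw [← hwv]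
      simp [weightSum, ite_smul, Finset.sum_ite_mem]
  · rintro ⟨f, hf0, hfF, hf1, rfl⟩
    have hsub : ∀ p, p ∉ F → f p = 0 := fun p hp => by by_contra h; exact hp (hfF p h)
    have h1 : ∑ p ∈ F, f p = 1 := by
      rw [← hf1]
      exact Finset.sum_subset (Finset.subset_univ _) fun p _ hp => hsub p hp
    have h2 : weightSum f = ∑ p ∈ F, f p • weight p :=
      (Finset.sum_subset (Finset.subset_univ _) fun p _ hp => by rw [hsub p hp, zero_smul]).symm
    rw [h2]
    exact (convex_convexHull ℝ _).sum_mem (fun p _ => hf0 p) h1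
      fun p hp => subset_convexHull ℝ _ ⟨p, hp, rfl⟩

/-- The x-coordinates of every weight add up to one, so the total mass can be read off the value. -/
lemma sum_eq_of_weightSum_eq {N : ℕ} {f g : Box N → ℝ} (h : weightSum f = weightSum g) :
    ∑ p, f p = ∑ p, g p := by
  rw [Fintype.sum_prod_type, Fintype.sum_prod_type]
  refine Finset.sum_congr rfl fun a _ => ?_
  rw [← weightSum_inl, ← weightSum_inl, h]

/-- Conflict-free supports are determined by the value of a nonnegative combination. -/
lemma ConflictFree.eq_of_weightSum_eq {N : ℕ} {Λ F G : Finset (Box N)} (hF : ConflictFree Λ F)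
    (hG : ConflictFree Λ G) (hFΛ : F ⊆ Λ) (hGΛ : G ⊆ Λ) {f g : Box N → ℝ} (hf0 : 0 ≤ f) (hg0 : 0 ≤ g)
    (hf : ∀ p, f p ≠ 0 → p ∈ F) (hg : ∀ p, g p ≠ 0 → p ∈ G) (h : weightSum f = weightSum g) :
    f = g :=
  SchubertCore.eq_of_weightSum_eq (fun p hp => hFΛ (hf p hp)) (fun p hp => hGΛ (hg p hp))
    (fun p _ => hf0 p) (fun p _ => hg0 p) (fun p q hp hq => hF p (hf p hp) q (hf q hq))
    (fun p q hp hq => hG p (hg p hp) q (hg q hq)) h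

/-- The positive and negative parts of a linear relation are two nonnegative combinations supported
in `F` with the same value, so they agree by uniqueness. -/
lemma ConflictFree.linearIndepOn {N : ℕ} {Λ F : Finset (Box N)} (hF : ConflictFree Λ F)
    (hFΛ : F ⊆ Λ) : LinearIndepOn ℝ weight (F : Set (Box N)) := by
  classical
  rw [linearIndepOn_finset_iff]
  intro c hc p hp
  let f : Box N → ℝ := fun q => if q ∈ F then max (c q) 0 else 0
  let g : Box N → ℝ := fun q => if q ∈ F then max (-c q) 0 else 0
  have hsupp : ∀ (d : Box N → ℝ) q, (if q ∈ F then d q else 0) ≠ 0 → q ∈ F := fun d q hq => by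
    by_contra h; simp [h] at hq
  have hnn : ∀ (d : Box N → ℝ), 0 ≤ fun q => if q ∈ F then max (d q) 0 else 0 := fun d q => by
    change 0 ≤ if q ∈ F then max (d q) 0 else 0
    split_ifs
    · exact le_max_right _ _
    · exact le_rfl
  have hfg : ∀ q, f q - g q = if q ∈ F then c q else 0 := by
    intro q
    simp only [f, g]
    split_ifs
    · rcases le_total (c q) 0 with h' | h'
      · rw [max_eq_left (neg_nonneg.2 h'), max_eq_right h', zero_sub, neg_neg]
      · rw [max_eq_right (neg_nonpos.2 h'), max_eq_left h', sub_zero]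
    · exact sub_zero 0
  have heq : f = g := hF.eq_of_weightSum_eq hF hFΛ hFΛ (hnn c) (hnn fun q => -c q)
    (hsupp _) (hsupp _) (by
      rw [← sub_eq_zero, ← weightSum_sub, ← hc, weightSum]
      simp only [Pi.sub_apply, hfg, ite_smul, zero_smul, Finset.sum_ite_mem, Finset.univ_inter])
  have := hfg p
  rw [heq, sub_self, if_pos hp] at this
  exact this.symm

open Classical in
/-- The geometric simplicial complex on the weights of a shape whose simplices are spanned by the
conflict-free sets. -/
noncomputable def conflictFreeComplex {N : ℕ} (Λ : Finset (Box N)) :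
    Geometry.SimplicialComplex ℝ (Fin N ⊕ Fin N → ℝ) where
  faces := {s | ∃ F : Finset (Box N), F.Nonempty ∧ F ⊆ Λ ∧ ConflictFree Λ F ∧ s = F.image weight}
  isRelLowerSet_faces := by
    rintro s ⟨F, hne, hFΛ, hF, rfl⟩
    refine ⟨hne.image _, fun t hts ht => ?_⟩
    obtain ⟨G, hGF, rfl⟩ := Finset.subset_image_iff.1 hts
    exact ⟨G, Finset.image_nonempty.1 ht, hGF.trans hFΛ, hF.mono hGF, rfl⟩
  indep := by
    rintro s ⟨F, -, hFΛ, hF, rfl⟩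
    have := (hF.linearIndepOn hFΛ).id_image
    rw [← Finset.coe_image] at this
    exact LinearIndependent.affineIndependent ℝ this
  inter_subset_convexHull := by
    rintro s t ⟨F, -, hFΛ, hF, rfl⟩ ⟨G, -, hGΛ, hG, rfl⟩ v ⟨hvF, hvG⟩
    rw [Finset.coe_image, mem_convexHull_weight_iff] at hvF hvG
    obtain ⟨f, hf0, hfF, hf1, hfv⟩ := hvF
    obtain ⟨g, hg0, hgG, -, hgv⟩ := hvG
    -- A common point of two simplices has the same coefficients in both, so it is supported on the
    -- common vertices.
    have hfg : f = g := hF.eq_of_weightSum_eq hG hFΛ hGΛ hf0 hg0 hfF hgG (hfv.trans hgv.symm)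
    rw [Finset.coe_image, Finset.coe_image, ← Set.image_inter weight_injective, ← Finset.coe_inter,
      mem_convexHull_weight_iff]
    exact ⟨f, hf0, fun p hp => Finset.mem_inter.2 ⟨hfF p hp, hgG p (hfg ▸ hp)⟩, hf1, hfv⟩

lemma mem_conflictFreeComplex_faces {N : ℕ} {Λ : Finset (Box N)}
    {s : Finset (Fin N ⊕ Fin N → ℝ)} : s ∈ (conflictFreeComplex Λ).faces ↔
      ∃ F : Finset (Box N), F.Nonempty ∧ F ⊆ Λ ∧ ConflictFree Λ F ∧
        (s : Set (Fin N ⊕ Fin N → ℝ)) = weight '' (F : Set (Box N)) := by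
  classical
  change (∃ _, _) ↔ _
  simp only [← Finset.coe_image, Finset.coe_inj]

lemma space_conflictFreeComplex {N : ℕ} {Λ : Finset (Box N)} (hΛ : IsLowerSet (Λ : Set (Box N))) :
    (conflictFreeComplex Λ).space = convexHull ℝ (weight '' (Λ : Set (Box N))) := by
  classical
  refine Set.Subset.antisymm (fun v hv => ?_) fun v hv => ?_
  · obtain ⟨s, hs, hv⟩ := Geometry.SimplicialComplex.mem_space_iff.1 hv
    obtain ⟨F, -, hFΛ, -, hsF⟩ := mem_conflictFreeComplex_faces.1 hs
    rw [hsF] at hv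
    exact convexHull_mono (Set.image_mono hFΛ) hv
  · obtain ⟨c, hc0, hcΛ, hc1, rfl⟩ := mem_convexHull_weight_iff.1 hv
    obtain ⟨f, hf0, hfΛ, hfc, hcf⟩ := exists_conflictFree_weightSum hΛ c hc0 hcΛ
    let F := Finset.univ.filter fun p => f p ≠ 0
    have hmem : ∀ p, p ∈ F ↔ f p ≠ 0 := fun p => by simp [F]
    have hf1 : ∑ p, f p = 1 := (sum_eq_of_weightSum_eq hfc).trans hc1
    refine Geometry.SimplicialComplex.mem_space_iff.2 ⟨F.image weight,
      mem_conflictFreeComplex_faces.2 ⟨F, ?_, fun p hp => hfΛ p ((hmem p).1 hp),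
        fun p hp q hq => hcf p q ((hmem p).1 hp) ((hmem q).1 hq), by simp⟩, ?_⟩
    · by_contra hne
      rw [Finset.not_nonempty_iff_eq_empty] at hne
      rw [Finset.sum_eq_zero fun p _ => by
        by_contra hp
        have := (hmem p).2 hp
        simp [hne] at this] at hf1
      exact zero_ne_one hf1
    · rw [Finset.coe_image]
      exact mem_convexHull_weight_iff.2 ⟨f, hf0, fun p hp => (hmem p).2 hp, hf1, hfc⟩

lemma mem_conflictFreeComplex_facets {n : ℕ} {Λ : Finset (Box (n + 1))} (h0 : (0, 0) ∈ Λ)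
    {s : Finset (Fin (n + 1) ⊕ Fin (n + 1) → ℝ)} : s ∈ (conflictFreeComplex Λ).facets ↔
      ∃ F : Finset (Box (n + 1)), IsMaxConflictFree Λ F ∧
        (s : Set (Fin (n + 1) ⊕ Fin (n + 1) → ℝ)) = weight '' (F : Set (Box (n + 1))) := by
  classical
  constructor
  · rintro ⟨hs, hmax⟩
    obtain ⟨F, hne, hFΛ, hF, hsF⟩ := mem_conflictFreeComplex_faces.1 hs
    obtain ⟨G, hFG, hG⟩ := hF.exists_isMaxConflictFree hFΛ
    have hsG : s = G.image weight := hmax (mem_conflictFreeComplex_faces.2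
      ⟨G, hne.mono hFG, hG.subset, hG.conflictFree, by simp⟩) (by
        rw [← Finset.coe_subset, hsF, Finset.coe_image]
        exact Set.image_mono hFG)
    exact ⟨G, hG, by rw [hsG, Finset.coe_image]⟩
  · rintro ⟨F, hF, hsF⟩
    refine ⟨mem_conflictFreeComplex_faces.2 ⟨F, ⟨_, hF.zero_mem h0⟩, hF.subset, hF.conflictFree,
      hsF⟩, fun t ht hst => ?_⟩
    obtain ⟨G, -, hGΛ, hG, htG⟩ := mem_conflictFreeComplex_faces.1 ht
    rw [← Finset.coe_subset, hsF, htG, Set.image_subset_image_iff weight_injective,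
      Finset.coe_subset] at hst
    rw [← Finset.coe_inj, hsF, htG, hF.eq_of_subset hG hGΛ hst]

/-! ### The moment polytope, its cells and the coned core -/

variable {n : ℕ} {π : Equiv.Perm (Fin (n + 1))}

namespace IsShiftedDominant

variable (h : IsShiftedDominant π)

include h

/-- No coordinate vanishes identically on `Y_π`. -/
lemma exists_varietyY_ne_zero (p : regionL π) : ∃ z ∈ varietyY π, z p ≠ 0 := by
  classical
  -- A unitriangular matrix whose first column consists of ones. As `π` fixes `0`, every entry of `X
  -- π Xᵀ` is a sum of natural numbers with a summand `1`; writing the entries as casts from `ℕ`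
  -- makes this positivity available over ℂ.
  let X : Matrix (Fin (n + 1)) (Fin (n + 1)) ℂ := Matrix.of fun i j =>
    ((if i = j ∨ j = 0 then 1 else 0 : ℕ) : ℂ)
  have hX : ∀ i j, i < j → X i j = 0 := fun i j hij => by
    have hj : j ≠ 0 := Fin.pos_iff_ne_zero.1 (lt_of_le_of_lt (Fin.zero_le _) hij)
    simp [X, hij.ne, hj]
  have hdet : X.det = 1 := by
    rw [Matrix.det_of_isLowerTriangular (M := X) (fun i j hij => hX i j hij)]
    simp [X]
  have hentry : (X * permMatrix π * X.transpose) p.1.1 p.1.2 ≠ 0 := by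
    have hsum : (X * permMatrix π * X.transpose) p.1.1 p.1.2 =
        ∑ l, X p.1.1 (π l) * X p.1.2 l := by
      simp only [Matrix.mul_apply, permMatrix, Matrix.of_apply, mul_ite, mul_one, mul_zero,
        Matrix.transpose_apply, Finset.sum_ite_eq, Finset.mem_univ, if_true]
    rw [hsum]
    simp only [X, Matrix.of_apply]
    rw [Finset.sum_congr rfl fun l _ => (Nat.cast_mul _ _).symm, ← Nat.cast_sum, Nat.cast_ne_zero]
    refine (Finset.sum_pos' (fun _ _ => Nat.zero_le _) ⟨0, Finset.mem_univ _, ?_⟩).ne'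
    have : π 0 = 0 := by rw [← Equiv.eq_symm_apply, h.symm_zero]
    simp [this]
  refine ⟨_, ⟨X * permMatrix π * X.transpose, fun f hf => hf _ ⟨X, X.transpose, hX, ?_, ?_, ?_, rfl⟩,
    rfl⟩, hentry⟩
  · simp [hdet]
  · exact fun i j hij => hX j i hij
  · simp [hdet]

lemma momentPolytope_eq :
    momentPolytope π = convexHull ℝ (weight '' (shape π : Set (Box (n + 1)))) := by
  rw [momentPolytope]
  congr 1
  ext v
  constructor
  · rintro ⟨p, -, rfl⟩
    exact ⟨p.1, h.mem_regionL_iff.1 p.2, rfl⟩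
  · rintro ⟨p, hp, rfl⟩
    exact ⟨⟨p, h.mem_regionL_iff.2 hp⟩, h.exists_varietyY_ne_zero _, rfl⟩

/-- The part of the moment polytope over a cell of the canonical triangulation. -/
theorem momentPolytope_inter_preimage {S : SimpleGraph (Fin (labelledSteps π).card)}
    (hle : S ≤ transClosure (treeT π)) (hnc : IsNoncrossing S) (halt : IsAlternating S) :
    momentPolytope π ∩ contraction π ⁻¹' rootPolytope S =
      convexHull ℝ (weight '' (treeBoxes π S : Set (Box (n + 1)))) := by
  classical
  have hcf := h.conflictFree_treeBoxes hnc halt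
  have hedge : ∀ i j, i < j → S.Adj i j → ∃ p ∈ regionR π, p ∈ treeBoxes π S ∧
      contraction π (weight p) = rootVec i j := by
    intro i j hij hadj
    obtain ⟨p, hp, hi, hj⟩ := (h.transClosure_treeT_adj_iff hij).1 (hle hadj)
    exact ⟨p, hp, Finset.mem_filter.2 ⟨h.mem_shape_of_mem_regionR hp, Or.inr ⟨i, j, hi, hj, hadj⟩⟩,
      h.contraction_weight_eq_rootVec hi hj⟩
  rw [h.momentPolytope_eq]
  refine Set.Subset.antisymm ?_ (Set.subset_inter (convexHull_mono (Set.image_mono treeBoxes_subset))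
    (convexHull_min ?_ ((convex_convexHull ℝ _).linear_preimage (contraction π))))
  · rintro v ⟨hv, hcv⟩
    obtain ⟨c, hc0, hcΛ, hc1, rfl⟩ := mem_convexHull_weight_iff.1 hv
    obtain ⟨f, hf0, hfΛ, hfc, hff⟩ := exists_conflictFree_weightSum isLowerSet_shape c hc0 hcΛ
    -- The contracted cone of the weights of the tree boxes. It is convex and contains `0` and the
    -- cone of `S`, hence the root polytope of `S`.
    let C : Set (Fin (labelledSteps π).card → ℝ) := {w | ∃ g : Box (n + 1) → ℝ, 0 ≤ g ∧
      (∀ p, g p ≠ 0 → p ∈ treeBoxes π S) ∧ contraction π (weightSum g) = w}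
    have hadd : ∀ w ∈ C, ∀ w' ∈ C, w + w' ∈ C := by
      rintro w ⟨g, hg0, hgS, rfl⟩ w' ⟨g', hg0', hgS', rfl⟩
      refine ⟨g + g', add_nonneg hg0 hg0', fun p hp => ?_, by rw [weightSum_add, map_add]⟩
      by_contra hS
      refine hp ?_
      rw [Pi.add_apply, show g p = 0 by by_contra h'; exact hS (hgS p h'),
        show g' p = 0 by by_contra h'; exact hS (hgS' p h'), add_zero]
    have hsmul : ∀ t : ℝ, 0 ≤ t → ∀ w ∈ C, t • w ∈ C := by
      rintro t ht w ⟨g, hg0, hgS, rfl⟩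
      refine ⟨t • g, smul_nonneg ht hg0, fun p hp => hgS p fun h' => hp ?_,
        by rw [weightSum_smul, map_smul]⟩
      rw [Pi.smul_apply, h', smul_zero]
    have hzero : (0 : Fin (labelledSteps π).card → ℝ) ∈ C :=
      ⟨0, le_rfl, fun p hp => absurd rfl hp, by simp [weightSum]⟩
    have hgen : ∀ i j, i < j → S.Adj i j → rootVec i j ∈ C := by
      intro i j hij hadj
      obtain ⟨p, -, hp, he⟩ := hedge i j hij hadj
      refine ⟨Pi.single p 1, Pi.single_nonneg.2 zero_le_one, fun q hq => ?_,
        by rw [weightSum_single, one_smul, he]⟩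
      by_contra hqS
      exact hq (Pi.single_eq_of_ne (fun e : q = p => hqS (by rwa [e])) 1)
    have hcone : graphCone S ⊆ C := by
      rintro w ⟨c, hc0, hc, rfl⟩
      refine Finset.sum_induction _ (· ∈ C) (fun w w' hw hw' => hadd w hw w' hw') hzero fun i _ =>
        Finset.sum_induction _ (· ∈ C) (fun w w' hw hw' => hadd w hw w' hw') hzero fun j _ => ?_
      by_cases hij : i < j ∧ S.Adj i j
      · exact hsmul _ (hc0 i j) _ (hgen i j hij.1 hij.2)
      · rw [hc i j hij, zero_smul]; exact hzero
    have hCconv : Convex ℝ C := fun w hw w' hw' s t hs ht _ =>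
      hadd _ (hsmul s hs w hw) _ (hsmul t ht w' hw')
    obtain ⟨g, hg0, hgS, hg⟩ : contraction π (weightSum c) ∈ C :=
      convexHull_min (Set.union_subset (Set.singleton_subset_iff.2 hzero)
        (Set.inter_subset_right.trans hcone)) hCconv hcv
    -- The conflict-free expression of the point and the tree combination of its contraction agree
    -- on R(π), so the former uses only tree boxes; its remaining boxes are essential, hence tree
    -- boxes as well.
    have heq := h.eq_of_contraction_eq hfΛ (fun p hp => treeBoxes_subset (hgS p hp))
      (fun p _ => hf0 p) (fun p _ => hg0 p) hff
      (fun p q hp hq => hcf p (hgS p hp) q (hgS q hq)) ((congrArg _ hfc).trans hg.symm)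
    refine mem_convexHull_weight_iff.2 ⟨f, hf0, fun p hp => ?_,
      (sum_eq_of_weightSum_eq hfc).trans hc1, hfc⟩
    rcases h.mem_essentialSet_or_mem_regionR (hfΛ p hp) with he | hR
    · exact Finset.mem_filter.2 ⟨hfΛ p hp, Or.inl he⟩
    · exact hgS p (heq p hR ▸ hp)
  · rintro _ ⟨p, hp, rfl⟩
    obtain ⟨hpS, he | ⟨i, j, hi, hj, hadj⟩⟩ := Finset.mem_filter.1 hp
    · refine subset_convexHull ℝ _ (Or.inl ?_)
      exact h.contraction_weight_of_mem_essentialSet he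
    · have hij : i < j := lt_of_le_of_ne (by
        have := h.stepLabel_inr_le_inl hpS
        rw [hi, hj] at this
        exact this) hadj.ne
      refine subset_convexHull ℝ _ (Or.inr ⟨⟨i, j, hij, h.contraction_weight_eq_rootVec hi hj⟩, ?_⟩)
      rw [h.contraction_weight_eq_rootVec hi hj]
      refine ⟨fun k l => if k = i ∧ l = j then 1 else 0, fun k l => ?_, fun k l hkl => ?_, ?_⟩
      · change (0 : ℝ) ≤ if k = i ∧ l = j then 1 else 0
        split_ifs <;> norm_num
      · refine if_neg ?_
        rintro ⟨rfl, rfl⟩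
        exact hkl ⟨hij, hadj⟩
      · rw [Finset.sum_eq_single i, Finset.sum_eq_single j] <;> simp +contextual

/-- The conflict-free complex is the canonical triangulation of the moment polytope. -/
theorem isCanonicalTriangulation :
    IsCanonicalTriangulation π (conflictFreeComplex (shape π)) where
  space_eq := by rw [space_conflictFreeComplex isLowerSet_shape, h.momentPolytope_eq]
  cells_eq := by
    classical
    ext P
    constructor
    · rintro ⟨s, hs, rfl⟩
      obtain ⟨F, hF, hsF⟩ := (mem_conflictFreeComplex_facets h.zero_mem_shape).1 hs
      obtain ⟨S, hle, hS, hnc, halt, rfl⟩ := h.exists_treeBoxes_eq hF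
      exact ⟨_, ⟨S, hle, hS, hnc, halt, rfl⟩, by
        rw [hsF]; exact (h.momentPolytope_inter_preimage hle hnc halt).symm⟩
    · rintro ⟨_, ⟨S, hle, hS, hnc, halt, rfl⟩, rfl⟩
      refine ⟨(treeBoxes π S).image weight, (mem_conflictFreeComplex_facets h.zero_mem_shape).2
        ⟨_, h.isMaxConflictFree_treeBoxes hle hS hnc halt, by simp⟩, ?_⟩
      rw [Finset.coe_image]
      exact h.momentPolytope_inter_preimage hle hnc halt

/-- The conflict-free complex is a geometric realization of the cone over the core, the boxes of the
essential set and the north-west box being the cone points. -/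
theorem isGeometricRealization : IsGeometricRealization (conflictFreeComplex (shape π))
    (iteratedCone (core π) ((essentialSet π).card + 1)) := by
  classical
  have h0 : ((0, 0) : Box (n + 1)) ∉ essentialSet π := fun h' =>
    (h.ne_zero_of_mem_essentialSet h').1 rfl
  -- The new vertices of the cone enumerate the origin and the essential boxes. The origin is not
  -- essential, whence the `+ 1`.
  let e : Fin ((essentialSet π).card + 1) ≃ (insert (0, 0) (essentialSet π) : Finset (Box (n + 1))) :=
    (finCongr (Finset.card_insert_of_notMem h0).symm).trans (Finset.equivFin _).symm
  let β : TriBox n ⊕ Fin ((essentialSet π).card + 1) → Box (n + 1) :=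
    Sum.elim Subtype.val fun k => (e k).1
  have hcone : ∀ k q, ¬ Conflict (shape π) (e k).1 q ∧ ¬ Conflict (shape π) q (e k).1 := by
    intro k q
    rcases Finset.mem_insert.1 (e k).2 with h' | h'
    · rw [h']; exact not_conflict_zero _ _
    · exact not_conflict_of_maximal (h.mem_essentialSet_iff.1 h').2 q
  have hconeS : ∀ k, (e k).1 ∈ shape π := by
    intro k
    rcases Finset.mem_insert.1 (e k).2 with h' | h'
    · rw [h']; exact h.zero_mem_shape
    · exact h.mem_shape_of_mem_essentialSet h'
  have hconecr : ∀ k, (e k).1 ∉ coreRegion π := by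
    intro k hk
    obtain ⟨-, ⟨q, hq, hlt⟩, hne⟩ := h.mem_coreRegion_iff.1 hk
    rcases Finset.mem_insert.1 (e k).2 with h' | h'
    · exact hne h'
    · exact h.not_lt_of_mem_essentialSet h' hq hlt
  have hface : ∀ F : Finset (TriBox n ⊕ Fin ((essentialSet π).card + 1)),
      F ∈ (iteratedCone (core π) ((essentialSet π).card + 1)).faces ↔ F.Nonempty ∧
        (∀ v : TriBox n, Sum.inl v ∈ F → v.1 ∈ coreRegion π) ∧
        ConflictFree (shape π) (F.image β) := by
    intro F
    change (F.Nonempty ∧ (F.toLeft = ∅ ∨ F.toLeft ∈ (core π).faces)) ↔ _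
    refine and_congr_right fun _ => ?_
    have hiff : (F.toLeft = ∅ ∨ F.toLeft ∈ (core π).faces) ↔
        (∀ v ∈ F.toLeft, v.1 ∈ coreRegion π) ∧
          ∀ u ∈ F.toLeft, ∀ v ∈ F.toLeft, ¬ Conflict (shape π) u.1 v.1 := by
      rw [h.mem_core_faces_iff]
      constructor
      · rintro (h' | h')
        · simp [h']
        · exact h'.2
      · intro h'
        rcases F.toLeft.eq_empty_or_nonempty with he | hne
        · exact Or.inl he
        · exact Or.inr ⟨hne, h'⟩
    rw [hiff]
    simp only [Finset.mem_toLeft]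
    refine and_congr_right fun _ => ⟨fun hc => ?_, fun hc u hu v hv =>
      hc u.1 (Finset.mem_image_of_mem β hu) v.1 (Finset.mem_image_of_mem β hv)⟩
    intro p hp q hq
    obtain ⟨x, hx, rfl⟩ := Finset.mem_image.1 hp
    obtain ⟨y, hy, rfl⟩ := Finset.mem_image.1 hq
    rcases x with u | k
    · rcases y with v | l
      · exact hc u hx v hy
      · exact (hcone l _).2
    · exact (hcone k _).1
  refine ⟨fun x => weight (β x), ?_, ?_⟩
  · intro x hx y hy hxy
    have hxy : β x = β y := weight_injective hxy
    have hx := ((hface _).1 hx).2.1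
    have hy := ((hface _).1 hy).2.1
    rcases x with u | k <;> rcases y with v | l
    · exact congrArg Sum.inl (Subtype.ext hxy)
    · refine absurd (hx u (by simp)) ?_
      rw [show u.1 = (e l).1 from hxy]
      exact hconecr l
    · refine absurd (hy v (by simp)) ?_
      rw [show v.1 = (e k).1 from hxy.symm]
      exact hconecr k
    · exact congrArg Sum.inr (e.injective (Subtype.ext hxy))
  · ext s
    rw [mem_conflictFreeComplex_faces]
    constructor
    · rintro ⟨F, hne, hFS, hF, hsF⟩
      -- The origin and possibly some essential boxes are also boxes of the staircase, so the
      -- preimage under `β` must be chosen: a cone point for these, a core vertex for all others.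
      have hsurj : ∀ p ∈ shape π, ∃ x, β x = p ∧ ∀ v, x = Sum.inl v → v.1 ∈ coreRegion π := by
        intro p hp
        by_cases hpe : p ∈ insert (0, 0) (essentialSet π)
        · exact ⟨Sum.inr (e.symm ⟨p, hpe⟩), by simp [β], fun v hv => by simp at hv⟩
        · rw [Finset.mem_insert, not_or] at hpe
          have hR := (h.mem_essentialSet_or_mem_regionR hp).resolve_left hpe.2
          refine ⟨Sum.inl ⟨p, h.add_lt_of_mem_regionR hR⟩, rfl, fun v hv => ?_⟩
          obtain rfl := Sum.inl_injective hv
          exact h.mem_coreRegion_iff.2 ⟨hp, (h.mem_regionR_iff.1 hR).2, hpe.1⟩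
      choose! γ hγ hγcr using hsurj
      have himg : (F.image γ).image β = F := by
        rw [Finset.image_image]
        exact (Finset.image_congr fun p hp => hγ p (hFS hp)).trans Finset.image_id
      refine ⟨F.image γ, (hface _).2 ⟨hne.image _, fun v hv => ?_, by rwa [himg]⟩, ?_⟩
      · obtain ⟨p, hp, hpv⟩ := Finset.mem_image.1 hv
        exact hγcr p (hFS hp) v hpv
      · rw [← Finset.coe_inj, hsF]
        conv_rhs => rw [← himg]
        simp only [Finset.coe_image, Set.image_image]
    · rintro ⟨F, hF, rfl⟩
      obtain ⟨hne, hcr, hc⟩ := (hface F).1 hF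
      refine ⟨F.image β, hne.image _, fun p hp => ?_, hc, by
        simp only [Finset.coe_image, Set.image_image]⟩
      obtain ⟨x, hx, rfl⟩ := Finset.mem_image.1 hp
      rcases x with v | k
      · exact (h.mem_coreRegion_iff.1 (hcr v hx)).1
      · exact hconeS k

end IsShiftedDominant

end Triangulation

end SchubertCore

theorem theorem5p8 (n : ℕ) (π' : Equiv.Perm (Fin n)) (hdom : SchubertCore.IsDominant π')
    (hne : π' ≠ 1) :
    ∃ K : Geometry.SimplicialComplex ℝ (Fin (n + 1) ⊕ Fin (n + 1) → ℝ),
      SchubertCore.IsCanonicalTriangulation (SchubertCore.oneCons π') K ∧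
      SchubertCore.IsGeometricRealization K
        (SchubertCore.iteratedCone (SchubertCore.core (SchubertCore.oneCons π'))
          ((SchubertCore.essentialSet (SchubertCore.oneCons π')).card + 1)) :=
  have h := SchubertCore.isShiftedDominant_oneCons hdom hne
  ⟨_, h.isCanonicalTriangulation, h.isGeometricRealization⟩
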